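/- Let $\alpha,\gamma\in\mathbb R$ with $\max(-\alpha,0)<\gamma<1/4$, and let $g\in L_2(\mathbb R)$ be complex-valued. Let $J_\nu,Y_\nu,K_\nu$ denote the Bessel functions of the first and second kind and the Macdonald function, put $$\mathcal W_\alpha(x,\tau)=\frac{\operatorname{Im}\left[J_{\alpha+i\tau}(\sqrt x)\,Y_{\alpha-i\tau}(\sqrt x)\right]}{\sinh(\pi\tau)},\qquad (G_\alpha g)(x)=\int_{-\infty}^{\infty}\mathcal W_\alpha(x,\tau)\,g(\tau)\,d\tau,\qquad x>0,$$ and let $f^*(s)=\int_0^\infty f(x)x^{s-1}\,dx$ be the Mellin transform. Then the integral defining $(G_\alpha g)(x)$ converges absolutely for every $x>0$, the function $x^\gamma (G_\alpha g)(x)$ is bounded and continuous on $(0,\infty)$, and $$\sup_{x>0}\left|x^\gamma (G_\alpha g)(x)\right|\le C\,\|g\|_{L_2(\mathbb R)},$$ with the finite constant $$C=\frac{1}{2\pi^{7/4}}\left[\Gamma\left(\tfrac12-2\gamma\right)\Gamma(2\gamma)\right]^{1/2}\int_{\gamma-i\infty}^{\gamma+i\infty}\left|\frac{\Gamma(s+\alpha)}{\sin(\pi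 s)\,\Gamma(1+\alpha-s)}\,ds\right|.$$ If, in addition, $\int_0^\infty |(G_\alpha g)(x)|\,x^{\gamma-1}\,dx<\infty$ and $|s|^{1/2-\gamma}e^{\pi|s|/2}(G_\alpha g)^*(s)\in L_1(\gamma-i\infty,\gamma+i\infty)$, then for every $y>0$ $$\frac1{2\pi i}\int_{\gamma-i\infty}^{\gamma+i\infty}\frac{\Gamma(1+\alpha-s)}{\Gamma(\alpha+s)\,\Gamma(1-s)}\,(G_\alpha g)^*(s)\,y^{-s}\,ds=\frac1{\pi^2}\int_{-\infty}^{\infty}e^{y/2}K_{i\tau}\left(\tfrac y2\right)g(\tau)\,d\tau,$$ where both integrals converge absolutely. -/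

import Mathlib

open MeasureTheory Set Filter Topology

noncomputable section

namespace WeberIndex

/-- Bessel function of the first kind of complex order `ν`:
`J_ν(z) = ∑ₖ (-1)ᵏ / (k! Γ(ν+k+1)) (z/2)^(ν+2k)`, principal branch of the power.
At a pole of `Γ` the convention `Γ = 0` gives the correct value `1/Γ = 0`. -/
def besselJ (ν z : ℂ) : ℂ :=
  ∑' k : ℕ, (-1 : ℂ) ^ k / ((k.factorial : ℂ) * Complex.Gamma (ν + k + 1)) *
    (z / 2) ^ (ν + 2 * (k : ℂ))

/-- The quotient `(J_ν(z) cos(πν) - J_{-ν}(z)) / sin(πν)`, meaningful for non-integer `ν`. -/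
def besselYQuot (ν z : ℂ) : ℂ :=
  (besselJ ν z * Complex.cos (Real.pi * ν) - besselJ (-ν) z) / Complex.sin (Real.pi * ν)

open Classical in
/-- Bessel function of the second kind: the quotient above for non-integer order and its limit
as the order tends to `ν` when `ν` is an integer. -/
def besselY (ν z : ℂ) : ℂ :=
  if Complex.sin (Real.pi * ν) = 0 then limUnder (𝓝[≠] ν) (fun μ => besselYQuot μ z)
  else besselYQuot ν z

/-- Macdonald function (modified Bessel function of the second kind) for `Re z > 0`:
`K_ν(z) = ∫₀^∞ exp(-z cosh u) cosh(ν u) du`. -/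
def besselK (ν z : ℂ) : ℂ :=
  ∫ u in Ioi (0 : ℝ), Complex.exp (-z * Real.cosh u) * Complex.cosh (ν * u)

/-- The Weber type kernel `W_α(x, τ) = Im[J_{α+iτ}(√x) Y_{α-iτ}(√x)] / sinh(πτ)`.
(Its value at `τ = 0`, where the quotient has a removable singularity, is irrelevant for
integrals with respect to `τ`.) -/
def weberKernel (α x τ : ℝ) : ℝ :=
  (besselJ (α + Complex.I * τ) (Real.sqrt x) * besselY (α - Complex.I * τ) (Real.sqrt x)).im /
    Real.sinh (Real.pi * τ)

/-- The index transform `(G_α g)(x) = ∫_{-∞}^{∞} W_α(x, τ) g(τ) dτ`. -/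
def indexG (α : ℝ) (g : ℝ → ℂ) (x : ℝ) : ℂ :=
  ∫ τ : ℝ, (weberKernel α x τ : ℂ) * g τ

/-- The point `γ + i t` of the vertical line `Re s = γ`. -/
def vline (γ t : ℝ) : ℂ := γ + t * Complex.I

/-- `f ∈ L_{γ,1}(ℝ₊)`: `∫₀^∞ |f(x)| x^(γ-1) dx < ∞`. -/
def MemLWeighted (γ : ℝ) (f : ℝ → ℂ) : Prop :=
  IntegrableOn (fun x : ℝ => ((x ^ (γ - 1) : ℝ) : ℂ) * f x) (Ioi 0)

/-- `|s|^(1/2-γ) exp(π|s|/2) f*(s) ∈ L₁(γ - i∞, γ + i∞)`, with `f*` the Mellin transform of `f`. -/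
def MellinDecay (γ : ℝ) (f : ℝ → ℂ) : Prop :=
  Integrable (fun t : ℝ =>
    ((‖vline γ t‖ ^ (1 / 2 - γ) * Real.exp (Real.pi * ‖vline γ t‖ / 2) : ℝ) : ℂ) *
      mellin f (vline γ t))

/-- The multiplier `Γ(1+α-s) / (Γ(α+s) Γ(1-s))`. -/
def multiplier (α : ℝ) (s : ℂ) : ℂ :=
  Complex.Gamma (1 + α - s) / (Complex.Gamma (α + s) * Complex.Gamma (1 - s))

/-- `|Γ(s+α) / (sin(πs) Γ(1+α-s))|` at `s = γ + i t`. -/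
def constIntegrand (α γ t : ℝ) : ℝ :=
  ‖Complex.Gamma (vline γ t + α) /
    (Complex.sin (Real.pi * vline γ t) * Complex.Gamma (1 + α - vline γ t))‖

/-- `C = (1 / (2 π^(7/4))) [Γ(1/2-2γ) Γ(2γ)]^(1/2) ∫_{Re s = γ} |Γ(s+α)/(sin(πs) Γ(1+α-s)) ds|`. -/
def boundConst (α γ : ℝ) : ℝ :=
  1 / (2 * Real.pi ^ (7 / 4 : ℝ)) *
    Real.sqrt (Real.Gamma (1 / 2 - 2 * γ) * Real.Gamma (2 * γ)) *
    ∫ t : ℝ, constIntegrand α γ t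

end WeberIndex

end

open WeberIndex

/-!
The Fourier transform in `τ` diagonalizes the problem. Everything rests on the representation

  `2π W_α(x, τ) = ∫ e^{-2πivτ} F(x sinh²(πv)) dv`,
  `F(z) = ∫ Γ(s+α) / (sin(πs) Γ(1+α-s)) z^{-s} dt` with `s = γ + it`, valid for `τ ≠ 0`

(`fourier_lineMellin_gammaQuot`), in which the variables `x` and `τ` are separated. Since
`|F(z)| ≤ z^{-γ} ∫ constIntegrand` and `sinh(πv)^{-2γ}` is square integrable for `γ < 1/4`,
Plancherel's theorem replaces `g` by some `h ∈ L²` of the same norm and gives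

  `(G_α g)(x) = (2π)⁻¹ ∫ F(x sinh²(πv)) h(v) dv`  (`indexG_eq_integral`).

Absolute convergence, continuity and the bound follow. Hölder's inequality yields the constant
exactly as claimed, because `∫ sinh(πv)^{-4γ} dv` is a beta integral (`integral_sinhSq_rpow`).

The representation comes from the Mellin–Barnes integral of the Weber kernel
(`weberKernel_eq_integral_barnes`). The contour is closed to the left, a residue theorem for
vertical strips (`integral_line_sub_integral_line`) together with exponential bounds for `Γ` giving
three series of residues, at `±iτ - k` and `-α - k`. By the Chu–Vandermonde identity these are the
series of the products `J_ν J_{-ν'}`, `J_{ν'} J_{-ν}` and `J_ν J_{ν'}` (with `ν = α + iτ` and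
`ν' = α - iτ`) that make up the kernel. The Mellin–Barnes
integrand contains the Fourier transform of `sinh(πv)^{-2s}`, a beta integral in `e^{-2πv}`
(`integral_exp_mul_sinhSq_cpow`), and Fubini's theorem finishes.

For the inversion formula, the last display exhibits `G_α g` as an inverse Mellin transform, so its
Mellin transform on the line is `Γ(s+α) / (sin(πs) Γ(1+α-s)) ∫ sinh(πv)^{-2s} h(v) dv`
(`mellin_indexG`). The multiplier cancels all but `Γ(s) / π` of the first factor, and `Γ(s)` is the
Mellin transform of `e^{-x}`. The left side of the formula is therefore
`π⁻¹ ∫ exp(-y sinh²(πv)) h(v) dv`. The Fourier transform of `exp(-y sinh²(πv))` is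
`π⁻¹ e^{y/2} K_{iτ}(y/2)` (`fourier_exp_neg_sinhSq`), so Plancherel's theorem gives the right side.
-/

open WeberIndex

/-! ### Exponential bounds for the Gamma function in vertical strips -/

/-- Euler's integral along a rotated ray, obtained from the real case by analytic continuation
in `r`. -/
theorem integral_cpow_mul_exp_neg_mul_of_re_pos {a r : ℂ} (ha : 0 < a.re) (hr : 0 < r.re) :
    ∫ t : ℝ in Ioi 0, (t : ℂ) ^ (a - 1) * Complex.exp (-(r * t)) =
      r ^ (-a) * Complex.Gamma a := by
  have hopen : IsOpen {z : ℂ | 0 < z.re} := isOpen_lt continuous_const Complex.continuous_re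
  have hconv : IsPreconnected {z : ℂ | 0 < z.re} := (convex_halfSpace_re_gt 0).isPreconnected
  have hnorm : ∀ (z : ℂ) (t : ℝ), t ∈ Ioi (0 : ℝ) →
      ‖(t : ℂ) ^ (a - 1) * Complex.exp (-(z * t))‖ = t ^ (a.re - 1) * Real.exp (-(z.re * t)) := by
    intro z t ht
    rw [norm_mul, Complex.norm_cpow_eq_rpow_re_of_pos ht, Complex.norm_exp]
    simp
  have hmeas : ∀ z : ℂ, AEStronglyMeasurable
      (fun t : ℝ => (t : ℂ) ^ (a - 1) * Complex.exp (-(z * t))) (volume.restrict (Ioi 0)) := by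
    intro z
    apply ContinuousOn.aestronglyMeasurable _ measurableSet_Ioi
    intro t ht
    apply ContinuousAt.continuousWithinAt
    apply ContinuousAt.mul
    · exact (Complex.continuousAt_ofReal_cpow_const t (a - 1) (Or.inr (ne_of_gt ht)))
    · fun_prop
  have hint : ∀ (b c : ℝ), 0 < c → 0 < b →
      IntegrableOn (fun t : ℝ => t ^ (b - 1) * Real.exp (-(c * t))) (Ioi 0) := by
    intro b c hc hb
    have := integrableOn_rpow_mul_exp_neg_mul_rpow (p := 1) (s := b - 1) (by linarith)
      one_pos hc
    simpa [neg_mul] using this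
  have hd : DifferentiableOn ℂ (fun z : ℂ => ∫ t : ℝ in Ioi 0,
      (t : ℂ) ^ (a - 1) * Complex.exp (-(z * t))) {z : ℂ | 0 < z.re} := by
    intro z hz
    have hz' : 0 < z.re := hz
    refine (DifferentiableAt.differentiableWithinAt ?_)
    have := hasDerivAt_integral_of_dominated_loc_of_deriv_le (μ := volume.restrict (Ioi (0:ℝ)))
      (F := fun (w : ℂ) (t : ℝ) => (t : ℂ) ^ (a - 1) * Complex.exp (-(w * t)))
      (F' := fun (w : ℂ) (t : ℝ) => (t : ℂ) ^ (a - 1) * (Complex.exp (-(w * t)) * (-t)))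
      (x₀ := z) (s := {w : ℂ | z.re / 2 < w.re})
      (bound := fun t => t ^ (a.re + 1 - 1) * Real.exp (-(z.re / 2 * t)))
      ((isOpen_lt continuous_const Complex.continuous_re).mem_nhds (by
        simp only [mem_ofPred_eq]; linarith))
      (Eventually.of_forall hmeas) ?_ ?_ ?_ ?_ ?_
    · exact this.2.differentiableAt
    · have h := hint a.re z.re hz' ha
      refine Integrable.mono' h (hmeas z) ?_
      filter_upwards [ae_restrict_mem measurableSet_Ioi] with t ht
      rw [hnorm z t ht]
    · have : (fun t : ℝ => (t : ℂ) ^ (a - 1) * (Complex.exp (-(z * t)) * (-t))) =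
        fun t : ℝ => ((t : ℂ) ^ (a - 1) * Complex.exp (-(z * t))) * (-(t : ℂ)) := by
        ext t; ring
      rw [this]
      exact (hmeas z).mul (Continuous.aestronglyMeasurable (by fun_prop))
    · filter_upwards [ae_restrict_mem measurableSet_Ioi] with t ht w hw
      have ht' : (0 : ℝ) < t := ht
      rw [← mul_assoc, norm_mul, hnorm w t ht, norm_neg, Complex.norm_real, Real.norm_eq_abs,
        abs_of_pos ht']
      have h1 : t ^ (a.re + 1 - 1) = t ^ (a.re - 1) * t := by
        rw [add_sub_right_comm, Real.rpow_add_one ht'.ne']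
      rw [h1, mul_right_comm]
      have hw' : z.re / 2 < w.re := hw
      gcongr
    · exact hint (a.re + 1) (z.re / 2) (by linarith) (by linarith)
    · filter_upwards with t w hw
      apply HasDerivAt.const_mul
      have : HasDerivAt (fun w : ℂ => -(w * t)) (-(1 * (t : ℂ))) w :=
        ((hasDerivAt_id w).mul_const (t : ℂ)).neg
      simpa using this.cexp
  have hd2 : DifferentiableOn ℂ (fun z : ℂ => z ^ (-a) * Complex.Gamma a) {z : ℂ | 0 < z.re} := by
    intro z hz
    refine DifferentiableAt.differentiableWithinAt (DifferentiableAt.mul_const ?_ _)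
    exact differentiableAt_id.cpow (differentiableAt_const _) (Or.inl hz)
  have key := (hd.analyticOnNhd hopen).eqOn_of_preconnected_of_frequently_eq
    (hd2.analyticOnNhd hopen) hconv (z₀ := (1 : ℂ)) (by simp) ?_
  · exact key hr
  · have hfreq : ∃ᶠ x : ℝ in 𝓝[≠] (1 : ℝ), 0 < x := by
      apply Eventually.frequently
      exact eventually_nhdsWithin_of_eventually_nhds (eventually_gt_nhds one_pos)
    have ht : Tendsto (fun x : ℝ => (x : ℂ)) (𝓝[≠] (1 : ℝ)) (𝓝[≠] (1 : ℂ)) := by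
      apply tendsto_nhdsWithin_of_tendsto_nhds_of_eventually_within
      · have : Tendsto (fun x : ℝ => (x : ℂ)) (𝓝 (1 : ℝ)) (𝓝 ((1 : ℝ) : ℂ)) :=
          Complex.continuous_ofReal.continuousAt
        simpa using this.mono_left nhdsWithin_le_nhds
      · filter_upwards [self_mem_nhdsWithin] with x hx
        simpa using hx
    refine ht.frequently (hfreq.mono ?_)
    intro x hx
    rw [Complex.integral_cpow_mul_exp_neg_mul_Ioi ha hx, one_div, Complex.inv_cpow,
      Complex.cpow_neg]
    rw [Complex.arg_ofReal_of_nonneg hx.le]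
    exact Real.pi_pos.ne

/-- `|Γ(σ + it)| ≤ Γ(σ) (cos θ)^{-σ} e^{-θ|t|}` for `0 ≤ θ < π/2`: rotate Euler's integral by the
angle `± θ`. -/
theorem norm_Gamma_le_exp {s : ℂ} (hs : 0 < s.re) {θ : ℝ} (hθ₀ : 0 ≤ θ) (hθ : θ < Real.pi / 2) :
    ‖Complex.Gamma s‖ ≤
      Real.Gamma s.re * (Real.cos θ) ^ (-s.re) * Real.exp (-(θ * |s.im|)) := by
  have aux : ∀ φ : ℝ, |φ| < Real.pi / 2 → ‖Complex.Gamma s‖ * Real.exp (φ * s.im) ≤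
      Real.Gamma s.re * (Real.cos φ) ^ (-s.re) := by
    intro φ hφ
    have hcos : 0 < Real.cos φ := Real.cos_pos_of_mem_Ioo (by
      rw [abs_lt] at hφ; exact ⟨by linarith, hφ.2⟩)
    set r : ℂ := Complex.exp (φ * Complex.I) with hrdef
    have hre : r.re = Real.cos φ := by
      rw [hrdef, Complex.exp_ofReal_mul_I_re]
    have h := integral_cpow_mul_exp_neg_mul_of_re_pos (a := s) (r := r) hs (by rw [hre]; exact hcos)
    have hn : ‖r ^ (-s)‖ = Real.exp (φ * s.im) := by
      rw [Complex.norm_cpow_of_ne_zero (Complex.exp_ne_zero _)]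
      have harg : r.arg = φ := by
        rw [hrdef, Complex.arg_exp_mul_I]
        rw [toIocMod_eq_self]
        rw [abs_lt] at hφ
        constructor <;> linarith [Real.pi_pos]
      rw [harg, Complex.norm_exp_ofReal_mul_I, Real.one_rpow, one_div, ← Real.exp_neg]
      simp
    have h2 := congrArg norm h
    rw [norm_mul, hn] at h2
    rw [mul_comm, ← h2]
    have h3 := Real.integral_rpow_mul_exp_neg_mul_Ioi hs hcos
    calc _ ≤ ∫ t : ℝ in Ioi 0, ‖(t : ℂ) ^ (s - 1) * Complex.exp (-(r * t))‖ :=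
          norm_integral_le_integral_norm _
      _ = ∫ t : ℝ in Ioi 0, t ^ (s.re - 1) * Real.exp (-(Real.cos φ * t)) := by
          apply setIntegral_congr_fun measurableSet_Ioi
          intro t ht
          simp only
          rw [norm_mul, Complex.norm_cpow_eq_rpow_re_of_pos ht, Complex.norm_exp]
          simp [hre]
      _ = _ := by
          rw [h3, one_div, Real.inv_rpow hcos.le, ← Real.rpow_neg hcos.le]; ring
  have habs : |θ| < Real.pi / 2 := by rwa [abs_of_nonneg hθ₀]
  rcases le_total 0 s.im with him | him
  · have := aux θ habs
    rw [abs_of_nonneg him, Real.exp_neg, ← div_eq_mul_inv, le_div_iff₀ (Real.exp_pos _)]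
    exact this
  · have := aux (-θ) (by rwa [abs_neg])
    rw [abs_of_nonpos him, Real.exp_neg, ← div_eq_mul_inv, le_div_iff₀ (Real.exp_pos _)]
    rwa [Real.cos_neg, neg_mul, ← mul_neg] at this

/-- Moving to the right only increases `|Γ|` as long as `|Im s| ≥ 1`. -/
theorem norm_Gamma_le_norm_Gamma_add_nat {s : ℂ} (hs : 1 ≤ |s.im|) (n : ℕ) :
    ‖Complex.Gamma s‖ ≤ ‖Complex.Gamma (s + n)‖ := by
  induction n with
  | zero => simp
  | succ n ih =>
    refine ih.trans ?_
    have him : (s + n).im = s.im := by simp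
    have h1 : 1 ≤ ‖s + n‖ := by
      refine hs.trans ?_
      rw [← him]; exact Complex.abs_im_le_norm _
    have h0 : s + n ≠ 0 := by
      intro h; rw [h, norm_zero] at h1; linarith
    have : s + ((n + 1 : ℕ) : ℂ) = (s + n) + 1 := by push_cast; ring
    rw [this, Complex.Gamma_add_one _ h0, norm_mul]
    exact le_mul_of_one_le_left (norm_nonneg _) h1

/-- Decay of `Γ` in vertical strips, at any exponential rate below the true rate `π/2`. -/
theorem exists_norm_Gamma_le (a b : ℝ) {θ : ℝ} (hθ₀ : 0 ≤ θ) (hθ : θ < Real.pi / 2) :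
    ∃ C, 0 ≤ C ∧ ∀ s : ℂ, a ≤ s.re → s.re ≤ b → 1 ≤ |s.im| →
      ‖Complex.Gamma s‖ ≤ C * Real.exp (-(θ * |s.im|)) := by
  obtain ⟨n, hn⟩ := exists_nat_gt (1 - a)
  have hcos : 0 < Real.cos θ := Real.cos_pos_of_mem_Ioo ⟨by linarith [Real.pi_pos], hθ⟩
  have hcont : ContinuousOn (fun σ : ℝ => Real.Gamma σ * (Real.cos θ) ^ (-σ)) (Icc 1 (b + n)) := by
    intro σ hσ
    apply ContinuousAt.continuousWithinAt
    apply ContinuousAt.mul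
    · apply (Real.differentiableAt_Gamma _).continuousAt
      intro m
      have h1 : 1 ≤ σ := hσ.1
      have h2 : (0 : ℝ) ≤ m := m.cast_nonneg
      intro h
      linarith
    · exact (continuousAt_const.rpow continuousAt_neg (Or.inl hcos.ne'))
  obtain ⟨C, hC⟩ := isCompact_Icc.exists_bound_of_continuousOn hcont
  refine ⟨max C 0, le_max_right _ _, fun s h1 h2 h3 => ?_⟩
  have hre : (s + n).re = s.re + n := by simp
  have him : (s + n).im = s.im := by simp
  refine (norm_Gamma_le_norm_Gamma_add_nat h3 n).trans ?_
  have hpos : 1 ≤ (s + n).re := by rw [hre]; linarith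
  refine (norm_Gamma_le_exp (by linarith) hθ₀ hθ).trans ?_
  rw [him]
  gcongr
  refine le_trans ?_ (le_max_left C 0)
  exact (le_abs_self _).trans (hC _ ⟨hpos, by rw [hre]; linarith⟩)

theorem norm_sin_le_exp (s : ℂ) : ‖Complex.sin s‖ ≤ Real.exp |s.im| := by
  have h : Complex.sin s = (Complex.exp (-s * Complex.I) - Complex.exp (s * Complex.I)) *
    Complex.I / 2 := rfl
  rw [h, norm_div, norm_mul, Complex.norm_I, mul_one]
  have h1 := norm_sub_le (Complex.exp (-s * Complex.I)) (Complex.exp (s * Complex.I))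
  rw [Complex.norm_exp, Complex.norm_exp] at h1
  have e1 : (-s * Complex.I).re = s.im := by simp
  have e2 : (s * Complex.I).re = -s.im := by simp
  rw [e1, e2] at h1
  have h2 := Real.exp_le_exp.2 (le_abs_self s.im)
  have h3 := Real.exp_le_exp.2 (neg_le_abs s.im)
  have : ‖(2 : ℂ)‖ = 2 := by simp
  rw [this]
  linarith

/-- Growth of `1/Γ` in vertical strips, by the reflection formula. -/
theorem exists_norm_Gamma_inv_le (a b : ℝ) {θ : ℝ} (hθ₀ : 0 ≤ θ) (hθ : θ < Real.pi / 2) :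
    ∃ C, 0 ≤ C ∧ ∀ s : ℂ, a ≤ s.re → s.re ≤ b → 1 ≤ |s.im| →
      ‖(Complex.Gamma s)⁻¹‖ ≤ C * Real.exp ((Real.pi - θ) * |s.im|) := by
  obtain ⟨C, hC0, hC⟩ := exists_norm_Gamma_le (1 - b) (1 - a) hθ₀ hθ
  refine ⟨C, hC0, fun s h1 h2 h3 => ?_⟩
  have him0 : s.im ≠ 0 := by
    intro h; rw [h, abs_zero] at h3; linarith
  have hG : Complex.Gamma s ≠ 0 := Complex.Gamma_ne_zero (fun m h => him0 (by rw [h]; simp))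
  have hs1 : Complex.sin (Real.pi * s) ≠ 0 := by
    rw [Ne, Complex.sin_eq_zero_iff]
    rintro ⟨k, hk⟩
    have := congrArg Complex.im hk
    simp [Real.pi_ne_zero] at this
    exact him0 this
  have h := Complex.Gamma_mul_Gamma_one_sub s
  have h' : (Complex.Gamma s)⁻¹ =
      Complex.Gamma (1 - s) * Complex.sin (Real.pi * s) / Real.pi := by
    have hpi : (Real.pi : ℂ) ≠ 0 := by exact_mod_cast Real.pi_ne_zero
    rw [eq_div_iff hs1] at h
    apply inv_eq_of_mul_eq_one_right
    rw [mul_div_assoc', div_eq_one_iff_eq hpi]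
    linear_combination h
  rw [h', norm_div, norm_mul]
  have e1 := hC (1 - s) (by simp; linarith) (by simp; linarith) (by simpa using h3)
  have e2 := norm_sin_le_exp (Real.pi * s)
  have e3 : ((Real.pi : ℂ) * s).im = Real.pi * s.im := by simp
  rw [e3, abs_mul, abs_of_pos Real.pi_pos] at e2
  have e4 : |(1 - s).im| = |s.im| := by simp
  rw [e4] at e1
  have e5 : ‖(Real.pi : ℂ)‖ = Real.pi := by simp [abs_of_pos Real.pi_pos]
  rw [e5]
  have hpi1 : 1 ≤ Real.pi := by linarith [Real.pi_gt_three]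
  calc _ ≤ ‖Complex.Gamma (1 - s)‖ * ‖Complex.sin (Real.pi * s)‖ :=
        div_le_self (by positivity) hpi1
    _ ≤ (C * Real.exp (-(θ * |s.im|))) * Real.exp (Real.pi * |s.im|) := by gcongr
    _ = _ := by rw [mul_assoc, ← Real.exp_add]; ring_nf

/-- `Γ` has a simple pole at `-k` with residue `(-1)^k / k!`. -/
theorem tendsto_add_nat_mul_Gamma (k : ℕ) :
    Tendsto (fun s : ℂ => (s + k) * Complex.Gamma s) (𝓝[≠] (-(k : ℂ)))
      (𝓝 ((-1) ^ k / (k.factorial : ℂ))) := by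
  induction k with
  | zero => simpa using Complex.tendsto_self_mul_Gamma_nhds_zero
  | succ k ih =>
    have hk : (-((k + 1 : ℕ) : ℂ)) ≠ 0 := by
      rw [neg_ne_zero]; exact_mod_cast k.succ_ne_zero
    have hshift : Tendsto (fun s : ℂ => s + 1) (𝓝[≠] (-((k + 1 : ℕ) : ℂ))) (𝓝[≠] (-(k : ℂ))) := by
      apply tendsto_nhdsWithin_of_tendsto_nhds_of_eventually_within
      · have : Tendsto (fun s : ℂ => s + 1) (𝓝 (-((k + 1 : ℕ) : ℂ)))
            (𝓝 (-((k + 1 : ℕ) : ℂ) + 1)) := by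
          apply Continuous.tendsto; fun_prop
        have e : (-((k + 1 : ℕ) : ℂ) + 1) = -(k : ℂ) := by push_cast; ring
        rw [e] at this
        exact this.mono_left nhdsWithin_le_nhds
      · filter_upwards [self_mem_nhdsWithin] with s hs h
        apply hs
        simp only [mem_singleton_iff] at h ⊢
        push_cast
        linear_combination h
    have h1 := ih.comp hshift
    have h2 : Tendsto (fun s : ℂ => s⁻¹) (𝓝[≠] (-((k + 1 : ℕ) : ℂ)))
        (𝓝 (-((k + 1 : ℕ) : ℂ))⁻¹) := (tendsto_inv₀ hk).mono_left nhdsWithin_le_nhds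
    have h3 := h1.mul h2
    have e : (-1 : ℂ) ^ k / (k.factorial : ℂ) * (-((k + 1 : ℕ) : ℂ))⁻¹ =
        (-1) ^ (k + 1) / ((k + 1).factorial : ℂ) := by
      have h4 : ((k + 1 : ℕ) : ℂ) ≠ 0 := by exact_mod_cast k.succ_ne_zero
      have h5 : (k.factorial : ℂ) ≠ 0 := by exact_mod_cast k.factorial_ne_zero
      rw [Nat.factorial_succ, Nat.cast_mul, inv_neg]
      field_simp
      ring
    rw [e] at h3
    refine h3.congr' ?_
    have hne : ∀ᶠ s : ℂ in 𝓝[≠] (-((k + 1 : ℕ) : ℂ)), s ≠ 0 :=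
      nhdsWithin_le_nhds (isOpen_ne.mem_nhds hk)
    filter_upwards [hne] with s hs
    simp only [Function.comp]
    rw [Complex.Gamma_add_one s hs]
    push_cast
    field_simp
    ring

/-! ### The residue theorem for a vertical strip -/

/-- `f` is `O(|Im s|⁻²)` in the closed strip `a ≤ Re s ≤ b`. -/
def VerticalDecay (f : ℂ → ℂ) (a b : ℝ) : Prop :=
  ∃ C T : ℝ, ∀ s : ℂ, a ≤ s.re → s.re ≤ b → T ≤ |s.im| → ‖f s‖ ≤ C / s.im ^ 2

theorem integrable_of_continuous_of_norm_le_div_sq {φ : ℝ → ℂ} (hφ : Continuous φ) {C T : ℝ}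
    (h : ∀ t, T ≤ |t| → ‖φ t‖ ≤ C / t ^ 2) : Integrable φ := by
  set R := max T 1 with hR
  obtain ⟨M, hM⟩ := (isCompact_Icc (a := -R) (b := R)).exists_bound_of_continuousOn
    hφ.continuousOn
  have hR1 : 1 ≤ R := le_max_right _ _
  have hM0 : 0 ≤ M := (norm_nonneg _).trans (hM 0 ⟨by linarith, by linarith⟩)
  set K := max (M * (1 + R ^ 2)) (2 * |C|) with hK
  refine Integrable.mono' (integrable_inv_one_add_sq.const_mul K) hφ.aestronglyMeasurable
    (Eventually.of_forall fun t => ?_)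
  have hpos : 0 < 1 + t ^ 2 := by positivity
  rw [← div_eq_mul_inv, le_div_iff₀ hpos]
  rcases le_total |t| R with ht | ht
  · refine le_trans ?_ (le_max_left _ _)
    have h1 := hM t (abs_le.1 ht)
    have h2 : t ^ 2 ≤ R ^ 2 := sq_le_sq' (abs_le.1 ht).1 (abs_le.1 ht).2
    gcongr
  · refine le_trans ?_ (le_max_right _ _)
    have h1 := h t ((le_max_left _ _).trans ht)
    have h2 : 1 ≤ t ^ 2 := by
      rw [← sq_abs]; nlinarith
    have h3 : ‖φ t‖ ≤ |C| / t ^ 2 := h1.trans (by gcongr; exact le_abs_self C)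
    rw [le_div_iff₀ (by linarith)] at h3
    nlinarith [norm_nonneg (φ t)]

theorem VerticalDecay.integrable_line {f : ℂ → ℂ} {a b c : ℝ} (h : VerticalDecay f a b)
    (hac : a ≤ c) (hcb : c ≤ b) (hf : ∀ t : ℝ, ContinuousAt f (c + t * Complex.I)) :
    Integrable (fun t : ℝ => f (c + t * Complex.I)) := by
  obtain ⟨C, T, hC⟩ := h
  apply integrable_of_continuous_of_norm_le_div_sq (C := C) (T := T)
  · rw [continuous_iff_continuousAt]
    intro t
    exact ContinuousAt.comp (f := fun t : ℝ => (c : ℂ) + t * Complex.I) (hf t) (by fun_prop)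
  · intro t ht
    simpa using hC (c + t * Complex.I) (by simpa using hac) (by simpa using hcb) (by simpa using ht)

/-- Shifting a vertical line of integration through a region without poles. -/
theorem integral_line_eq_of_differentiable {f : ℂ → ℂ} {a b : ℝ} (hab : a ≤ b)
    (hf : ∀ s : ℂ, a ≤ s.re → s.re ≤ b → DifferentiableAt ℂ f s) (hdec : VerticalDecay f a b) :
    ∫ t : ℝ, f (b + t * Complex.I) = ∫ t : ℝ, f (a + t * Complex.I) := by
  have hb := hdec.integrable_line hab le_rfl (fun t => (hf _ (by simpa) (by simp)).continuousAt)
  have ha := hdec.integrable_line le_rfl hab (fun t => (hf _ (by simp) (by simpa)).continuousAt)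
  have tb := intervalIntegral_tendsto_integral hb tendsto_neg_atTop_atBot tendsto_id
  have ta := intervalIntegral_tendsto_integral ha tendsto_neg_atTop_atBot tendsto_id
  have hrect : ∀ T : ℝ,
      (∫ x : ℝ in a..b, f (x + (-T : ℝ) * Complex.I)) - (∫ x : ℝ in a..b, f (x + T * Complex.I)) +
      Complex.I • (∫ y : ℝ in (-T)..T, f (b + y * Complex.I)) -
      Complex.I • ∫ y : ℝ in (-T)..T, f (a + y * Complex.I) = 0 := by
    intro T
    have := Complex.integral_boundary_rect_eq_zero_of_differentiableOn f
      ((a : ℂ) + (-T : ℝ) * Complex.I) ((b : ℂ) + T * Complex.I) ?_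
    · simpa using this
    · intro s hs
      apply DifferentiableAt.differentiableWithinAt
      rw [Complex.mem_reProdIm] at hs
      have h1 := hs.1
      simp only [Complex.add_re, Complex.ofReal_re, Complex.mul_re, Complex.I_re, mul_zero,
        Complex.ofReal_im, Complex.I_im, mul_one, sub_self, add_zero, uIcc_of_le hab] at h1
      exact hf s h1.1 h1.2
  obtain ⟨C, T₀, hC⟩ := hdec
  have hsmall : ∀ ε : ℝ, |ε| = 1 → Tendsto (fun T : ℝ =>
      ∫ x : ℝ in a..b, f (x + (ε * T : ℝ) * Complex.I)) atTop (𝓝 0) := by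
    intro ε hε
    have hlim : Tendsto (fun T : ℝ => C / T ^ 2 * |b - a|) atTop (𝓝 0) := by
      have : Tendsto (fun T : ℝ => C / T ^ 2) atTop (𝓝 0) :=
        tendsto_const_nhds.div_atTop (tendsto_pow_atTop two_ne_zero)
      simpa using this.mul_const (|b - a|)
    apply squeeze_zero_norm' _ hlim
    filter_upwards [eventually_ge_atTop (max T₀ 1)] with T hT
    apply intervalIntegral.norm_integral_le_of_norm_le_const
    intro x hx
    rw [uIoc_of_le hab] at hx
    have hT0 : 0 < T := lt_of_lt_of_le one_pos ((le_max_right _ _).trans hT)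
    have h2 : |ε * T| = T := by rw [abs_mul, hε, one_mul, abs_of_pos hT0]
    have := hC (x + (ε * T : ℝ) * Complex.I) (by simpa using hx.1.le) (by simpa using hx.2) (by
      simpa [← Complex.ofReal_mul, h2] using (le_max_left _ _).trans hT)
    have h3 : ((x : ℂ) + (ε * T : ℝ) * Complex.I).im ^ 2 = T ^ 2 := by
      rw [← sq_abs]
      have : ((x : ℂ) + (ε * T : ℝ) * Complex.I).im = ε * T := by
        simp only [Complex.add_im, Complex.ofReal_im, Complex.mul_im, Complex.ofReal_re,
          Complex.I_im, mul_one, Complex.I_re, mul_zero, add_zero, zero_add]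
      rw [this, h2]
    rwa [h3] at this
  have h1 := hsmall 1 (by simp)
  have h2 := hsmall (-1) (by simp)
  simp only [one_mul, neg_mul] at h1 h2
  have h3 := ((h2.sub h1).add (tb.const_smul Complex.I)).sub (ta.const_smul Complex.I)
  have h4 : (0 : ℂ) - 0 + Complex.I • (∫ t : ℝ, f (b + t * Complex.I)) -
      Complex.I • (∫ t : ℝ, f (a + t * Complex.I)) = 0 := by
    refine tendsto_nhds_unique h3 ?_
    refine (tendsto_const_nhds (x := (0 : ℂ))).congr' (Eventually.of_forall fun T => ?_)
    exact (hrect T).symm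
  rw [sub_zero, zero_add, ← smul_sub, smul_eq_zero] at h4
  exact sub_eq_zero.1 (h4.resolve_left Complex.I_ne_zero)

/-- A rational function with simple poles at `p` (residue `1`) and `p - K` (residue `-1`). The
second pole makes it decay like `s⁻²`, so that its line integrals converge absolutely. -/
noncomputable def simplePole (p : ℂ) (K : ℝ) (s : ℂ) : ℂ := (s - p)⁻¹ - (s - p + K)⁻¹

theorem simplePole_eq {p s : ℂ} {K : ℝ} (h1 : s - p ≠ 0) (h2 : s - p + K ≠ 0) :
    simplePole p K s = K / ((s - p) * (s - p + K)) := by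
  rw [simplePole]; field_simp; ring

theorem verticalDecay_simplePole (p : ℂ) (K a b : ℝ) : VerticalDecay (simplePole p K) a b := by
  refine ⟨4 * |K|, 2 * |p.im| + 1, fun s _ _ h => ?_⟩
  have h1 : |s.im| ≤ 2 * |s.im - p.im| := by
    have := abs_sub_abs_le_abs_sub s.im p.im
    linarith [abs_nonneg p.im]
  have hs0 : 0 < |s.im| := by linarith [abs_nonneg p.im]
  have h2 : |s.im - p.im| ≤ ‖s - p‖ := by
    simpa using Complex.abs_im_le_norm (s - p)
  have h3 : |s.im - p.im| ≤ ‖s - p + K‖ := by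
    simpa using Complex.abs_im_le_norm (s - p + K)
  have h4 : 0 < |s.im - p.im| := by linarith
  have h5 : s - p ≠ 0 := norm_pos_iff.1 (by linarith)
  have h6 : s - p + K ≠ 0 := norm_pos_iff.1 (by linarith)
  rw [simplePole_eq h5 h6, norm_div, norm_mul, Complex.norm_real, Real.norm_eq_abs,
    div_le_div_iff₀ (by positivity) (by rw [← sq_abs]; positivity), ← sq_abs s.im]
  have h7 : |s.im| ^ 2 ≤ 4 * (‖s - p‖ * ‖s - p + K‖) := by
    have : |s.im - p.im| * |s.im - p.im| ≤ ‖s - p‖ * ‖s - p + K‖ := by gcongr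
    nlinarith
  nlinarith [abs_nonneg K]

theorem integral_poisson_kernel {c : ℝ} (hc : 0 < c) :
    Integrable (fun t : ℝ => c / (c ^ 2 + t ^ 2)) ∧ ∫ t : ℝ, c / (c ^ 2 + t ^ 2) = Real.pi := by
  have e : (fun t : ℝ => c / (c ^ 2 + t ^ 2)) = fun t : ℝ => c⁻¹ * (1 + (c⁻¹ * t) ^ 2)⁻¹ := by
    ext t; field_simp
  rw [e]
  constructor
  · exact (integrable_inv_one_add_sq.comp_mul_left' (inv_ne_zero hc.ne')).const_mul _
  · rw [integral_const_mul, Measure.integral_comp_mul_left (fun t : ℝ => (1 + t ^ 2)⁻¹),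
      integral_univ_inv_one_add_sq, inv_inv, abs_of_pos hc, smul_eq_mul]
    field_simp

/-- The integral of `s⁻¹ - (s + K)⁻¹` along `Re s = c`: the imaginary part of the integrand is odd,
and the real part is a difference of two Poisson kernels. -/
theorem integral_inv_sub_inv {c K : ℝ} (hc : c ≠ 0) (hK : 0 < c + K) :
    ∫ t : ℝ, (((c : ℂ) + t * Complex.I)⁻¹ - ((c : ℂ) + t * Complex.I + K)⁻¹) =
      if 0 < c then 0 else -(2 * Real.pi : ℂ) := by
  have hne : ∀ (c : ℝ), c ≠ 0 → ∀ t : ℝ, (c : ℂ) + t * Complex.I ≠ 0 := by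
    intro c hc t h
    apply hc
    simpa using congrArg Complex.re h
  set F : ℝ → ℂ := fun t => ((c : ℂ) + t * Complex.I)⁻¹ - ((c : ℂ) + t * Complex.I + K)⁻¹ with hF
  have hcK : ∀ t : ℝ, (c : ℂ) + t * Complex.I + K = ((c + K : ℝ) : ℂ) + t * Complex.I := by
    intro t; push_cast; ring
  have hint : Integrable F := by
    have := (verticalDecay_simplePole 0 K c c).integrable_line le_rfl le_rfl (fun t => ?_)
    · simpa [simplePole] using this
    · unfold simplePole
      apply ContinuousAt.sub
      · apply ContinuousAt.inv₀ (by fun_prop)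
        simpa using hne c hc t
      · apply ContinuousAt.inv₀ (by fun_prop)
        rw [sub_zero, hcK]
        exact hne _ hK.ne' t
  have hodd : ∫ t : ℝ, F t = ∫ t : ℝ, F (-t) := (integral_neg_eq_self F volume).symm
  have hsum : (2 : ℂ) * ∫ t : ℝ, F t = ∫ t : ℝ, (F t + F (-t)) := by
    rw [integral_add hint hint.comp_neg, ← hodd]; ring
  have hreal : ∀ t : ℝ, F t + F (-t) =
      ((2 * (c / (c ^ 2 + t ^ 2) - (c + K) / ((c + K) ^ 2 + t ^ 2)) : ℝ) : ℂ) := by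
    intro t
    have key : ∀ (c : ℝ), c ≠ 0 → ((c : ℂ) + t * Complex.I)⁻¹ + ((c : ℂ) + (-t : ℝ) * Complex.I)⁻¹ =
        ((2 * (c / (c ^ 2 + t ^ 2)) : ℝ) : ℂ) := by
      intro c hc
      have h1 := hne c hc t
      have h2 := hne c hc (-t)
      have h3 : ((c : ℂ) ^ 2 + (t : ℂ) ^ 2) ≠ 0 := by
        have : (0 : ℝ) < c ^ 2 + t ^ 2 := by positivity
        exact_mod_cast this.ne'
      have h4 : ((c : ℂ) + t * Complex.I) * ((c : ℂ) + (-t : ℝ) * Complex.I) =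
          (c : ℂ) ^ 2 + (t : ℂ) ^ 2 := by
        push_cast
        linear_combination -(t : ℂ) ^ 2 * Complex.I_sq
      have h5 : ((c : ℂ) + t * Complex.I)⁻¹ + ((c : ℂ) + (-t : ℝ) * Complex.I)⁻¹ =
          (2 * c) / (((c : ℂ) + t * Complex.I) * ((c : ℂ) + (-t : ℝ) * Complex.I)) := by
        rw [inv_add_inv h1 h2]
        congr 1
        push_cast
        ring
      rw [h5, h4]
      push_cast
      ring
    have e : F t + F (-t) = (((c : ℂ) + t * Complex.I)⁻¹ + ((c : ℂ) + (-t : ℝ) * Complex.I)⁻¹) -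
        ((((c + K : ℝ) : ℂ) + t * Complex.I)⁻¹ + (((c + K : ℝ) : ℂ) + (-t : ℝ) * Complex.I)⁻¹) := by
      simp only [hF, hcK]; ring
    rw [e, key c hc, key (c + K) hK.ne', ← Complex.ofReal_sub]
    congr 1
    ring
  simp_rw [hreal] at hsum
  rw [integral_complex_ofReal, integral_const_mul] at hsum
  obtain ⟨i2, v2⟩ := integral_poisson_kernel hK
  split_ifs with h
  · obtain ⟨i1, v1⟩ := integral_poisson_kernel h
    rw [integral_sub i1 i2, v1, v2] at hsum
    simpa using hsum
  · have hneg : 0 < -c := by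
      rcases lt_trichotomy c 0 with h' | h' | h'
      · linarith
      · exact absurd h' hc
      · exact absurd h' h
    obtain ⟨i1, v1⟩ := integral_poisson_kernel hneg
    have e : (fun t : ℝ => c / (c ^ 2 + t ^ 2)) = fun t => -(-c / ((-c) ^ 2 + t ^ 2)) := by
      ext t; ring
    rw [integral_sub (by rw [e]; exact i1.neg) i2, e, integral_neg, v1, v2] at hsum
    have : (2 : ℂ) * ∫ t : ℝ, F t = 2 * (-(2 * Real.pi : ℂ)) := by
      rw [hsum]; push_cast; ring
    exact mul_left_cancel₀ two_ne_zero this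

theorem integral_simplePole {p : ℂ} {c K : ℝ} (hc : c ≠ p.re) (hK : p.re < c + K) :
    ∫ t : ℝ, simplePole p K (c + t * Complex.I) =
      if p.re < c then 0 else -(2 * Real.pi : ℂ) := by
  have h := integral_inv_sub_inv (c := c - p.re) (K := K) (sub_ne_zero.2 hc) (by linarith)
  simp only [sub_pos] at h
  rw [← h, ← integral_sub_right_eq_self (fun t : ℝ => ((((c - p.re : ℝ) : ℂ) + t * Complex.I)⁻¹ -
    (((c - p.re : ℝ) : ℂ) + t * Complex.I + K)⁻¹)) p.im]
  congr 1
  ext t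
  have : (c : ℂ) + t * Complex.I - p = ((c - p.re : ℝ) : ℂ) + ((t - p.im : ℝ) : ℂ) * Complex.I := by
    apply Complex.ext <;> simp
  rw [simplePole, this]

/-- Residue theorem for a vertical strip: `f` has finitely many poles in the open strip
`a < Re s < b`, all simple, and decays like `|Im s|⁻²`. -/
theorem integral_line_sub_integral_line (S : Finset ℂ) {f : ℂ → ℂ} {r : ℂ → ℂ} {a b : ℝ}
    (hab : a < b)
    (hf : ∀ s : ℂ, a ≤ s.re → s.re ≤ b → s ∉ S → DifferentiableAt ℂ f s)
    (hS : ∀ p ∈ S, a < p.re ∧ p.re < b)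
    (hr : ∀ p ∈ S, Tendsto (fun s => (s - p) * f s) (𝓝[≠] p) (𝓝 (r p)))
    (hdec : VerticalDecay f a b) :
    (∫ t : ℝ, f (b + t * Complex.I)) - ∫ t : ℝ, f (a + t * Complex.I) =
      2 * Real.pi * ∑ p ∈ S, r p := by
  induction S using Finset.induction_on generalizing f with
  | empty =>
    rw [integral_line_eq_of_differentiable hab.le (fun s h1 h2 => hf s h1 h2 (by simp)) hdec]
    simp
  | insert p S hp ih =>
    obtain ⟨hpa, hpb⟩ := hS p (Finset.mem_insert_self p S)
    -- the auxiliary pole `p - K` has to lie to the left of the strip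
    set K : ℝ := p.re - a + 1 with hK
    -- subtracting the principal part at `p` makes that singularity removable
    set g : ℂ → ℂ := fun s => f s - r p * simplePole p K s with hg
    set f₁ : ℂ → ℂ := Function.update g p (limUnder (𝓝[≠] p) g) with hf₁
    have hpole : ∀ s : ℂ, a ≤ s.re → s - p + K ≠ 0 := by
      intro s hs h
      have := congrArg Complex.re h
      simp [hK] at this
      linarith
    have hpd : ∀ s : ℂ, a ≤ s.re → s ≠ p → DifferentiableAt ℂ (simplePole p K) s := by
      intro s hs hsp
      unfold simplePole
      exact ((differentiableAt_id.sub_const p).inv (sub_ne_zero.2 hsp)).sub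
        (((differentiableAt_id.sub_const p).add_const _).inv (hpole s hs))
    have hgd : ∀ s : ℂ, a ≤ s.re → s.re ≤ b → s ∉ insert p S → DifferentiableAt ℂ g s := by
      intro s h1 h2 h3
      refine (hf s h1 h2 h3).sub ((hpd s h1 ?_).const_mul _)
      rintro rfl
      exact h3 (Finset.mem_insert_self s S)
    have hf1g : ∀ s : ℂ, s ≠ p → f₁ =ᶠ[𝓝 s] g := by
      intro s hs
      filter_upwards [isOpen_ne.mem_nhds hs] with z hz
      exact Function.update_of_ne hz _ _
    have hlim : Tendsto (fun s => (s - p) * g s) (𝓝[≠] p) (𝓝 0) := by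
      have h1 := hr p (Finset.mem_insert_self p S)
      have h2 : Tendsto (fun s : ℂ => r p * (1 - (s - p) * (s - p + K)⁻¹)) (𝓝[≠] p)
          (𝓝 (r p * (1 - (p - p) * (p - p + K)⁻¹))) := by
        apply Tendsto.mono_left _ nhdsWithin_le_nhds
        apply ContinuousAt.tendsto
          (f := fun s : ℂ => r p * (1 - (s - p) * (s - p + K)⁻¹))
        have := hpole p hpa.le
        fun_prop (disch := assumption)
      have h3 := h1.sub h2
      simp only [sub_self, zero_mul, sub_zero, mul_one] at h3
      refine h3.congr' ?_
      filter_upwards [self_mem_nhdsWithin] with s hs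
      have : s - p ≠ 0 := sub_ne_zero.2 hs
      simp only [hg, simplePole]
      linear_combination r p * mul_inv_cancel₀ this
    have hU : {s : ℂ | a < s.re ∧ s.re < b} ∩ ((S : Set ℂ))ᶜ ∈ 𝓝 p := by
      apply IsOpen.mem_nhds
      · apply IsOpen.inter
        · exact (isOpen_lt continuous_const Complex.continuous_re).inter
            (isOpen_lt Complex.continuous_re continuous_const)
        · exact S.finite_toSet.isClosed.isOpen_compl
      · exact ⟨⟨hpa, hpb⟩, by simpa using hp⟩
    have hrem : DifferentiableAt ℂ f₁ p := by
      have := Complex.differentiableOn_update_limUnder_of_isLittleO (f := g) hU ?_ ?_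
      · exact this.differentiableAt hU
      · intro s hs
        apply (hgd s hs.1.1.1.le hs.1.1.2.le ?_).differentiableWithinAt
        rw [Finset.mem_insert, not_or]
        exact ⟨hs.2, by simpa using hs.1.2⟩
      · rw [Asymptotics.isLittleO_iff_tendsto']
        · have h1 : Tendsto (fun s => (s - p) * g s - (s - p) * g p) (𝓝[≠] p) (𝓝 (0 - 0)) := by
            refine hlim.sub ?_
            have : Tendsto (fun s => (s - p) * g p) (𝓝 p) (𝓝 ((p - p) * g p)) := by
              apply Continuous.tendsto; fun_prop
            simpa using this.mono_left nhdsWithin_le_nhds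
          rw [sub_zero] at h1
          refine h1.congr fun s => ?_
          rw [div_inv_eq_mul]; ring
        · filter_upwards [self_mem_nhdsWithin] with s hs h
          exact absurd (inv_eq_zero.1 h) (sub_ne_zero.2 hs)
    have key := ih (f := f₁) ?_ (fun q hq => hS q (Finset.mem_insert_of_mem hq)) ?_ ?_
    · have hline : ∀ c : ℝ, a ≤ c → c ≤ b → c ≠ p.re → (∀ q ∈ insert p S, q.re ≠ c) →
          ∫ t : ℝ, f₁ (c + t * Complex.I) = (∫ t : ℝ, f (c + t * Complex.I)) -
            r p * ∫ t : ℝ, simplePole p K (c + t * Complex.I) := by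
        intro c h1 h2 h3 h4
        rw [← integral_const_mul, ← integral_sub]
        · congr 1
          ext t
          rw [hf₁, Function.update_of_ne]
          intro h
          apply h3
          rw [← h]; simp
        · refine hdec.integrable_line h1 h2 fun t => ?_
          refine (hf _ (by simpa) (by simpa) fun h => ?_).continuousAt
          exact h4 _ h (by simp)
        · apply Integrable.const_mul
          refine (verticalDecay_simplePole p K a b).integrable_line h1 h2 fun t => ?_
          refine (hpd _ (by simpa) fun h => ?_).continuousAt
          apply h3
          rw [← h]; simp
      rw [hline b hab.le le_rfl hpb.ne' (fun q hq => (hS q hq).2.ne),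
        hline a le_rfl hab.le hpa.ne (fun q hq => (hS q hq).1.ne'),
        integral_simplePole hpb.ne' (by rw [hK]; linarith),
        integral_simplePole hpa.ne (by rw [hK]; linarith),
        if_pos hpb, if_neg (not_lt.2 hpa.le)] at key
      rw [Finset.sum_insert hp, mul_add, ← key]
      ring
    · intro s h1 h2 h3
      by_cases hsp : s = p
      · rw [hsp]; exact hrem
      · refine (hgd s h1 h2 ?_).congr_of_eventuallyEq (hf1g s hsp)
        rw [Finset.mem_insert, not_or]
        exact ⟨hsp, h3⟩
    · intro q hq
      have hqp : q ≠ p := fun h => hp (h ▸ hq)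
      have h1 := hr q (Finset.mem_insert_of_mem hq)
      have h2 : Tendsto (fun s => (s - q) * (r p * simplePole p K s)) (𝓝[≠] q) (𝓝 0) := by
        have hc := (hpd q (hS q (Finset.mem_insert_of_mem hq)).1.le hqp).continuousAt
        have : ContinuousAt (fun s => (s - q) * (r p * simplePole p K s)) q := by fun_prop
        simpa using this.tendsto.mono_left nhdsWithin_le_nhds
      have h3 := h1.sub h2
      rw [sub_zero] at h3
      refine h3.congr' ?_
      filter_upwards [nhdsWithin_le_nhds (hf1g q hqp)] with s hs
      rw [hs, hg]; ring
    · obtain ⟨C₁, T₁, h₁⟩ := hdec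
      obtain ⟨C₂, T₂, h₂⟩ := verticalDecay_simplePole p K a b
      refine ⟨C₁ + ‖r p‖ * C₂, max (max T₁ T₂) (|p.im| + 1), fun s h1 h2 h3 => ?_⟩
      have hsp : s ≠ p := by
        rintro rfl
        have := (le_max_right _ _).trans h3
        linarith
      rw [hf₁, Function.update_of_ne hsp, hg]
      refine (norm_sub_le _ _).trans ?_
      rw [norm_mul, add_div, mul_div_assoc]
      gcongr
      · exact h₁ s h1 h2 ((le_max_left _ _).trans ((le_max_left _ _).trans h3))
      · exact h₂ s h1 h2 ((le_max_right _ _).trans ((le_max_left _ _).trans h3))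

/-! ### Residues of the Mellin–Barnes integral -/

/-- The Mellin–Barnes integrand of the Weber kernel, where `y` stands for `x/4`. The
first, second and fourth factors come from the Fourier transform of `sinh(πv)^(-2s)`, whose sine
cancels the one in `Γ(s+α) / (sin(πs) Γ(1+α-s))`. -/
noncomputable def barnes (α τ y : ℝ) (s : ℂ) : ℂ :=
  Complex.Gamma (s + Complex.I * τ) * Complex.Gamma (s - Complex.I * τ) * Complex.Gamma (s + α) *
    Complex.Gamma (1 - 2 * s) * (Complex.Gamma (1 + α - s))⁻¹ * (y : ℂ) ^ (-s)

theorem barnes_neg (α τ y : ℝ) (s : ℂ) : barnes α (-τ) y s = barnes α τ y s := by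
  simp only [barnes, Complex.ofReal_neg, mul_neg, sub_neg_eq_add, ← sub_eq_add_neg]
  ring

theorem ne_neg_nat_of_im_ne_zero {s : ℂ} (h : s.im ≠ 0) : ∀ m : ℕ, s ≠ -m :=
  fun m hm => h (by rw [hm]; simp)

theorem ne_neg_nat_of_re_pos {s : ℂ} (h : 0 < s.re) : ∀ m : ℕ, s ≠ -m := by
  intro m hm
  rw [hm] at h
  simp at h
  linarith [(Nat.cast_nonneg m : (0:ℝ) ≤ m)]

theorem differentiableAt_barnes {α τ y : ℝ} (hy : 0 < y) {s : ℂ} (hs : s.re < 1 / 2)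
    (h1 : ∀ k : ℕ, s ≠ -(Complex.I * τ) - k) (h2 : ∀ k : ℕ, s ≠ Complex.I * τ - k)
    (h3 : ∀ k : ℕ, s ≠ -(α : ℂ) - k) : DifferentiableAt ℂ (barnes α τ y) s := by
  have d1 : DifferentiableAt ℂ (fun s : ℂ => Complex.Gamma (s + Complex.I * τ)) s :=
    (Complex.differentiableAt_Gamma (s + Complex.I * τ)
      (fun k hk => h1 k (by linear_combination hk))).comp s (by fun_prop)
  have d2 : DifferentiableAt ℂ (fun s : ℂ => Complex.Gamma (s - Complex.I * τ)) s :=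
    (Complex.differentiableAt_Gamma (s - Complex.I * τ)
      (fun k hk => h2 k (by linear_combination hk))).comp s (by fun_prop)
  have d3 : DifferentiableAt ℂ (fun s : ℂ => Complex.Gamma (s + α)) s :=
    (Complex.differentiableAt_Gamma (s + α)
      (fun k hk => h3 k (by linear_combination hk))).comp s (by fun_prop)
  have d4 : DifferentiableAt ℂ (fun s : ℂ => Complex.Gamma (1 - 2 * s)) s := by
    refine (Complex.differentiableAt_Gamma (1 - 2 * s) (ne_neg_nat_of_re_pos ?_)).comp s
      (by fun_prop)
    simp; linarith
  have d5 : DifferentiableAt ℂ (fun s : ℂ => (Complex.Gamma (1 + α - s))⁻¹) s :=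
    (Complex.differentiable_one_div_Gamma (1 + α - s)).comp s (by fun_prop)
  have d6 : DifferentiableAt ℂ (fun s : ℂ => (y : ℂ) ^ (-s)) s :=
    differentiableAt_id.neg.const_cpow (Or.inl (by exact_mod_cast hy.ne'))
  exact ((((d1.mul d2).mul d3).mul d4).mul d5).mul d6

theorem verticalDecay_barnes (α τ : ℝ) {y : ℝ} (hy : 0 < y) (a b : ℝ) :
    VerticalDecay (barnes α τ y) a b := by
  have hpi := Real.pi_pos
  -- with `θ = π/3` the total exponent is `-(1 + 1 + 1 + 2) θ + (π - θ) = -π`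
  have hθ0 : 0 ≤ Real.pi / 3 := by positivity
  have hθ : Real.pi / 3 < Real.pi / 2 := by linarith
  obtain ⟨C₁, p₁, h₁⟩ := exists_norm_Gamma_le a b hθ0 hθ
  obtain ⟨C₃, p₃, h₃⟩ := exists_norm_Gamma_le (a + α) (b + α) hθ0 hθ
  obtain ⟨C₄, p₄, h₄⟩ := exists_norm_Gamma_le (1 - 2 * b) (1 - 2 * a) hθ0 hθ
  obtain ⟨C₅, p₅, h₅⟩ := exists_norm_Gamma_inv_le (1 + α - b) (1 + α - a) hθ0 hθ
  have hyc : ContinuousOn (fun σ : ℝ => y ^ (-σ)) (Icc a b) := by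
    apply Continuous.continuousOn
    exact Continuous.rpow continuous_const continuous_neg (fun _ => Or.inl hy.ne')
  obtain ⟨C₆, h₆⟩ := isCompact_Icc.exists_bound_of_continuousOn hyc
  set θ := Real.pi / 3 with hθdef
  refine ⟨C₁ * Real.exp (θ * |τ|) * (C₁ * Real.exp (θ * |τ|)) * C₃ * C₄ * C₅ * C₆, 1 + |τ|,
    fun s ha hb ht => ?_⟩
  have hτ := abs_nonneg τ
  set t := s.im with htdef
  have e1 : |t| - |τ| ≤ |t + τ| := by
    have := abs_sub_abs_le_abs_sub t (-τ); rwa [abs_neg, sub_neg_eq_add] at this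
  have e2 : |t| - |τ| ≤ |t - τ| := abs_sub_abs_le_abs_sub t τ
  have b1 : ‖Complex.Gamma (s + Complex.I * τ)‖ ≤
      C₁ * Real.exp (θ * |τ|) * Real.exp (-(θ * |t|)) := by
    have := h₁ (s + Complex.I * τ) (by simpa) (by simpa) (by simp; linarith)
    refine this.trans ?_
    rw [mul_assoc, ← Real.exp_add]
    have him : (s + Complex.I * τ).im = t + τ := by simp [htdef]
    rw [him]
    gcongr
    nlinarith
  have b2 : ‖Complex.Gamma (s - Complex.I * τ)‖ ≤
      C₁ * Real.exp (θ * |τ|) * Real.exp (-(θ * |t|)) := by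
    have := h₁ (s - Complex.I * τ) (by simpa) (by simpa) (by simp; linarith)
    refine this.trans ?_
    rw [mul_assoc, ← Real.exp_add]
    have him : (s - Complex.I * τ).im = t - τ := by simp [htdef]
    rw [him]
    gcongr
    nlinarith
  have b3 : ‖Complex.Gamma (s + α)‖ ≤ C₃ * Real.exp (-(θ * |t|)) := by
    simpa [htdef] using h₃ (s + α) (by simpa) (by simpa) (by simp; linarith)
  have him4 : |(1 - 2 * s).im| = 2 * |t| := by simp [htdef, abs_mul]
  have b4 : ‖Complex.Gamma (1 - 2 * s)‖ ≤ C₄ * Real.exp (-(θ * (2 * |t|))) := by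
    rw [← him4]
    exact h₄ (1 - 2 * s) (by simp; linarith) (by simp; linarith) (by rw [him4]; linarith)
  have b5 : ‖(Complex.Gamma (1 + α - s))⁻¹‖ ≤ C₅ * Real.exp ((Real.pi - θ) * |t|) := by
    have := h₅ (1 + α - s) (by simp; linarith) (by simp; linarith) (by simp; linarith)
    simpa [htdef] using this
  have b6 : ‖(y : ℂ) ^ (-s)‖ ≤ C₆ := by
    rw [Complex.norm_cpow_eq_rpow_re_of_pos hy]
    exact (le_abs_self _).trans (h₆ s.re ⟨ha, hb⟩)
  have p₆ : 0 ≤ C₆ := (norm_nonneg _).trans b6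
  rw [barnes, norm_mul, norm_mul, norm_mul, norm_mul, norm_mul]
  calc _ ≤ (C₁ * Real.exp (θ * |τ|) * Real.exp (-(θ * |t|))) *
        (C₁ * Real.exp (θ * |τ|) * Real.exp (-(θ * |t|))) * (C₃ * Real.exp (-(θ * |t|))) *
        (C₄ * Real.exp (-(θ * (2 * |t|)))) * (C₅ * Real.exp ((Real.pi - θ) * |t|)) * C₆ := by
        gcongr
    _ = (C₁ * Real.exp (θ * |τ|) * (C₁ * Real.exp (θ * |τ|)) * C₃ * C₄ * C₅ * C₆) *
        Real.exp (-(Real.pi * |t|)) := by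
        have : Real.exp (-(Real.pi * |t|)) = Real.exp (-(θ * |t|)) * Real.exp (-(θ * |t|)) *
            Real.exp (-(θ * |t|)) * Real.exp (-(θ * (2 * |t|))) *
            Real.exp ((Real.pi - θ) * |t|) := by
          simp only [← Real.exp_add]
          congr 1
          rw [hθdef]; ring
        rw [this]; ring
    _ ≤ _ := by
        rw [div_eq_mul_inv]
        gcongr
        rw [Real.exp_neg]
        have ht0 : 0 < |t| := by linarith
        have hq := Real.quadratic_le_exp_of_nonneg (x := Real.pi * |t|) (by positivity)
        apply inv_anti₀
        · rw [← sq_abs]; positivity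
        · rw [← sq_abs t]
          have := Real.pi_gt_three
          have h9 : 9 * |t| ^ 2 ≤ (Real.pi * |t|) ^ 2 := by
            rw [mul_pow]; gcongr; nlinarith
          nlinarith [mul_pos hpi ht0]

theorem barnes_sub_one {α τ y : ℝ} (hy : 0 < y) {w : ℂ} (h1 : w - 1 + Complex.I * τ ≠ 0)
    (h2 : w - 1 - Complex.I * τ ≠ 0) (h3 : w - 1 + α ≠ 0) (h4 : 1 + α - w ≠ 0)
    (h5 : 1 - 2 * w ≠ 0) (h6 : 2 - 2 * w ≠ 0) :
    barnes α τ y (w - 1) = barnes α τ y w * ((1 - 2 * w) * (2 - 2 * w) * y /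
      ((w - 1 + Complex.I * τ) * (w - 1 - Complex.I * τ) * (w - 1 + α) * (1 + α - w))) := by
  have g1 : Complex.Gamma (w + Complex.I * τ) =
      (w - 1 + Complex.I * τ) * Complex.Gamma (w - 1 + Complex.I * τ) := by
    rw [← Complex.Gamma_add_one _ h1]; congr 1; ring
  have g2 : Complex.Gamma (w - Complex.I * τ) =
      (w - 1 - Complex.I * τ) * Complex.Gamma (w - 1 - Complex.I * τ) := by
    rw [← Complex.Gamma_add_one _ h2]; congr 1; ring
  have g3 : Complex.Gamma (w + α) = (w - 1 + α) * Complex.Gamma (w - 1 + α) := by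
    rw [← Complex.Gamma_add_one _ h3]; congr 1; ring
  have g4 : Complex.Gamma (1 + α - (w - 1)) = (1 + α - w) * Complex.Gamma (1 + α - w) := by
    rw [← Complex.Gamma_add_one _ h4]; congr 1; ring
  have g5 : Complex.Gamma (1 - 2 * (w - 1)) =
      (2 - 2 * w) * ((1 - 2 * w) * Complex.Gamma (1 - 2 * w)) := by
    rw [← Complex.Gamma_add_one _ h5]
    rw [show (1 - 2 * w + 1 : ℂ) = 2 - 2 * w by ring, ← Complex.Gamma_add_one _ h6]
    congr 1; ring
  have g6 : (y : ℂ) ^ (-(w - 1)) = y * (y : ℂ) ^ (-w) := by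
    have hy0 : (y : ℂ) ≠ 0 := by exact_mod_cast hy.ne'
    rw [show -(w - 1) = 1 + -w by ring, Complex.cpow_add _ _ hy0, Complex.cpow_one]
  rw [barnes, barnes, g1, g2, g3, g4, g5, g6, mul_inv]
  field_simp

/-- Far to the left each unit step gains a factor `1/2`, because the ratio in `barnes_sub_one` is
`O(|w|⁻²)`. -/
theorem barnes_ratio_bound (α τ : ℝ) {y : ℝ} (hy : 0 < y) :
    ∃ R : ℝ, 0 < R ∧ ∀ w : ℂ, w.re ≤ -R → ‖barnes α τ y (w - 1)‖ ≤ 1 / 2 * ‖barnes α τ y w‖ := by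
  refine ⟨max (max (2 * |τ|) (2 * |α|)) (128 * y) + 1, by positivity, fun w hw => ?_⟩
  set D := ‖w - 1‖ with hD
  have hre : -(w.re) + 1 ≤ D := by
    have := Complex.abs_re_le_norm (w - 1)
    simp only [Complex.sub_re, Complex.one_re] at this
    have := neg_abs_le (w.re - 1)
    linarith
  have m1 := le_max_left (max (2 * |τ|) (2 * |α|)) (128 * y)
  have m2 := le_max_right (max (2 * |τ|) (2 * |α|)) (128 * y)
  have m3 := le_max_left (2 * |τ|) (2 * |α|)
  have m4 := le_max_right (2 * |τ|) (2 * |α|)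
  have hD1 : 2 ≤ D := by linarith [abs_nonneg τ]
  have nτ : ‖Complex.I * (τ : ℂ)‖ = |τ| := by simp
  have nα : ‖(α : ℂ)‖ = |α| := by simp
  have l1 : D / 2 ≤ ‖w - 1 + Complex.I * τ‖ := by
    have := norm_sub_le (w - 1 + Complex.I * τ) (Complex.I * τ)
    rw [add_sub_cancel_right, nτ, ← hD] at this
    linarith
  have l2 : D / 2 ≤ ‖w - 1 - Complex.I * τ‖ := by
    have := norm_add_le (w - 1 - Complex.I * τ) (Complex.I * τ)
    rw [sub_add_cancel, nτ, ← hD] at this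
    linarith
  have l3 : D / 2 ≤ ‖w - 1 + α‖ := by
    have := norm_sub_le (w - 1 + α) (α : ℂ)
    rw [add_sub_cancel_right, nα, ← hD] at this
    linarith
  have l4 : D / 2 ≤ ‖1 + α - w‖ := by
    have := norm_sub_le (1 + α - w) (α : ℂ)
    rw [show (1 + α - w - α : ℂ) = -(w - 1) by ring, norm_neg, nα, ← hD] at this
    linarith
  have u1 : ‖1 - 2 * w‖ ≤ 4 * D := by
    rw [show (1 - 2 * w : ℂ) = -(2 * (w - 1)) - 1 by ring]
    refine (norm_sub_le _ _).trans ?_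
    rw [norm_neg, norm_mul, ← hD]
    simp; linarith
  have u2 : ‖2 - 2 * w‖ = 2 * D := by
    rw [show (2 - 2 * w : ℂ) = -(2 * (w - 1)) by ring, norm_neg, norm_mul, ← hD]; simp
  have hwre : w.re ≤ -1 := by linarith [abs_nonneg τ]
  have ne : ∀ z : ℂ, D / 2 ≤ ‖z‖ → z ≠ 0 := by
    rintro z hz rfl
    rw [norm_zero] at hz; linarith
  rw [barnes_sub_one hy (ne _ l1) (ne _ l2) (ne _ l3) (ne _ l4) ?_ ?_, norm_mul, mul_comm]
  · gcongr
    rw [norm_div, norm_mul, norm_mul, norm_mul, norm_mul, norm_mul, u2, Complex.norm_real,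
      Real.norm_eq_abs, abs_of_pos hy]
    have hden : (D / 2) * (D / 2) * (D / 2) * (D / 2) ≤ ‖w - 1 + Complex.I * τ‖ *
        ‖w - 1 - Complex.I * τ‖ * ‖w - 1 + α‖ * ‖1 + α - w‖ := by gcongr
    rw [div_le_iff₀ (lt_of_lt_of_le (by positivity) hden)]
    have hnum : ‖1 - 2 * w‖ * (2 * D) * y ≤ 4 * D * (2 * D) * y := by gcongr
    refine hnum.trans (le_trans ?_ (mul_le_mul_of_nonneg_left hden (by norm_num)))
    have : 256 * y ≤ D * D := by nlinarith
    nlinarith [mul_pos (show 0 < D by linarith) (show 0 < D by linarith)]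
  · intro h
    have := congrArg Complex.re h
    simp at this; linarith
  · intro h
    have := congrArg Complex.re h
    simp at this; linarith

/-- The residue of `barnes α τ y` at its pole `-iτ - k`. -/
noncomputable def residueTau (α τ y : ℝ) (k : ℕ) : ℂ :=
  (-1) ^ k / (k.factorial : ℂ) * Complex.Gamma (-(2 * (Complex.I * τ)) - k) *
    Complex.Gamma (α - Complex.I * τ - k) * Complex.Gamma (1 + 2 * (Complex.I * τ) + 2 * k) *
    (Complex.Gamma (1 + α + Complex.I * τ + k))⁻¹ * (y : ℂ) ^ (Complex.I * τ + k)

/-- The residue of `barnes α τ y` at its pole `-α - k`. -/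
noncomputable def residueAlpha (α τ y : ℝ) (k : ℕ) : ℂ :=
  (-1) ^ k / (k.factorial : ℂ) * Complex.Gamma (-(α + Complex.I * τ) - k) *
    Complex.Gamma (-(α - Complex.I * τ) - k) * Complex.Gamma (1 + 2 * α + 2 * k) *
    (Complex.Gamma (1 + 2 * α + k))⁻¹ * (y : ℂ) ^ ((α : ℂ) + k)

theorem tendsto_sub_mul_Gamma_add (c : ℂ) (k : ℕ) :
    Tendsto (fun s : ℂ => (s - (-c - k)) * Complex.Gamma (s + c)) (𝓝[≠] (-c - k))
      (𝓝 ((-1) ^ k / (k.factorial : ℂ))) := by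
  have hshift : Tendsto (fun s : ℂ => s + c) (𝓝[≠] (-c - k)) (𝓝[≠] (-(k : ℂ))) := by
    apply tendsto_nhdsWithin_of_tendsto_nhds_of_eventually_within
    · have : Tendsto (fun s : ℂ => s + c) (𝓝 (-c - k)) (𝓝 (-c - k + c)) := by
        apply Continuous.tendsto; fun_prop
      rw [show -c - k + c = -(k : ℂ) by ring] at this
      exact this.mono_left nhdsWithin_le_nhds
    · filter_upwards [self_mem_nhdsWithin] with s hs h
      apply hs
      simp only [mem_singleton_iff] at h ⊢
      linear_combination h
  refine ((tendsto_add_nat_mul_Gamma k).comp hshift).congr fun s => ?_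
  simp only [Function.comp]
  ring

theorem tendsto_barnes_tau {α τ y : ℝ} (hy : 0 < y) (hτ : τ ≠ 0) (k : ℕ) :
    Tendsto (fun s => (s - (-(Complex.I * τ) - k)) * barnes α τ y s)
      (𝓝[≠] (-(Complex.I * τ) - k)) (𝓝 (residueTau α τ y k)) := by
  have h1 := tendsto_sub_mul_Gamma_add (Complex.I * τ) k
  set p : ℂ := -(Complex.I * τ) - k with hp
  have him : p.im = -τ := by simp [hp]
  have hre : p.re = -k := by simp [hp]
  have hk : (0 : ℝ) ≤ k := k.cast_nonneg
  have c2 : ContinuousAt (fun s : ℂ => Complex.Gamma (s - Complex.I * τ)) p := by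
    refine ContinuousAt.comp (g := Complex.Gamma) (f := fun s : ℂ => s - Complex.I * τ)
      (Complex.continuousAt_Gamma _ (ne_neg_nat_of_im_ne_zero ?_)) (by fun_prop)
    simp only [Complex.sub_im, him, Complex.mul_im, Complex.I_re, Complex.ofReal_im, mul_zero,
      Complex.I_im, Complex.ofReal_re, one_mul, zero_add]
    intro h; apply hτ; linarith
  have c3 : ContinuousAt (fun s : ℂ => Complex.Gamma (s + α)) p := by
    refine ContinuousAt.comp (g := Complex.Gamma) (f := fun s : ℂ => s + α)
      (Complex.continuousAt_Gamma _ (ne_neg_nat_of_im_ne_zero ?_)) (by fun_prop)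
    simpa [him] using hτ
  have c4 : ContinuousAt (fun s : ℂ => Complex.Gamma (1 - 2 * s)) p := by
    refine ContinuousAt.comp (g := Complex.Gamma) (f := fun s : ℂ => 1 - 2 * s)
      (Complex.continuousAt_Gamma _ (ne_neg_nat_of_re_pos ?_)) (by fun_prop)
    simp [hre]; linarith
  have c5 : ContinuousAt (fun s : ℂ => (Complex.Gamma (1 + α - s))⁻¹) p :=
    ((Complex.differentiable_one_div_Gamma (1 + α - p)).comp p
      (f := fun s : ℂ => 1 + α - s) (by fun_prop)).continuousAt
  have c6 : ContinuousAt (fun s : ℂ => (y : ℂ) ^ (-s)) p :=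
    (differentiableAt_id.neg.const_cpow (Or.inl (by exact_mod_cast hy.ne'))).continuousAt
  have h2 := h1.mul ((((c2.mul c3).mul c4).mul c5).mul c6).continuousWithinAt.tendsto
  have e : residueTau α τ y k = (-1) ^ k / (k.factorial : ℂ) *
      (Complex.Gamma (p - Complex.I * τ) * Complex.Gamma (p + α) * Complex.Gamma (1 - 2 * p) *
        (Complex.Gamma (1 + α - p))⁻¹ * (y : ℂ) ^ (-p)) := by
    rw [residueTau, show p - Complex.I * τ = -(2 * (Complex.I * τ)) - k by rw [hp]; ring,
      show p + α = α - Complex.I * τ - k by rw [hp]; ring,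
      show 1 - 2 * p = 1 + 2 * (Complex.I * τ) + 2 * k by rw [hp]; ring,
      show 1 + α - p = 1 + α + Complex.I * τ + k by rw [hp]; ring,
      show -p = Complex.I * τ + k by rw [hp]; ring]
    ring
  rw [e]
  refine h2.congr fun s => ?_
  simp only [Pi.mul_apply]
  rw [barnes]; ring

theorem tendsto_barnes_alpha {α τ y : ℝ} (hy : 0 < y) (hα : -(1 / 2) < α) (hτ : τ ≠ 0) (k : ℕ) :
    Tendsto (fun s => (s - (-(α : ℂ) - k)) * barnes α τ y s)
      (𝓝[≠] (-(α : ℂ) - k)) (𝓝 (residueAlpha α τ y k)) := by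
  have h1 := tendsto_sub_mul_Gamma_add (α : ℂ) k
  set p : ℂ := -(α : ℂ) - k with hp
  have him : p.im = 0 := by simp [hp]
  have hre : p.re = -α - k := by simp [hp]
  have hk : (0 : ℝ) ≤ k := k.cast_nonneg
  have c2 : ContinuousAt (fun s : ℂ => Complex.Gamma (s + Complex.I * τ)) p := by
    refine ContinuousAt.comp (g := Complex.Gamma) (f := fun s : ℂ => s + Complex.I * τ)
      (Complex.continuousAt_Gamma _ (ne_neg_nat_of_im_ne_zero ?_)) (by fun_prop)
    simpa [him] using hτ
  have c3 : ContinuousAt (fun s : ℂ => Complex.Gamma (s - Complex.I * τ)) p := by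
    refine ContinuousAt.comp (g := Complex.Gamma) (f := fun s : ℂ => s - Complex.I * τ)
      (Complex.continuousAt_Gamma _ (ne_neg_nat_of_im_ne_zero ?_)) (by fun_prop)
    simpa [him] using hτ
  have c4 : ContinuousAt (fun s : ℂ => Complex.Gamma (1 - 2 * s)) p := by
    refine ContinuousAt.comp (g := Complex.Gamma) (f := fun s : ℂ => 1 - 2 * s)
      (Complex.continuousAt_Gamma _ (ne_neg_nat_of_re_pos ?_)) (by fun_prop)
    simp [hre]; linarith
  have c5 : ContinuousAt (fun s : ℂ => (Complex.Gamma (1 + α - s))⁻¹) p :=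
    ((Complex.differentiable_one_div_Gamma (1 + α - p)).comp p
      (f := fun s : ℂ => 1 + α - s) (by fun_prop)).continuousAt
  have c6 : ContinuousAt (fun s : ℂ => (y : ℂ) ^ (-s)) p :=
    (differentiableAt_id.neg.const_cpow (Or.inl (by exact_mod_cast hy.ne'))).continuousAt
  have h2 := h1.mul ((((c2.mul c3).mul c4).mul c5).mul c6).continuousWithinAt.tendsto
  have e : residueAlpha α τ y k = (-1) ^ k / (k.factorial : ℂ) *
      (Complex.Gamma (p + Complex.I * τ) * Complex.Gamma (p - Complex.I * τ) *
        Complex.Gamma (1 - 2 * p) * (Complex.Gamma (1 + α - p))⁻¹ * (y : ℂ) ^ (-p)) := by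
    rw [residueAlpha, show p + Complex.I * τ = -(α - Complex.I * τ) - k by rw [hp]; ring,
      show p - Complex.I * τ = -(α + Complex.I * τ) - k by rw [hp]; ring,
      show 1 - 2 * p = 1 + 2 * α + 2 * k by rw [hp]; ring,
      show 1 + α - p = 1 + 2 * α + k by rw [hp]; ring,
      show -p = (α : ℂ) + k by rw [hp]; ring]
    ring
  rw [e]
  refine h2.congr fun s => ?_
  simp only [Pi.mul_apply]
  rw [barnes]; ring

/-- The contour shifted from `Re s = γ` to `Re s = β - N`. With `m < α + β < m + 1`, the poles
crossed are `±iτ - k` for `k < N` and `-α - k` for `k < N - m`; the truncated subtraction is the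
right count also for `N < m`, when none of the latter is crossed. -/
theorem integral_barnes_sub {α τ y β γ : ℝ} {m : ℕ} (hy : 0 < y) (hτ : τ ≠ 0) (hβ0 : 0 < β)
    (hβ : -α < β) (hβγ : β < γ) (hγ : γ < 1 / 4) (hm1 : (m : ℝ) < α + β) (hm2 : α + β < m + 1)
    (N : ℕ) :
    (∫ t : ℝ, barnes α τ y (γ + t * Complex.I)) -
        ∫ t : ℝ, barnes α τ y ((β - N : ℝ) + t * Complex.I) =
      2 * Real.pi * (∑ k ∈ Finset.range N, residueTau α τ y k +
        ∑ k ∈ Finset.range N, residueTau α (-τ) y k +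
        ∑ k ∈ Finset.range (N - m), residueAlpha α τ y k) := by
  set pA : ℕ → ℂ := fun k => -(Complex.I * τ) - k with hpA
  set pB : ℕ → ℂ := fun k => Complex.I * τ - k with hpB
  set pC : ℕ → ℂ := fun k => -(α : ℂ) - k with hpC
  have imA : ∀ k, (pA k).im = -τ := by intro k; simp [hpA]
  have imB : ∀ k, (pB k).im = τ := by intro k; simp [hpB]
  have imC : ∀ k, (pC k).im = 0 := by intro k; simp [hpC]
  have reA : ∀ k, (pA k).re = -k := by intro k; simp [hpA]
  have reB : ∀ k, (pB k).re = -k := by intro k; simp [hpB]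
  have reC : ∀ k, (pC k).re = -α - k := by intro k; simp [hpC]
  have injA : Function.Injective pA := fun i j h => by
    have := congrArg Complex.re h; rw [reA, reA] at this; exact_mod_cast neg_injective this
  have injB : Function.Injective pB := fun i j h => by
    have := congrArg Complex.re h; rw [reB, reB] at this; exact_mod_cast neg_injective this
  have injC : Function.Injective pC := fun i j h => by
    have := congrArg Complex.re h; rw [reC, reC] at this; exact_mod_cast sub_right_injective this
  set SA := (Finset.range N).image pA with hSA
  set SB := (Finset.range N).image pB with hSB
  set SC := (Finset.range (N - m)).image pC with hSC
  set r : ℂ → ℂ := fun p => limUnder (𝓝[≠] p) (fun s => (s - p) * barnes α τ y s) with hr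
  have tA := fun k => tendsto_barnes_tau (α := α) hy hτ k
  have tB : ∀ k : ℕ, Tendsto (fun s => (s - pB k) * barnes α τ y s) (𝓝[≠] (pB k))
      (𝓝 (residueTau α (-τ) y k)) := by
    intro k
    have := tendsto_barnes_tau (α := α) hy (neg_ne_zero.2 hτ) k
    simp only [barnes_neg, Complex.ofReal_neg, mul_neg, neg_neg] at this
    exact this
  have tC := fun k => tendsto_barnes_alpha hy (by linarith) hτ (α := α) k
  have rA : ∀ k, r (pA k) = residueTau α τ y k := fun k => (tA k).limUnder_eq
  have rB : ∀ k, r (pB k) = residueTau α (-τ) y k := fun k => (tB k).limUnder_eq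
  have rC : ∀ k, r (pC k) = residueAlpha α τ y k := fun k => (tC k).limUnder_eq
  have dAB : Disjoint SA SB := by
    rw [Finset.disjoint_left]
    intro p h1 h2
    obtain ⟨i, _, rfl⟩ := Finset.mem_image.1 h1
    obtain ⟨j, _, h⟩ := Finset.mem_image.1 h2
    have := congrArg Complex.im h
    rw [imA, imB] at this
    apply hτ; linarith
  have dABC : Disjoint (SA ∪ SB) SC := by
    rw [Finset.disjoint_left]
    intro p h1 h2
    obtain ⟨j, _, rfl⟩ := Finset.mem_image.1 h2
    rcases Finset.mem_union.1 h1 with h1 | h1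
    · obtain ⟨i, _, h⟩ := Finset.mem_image.1 h1
      have := congrArg Complex.im h
      rw [imA, imC] at this
      apply hτ; linarith
    · obtain ⟨i, _, h⟩ := Finset.mem_image.1 h1
      have := congrArg Complex.im h
      rw [imB, imC] at this
      apply hτ; linarith
  have hN : (0 : ℝ) ≤ N := N.cast_nonneg
  have key := integral_line_sub_integral_line (SA ∪ SB ∪ SC) (f := barnes α τ y) (r := r)
    (a := β - N) (b := γ) (by linarith) ?_ ?_ ?_ (verticalDecay_barnes α τ hy _ _)
  · rw [key, Finset.sum_union dABC, Finset.sum_union dAB, hSA, hSB, hSC,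
      Finset.sum_image injA.injOn, Finset.sum_image injB.injOn, Finset.sum_image injC.injOn]
    simp only [rA, rB, rC]
  · intro s h1 h2 h3
    rw [Finset.mem_union, Finset.mem_union, not_or, not_or] at h3
    refine differentiableAt_barnes hy (by linarith) (fun k hk => ?_) (fun k hk => ?_)
      (fun k hk => ?_)
    · apply h3.1.1
      refine Finset.mem_image.2 ⟨k, ?_, hk.symm⟩
      have : s.re = -k := by rw [hk]; exact reA k
      rw [Finset.mem_range]
      by_contra hcon
      have : (N : ℝ) ≤ k := by exact_mod_cast not_lt.1 hcon
      linarith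
    · apply h3.1.2
      refine Finset.mem_image.2 ⟨k, ?_, hk.symm⟩
      have : s.re = -k := by rw [hk]; exact reB k
      rw [Finset.mem_range]
      by_contra hcon
      have : (N : ℝ) ≤ k := by exact_mod_cast not_lt.1 hcon
      linarith
    · apply h3.2
      refine Finset.mem_image.2 ⟨k, ?_, hk.symm⟩
      have : s.re = -α - k := by rw [hk]; exact reC k
      rw [Finset.mem_range]
      by_contra hcon
      have h4 : N ≤ k + m := by omega
      have : (N : ℝ) ≤ k + m := by exact_mod_cast h4
      linarith
  · intro p hp
    rcases Finset.mem_union.1 hp with hp | hp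
    · have : ∃ k < N, p.re = -(k : ℝ) := by
        rcases Finset.mem_union.1 hp with hp | hp
        · obtain ⟨k, hk, rfl⟩ := Finset.mem_image.1 hp
          exact ⟨k, Finset.mem_range.1 hk, reA k⟩
        · obtain ⟨k, hk, rfl⟩ := Finset.mem_image.1 hp
          exact ⟨k, Finset.mem_range.1 hk, reB k⟩
      obtain ⟨k, hk, hre⟩ := this
      have h1 : (k : ℝ) + 1 ≤ N := by exact_mod_cast hk
      have h2 : (0 : ℝ) ≤ k := k.cast_nonneg
      rw [hre]
      constructor <;> linarith
    · obtain ⟨k, hk, rfl⟩ := Finset.mem_image.1 hp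
      have h0 : k + m + 1 ≤ N := by
        have := Finset.mem_range.1 hk; omega
      have h1 : (k : ℝ) + m + 1 ≤ N := by exact_mod_cast h0
      have h2 : (0 : ℝ) ≤ k := k.cast_nonneg
      rw [reC]
      constructor <;> linarith
  · intro p hp
    rcases Finset.mem_union.1 hp with hp | hp
    · rcases Finset.mem_union.1 hp with hp | hp
      · obtain ⟨k, hk, rfl⟩ := Finset.mem_image.1 hp
        rw [rA]; exact tA k
      · obtain ⟨k, hk, rfl⟩ := Finset.mem_image.1 hp
        rw [rB]; exact tB k
    · obtain ⟨k, hk, rfl⟩ := Finset.mem_image.1 hp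
      rw [rC]; exact tC k

/-- The integrals along the lines `Re s = β - N` decay geometrically. The hypotheses on `β` and `m`
keep these lines away from the poles. -/
theorem tendsto_integral_barnes {α τ y β : ℝ} {m : ℕ} (hy : 0 < y) (hβ0 : 0 < β)
    (hβ4 : β < 1 / 4) (hm1 : (m : ℝ) < α + β) (hm2 : α + β < m + 1) :
    Tendsto (fun N : ℕ => ∫ t : ℝ, barnes α τ y ((β - N : ℝ) + t * Complex.I)) atTop (𝓝 0) := by
  obtain ⟨R, hR, hq⟩ := barnes_ratio_bound α τ hy
  obtain ⟨N₀, hN₀⟩ := exists_nat_gt (R + β)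
  have hbound : ∀ (n : ℕ) (t : ℝ), ‖barnes α τ y ((β - (n + N₀ : ℕ) : ℝ) + t * Complex.I)‖ ≤
      (1 / 2) ^ n * ‖barnes α τ y ((β - N₀ : ℝ) + t * Complex.I)‖ := by
    intro n t
    induction n with
    | zero => simp
    | succ n ih =>
      have h1 := hq ((β - (n + N₀ : ℕ) : ℝ) + t * Complex.I) (by
        simp
        have : (0 : ℝ) ≤ n := n.cast_nonneg
        linarith)
      have h2 : (((β - (n + 1 + N₀ : ℕ) : ℝ) : ℂ) + t * Complex.I) =
          ((β - (n + N₀ : ℕ) : ℝ) + t * Complex.I) - 1 := by push_cast; ring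
      rw [h2, pow_succ]
      refine h1.trans ?_
      calc _ ≤ 1 / 2 * ((1 / 2) ^ n * ‖barnes α τ y ((β - N₀ : ℝ) + t * Complex.I)‖) := by gcongr
        _ = _ := by ring
  have hint : Integrable (fun t : ℝ => barnes α τ y ((β - N₀ : ℝ) + t * Complex.I)) := by
    refine (verticalDecay_barnes α τ hy (β - N₀) (β - N₀)).integrable_line le_rfl le_rfl fun t => ?_
    have hN : (0 : ℝ) ≤ N₀ := N₀.cast_nonneg
    refine (differentiableAt_barnes hy (by simp; linarith) (fun k hk => ?_) (fun k hk => ?_)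
      (fun k hk => ?_)).continuousAt
    · have := congrArg Complex.re hk
      simp at this
      have h1 : (β : ℝ) = ((N₀ : ℤ) - k : ℤ) := by push_cast; linarith
      rw [h1] at hβ0 hβ4
      have h2 : (0 : ℤ) < (N₀ : ℤ) - k := by exact_mod_cast hβ0
      have h3 : ((N₀ : ℤ) - k : ℤ) < (1 : ℤ) := by
        have : (((N₀ : ℤ) - k : ℤ) : ℝ) < ((1 : ℤ) : ℝ) := by push_cast at hβ4 ⊢; linarith
        exact_mod_cast this
      omega
    · have := congrArg Complex.re hk
      simp at this
      have h1 : (β : ℝ) = ((N₀ : ℤ) - k : ℤ) := by push_cast; linarith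
      rw [h1] at hβ0 hβ4
      have h2 : (0 : ℤ) < (N₀ : ℤ) - k := by exact_mod_cast hβ0
      have h3 : ((N₀ : ℤ) - k : ℤ) < (1 : ℤ) := by
        have : (((N₀ : ℤ) - k : ℤ) : ℝ) < ((1 : ℤ) : ℝ) := by push_cast at hβ4 ⊢; linarith
        exact_mod_cast this
      omega
    · have := congrArg Complex.re hk
      simp at this
      have h1 : α + β = ((N₀ : ℤ) - k : ℤ) := by push_cast; linarith
      rw [h1] at hm1 hm2
      have h2 : (m : ℤ) < (N₀ : ℤ) - k := by exact_mod_cast hm1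
      have h3 : ((N₀ : ℤ) - k : ℤ) < (m : ℤ) + 1 := by exact_mod_cast hm2
      omega
  rw [← tendsto_add_atTop_iff_nat N₀]
  have hlim : Tendsto (fun n : ℕ => (1 / 2 : ℝ) ^ n *
      ∫ t : ℝ, ‖barnes α τ y ((β - N₀ : ℝ) + t * Complex.I)‖) atTop (𝓝 0) := by
    simpa using (tendsto_pow_atTop_nhds_zero_of_lt_one (by norm_num) (by norm_num :
      (1 / 2 : ℝ) < 1)).mul_const (∫ t : ℝ, ‖barnes α τ y ((β - N₀ : ℝ) + t * Complex.I)‖)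
  refine squeeze_zero_norm (fun n => ?_) hlim
  rw [← integral_const_mul]
  exact norm_integral_le_of_norm_le (hint.norm.const_mul _) (Eventually.of_forall (hbound n))

/-- Closing the contour to the left: the Mellin–Barnes integral is the sum of the three series of
residues. -/
theorem integral_barnes {α τ y γ : ℝ} (hy : 0 < y) (hτ : τ ≠ 0) (hγ₁ : max (-α) 0 < γ)
    (hγ₂ : γ < 1 / 4) (hA : Summable (residueTau α τ y)) (hB : Summable (residueTau α (-τ) y))
    (hC : Summable (residueAlpha α τ y)) :
    ∫ t : ℝ, barnes α τ y (γ + t * Complex.I) =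
      2 * Real.pi * (∑' k, residueTau α τ y k + ∑' k, residueTau α (-τ) y k +
        ∑' k, residueAlpha α τ y k) := by
  -- an abscissa `β` such that no line `Re s = β - N` meets a pole
  obtain ⟨β, m, hβ0, hβα, hβγ, hm1, hm2⟩ : ∃ (β : ℝ) (m : ℕ), 0 < β ∧ -α < β ∧ β < γ ∧
      (m : ℝ) < α + β ∧ α + β < m + 1 := by
    obtain ⟨h1, h2⟩ := max_lt_iff.1 hγ₁
    set L := max (-α) 0 with hL
    have hL0 : 0 ≤ L := le_max_right _ _
    have hLα : -α ≤ L := le_max_left _ _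
    set m := ⌊α + L⌋₊ with hm
    have hf1 : (m : ℝ) ≤ α + L := Nat.floor_le (by linarith)
    have hf2 : α + L < m + 1 := Nat.lt_floor_add_one _
    set δ := min (γ - L) (m + 1 - (α + L)) with hδ
    have hδ0 : 0 < δ := lt_min (by linarith) (by linarith)
    have hδ1 : δ ≤ γ - L := min_le_left _ _
    have hδ2 : δ ≤ m + 1 - (α + L) := min_le_right _ _
    exact ⟨L + δ / 2, m, by linarith, by linarith, by linarith, by linarith, by linarith⟩
  have t0 := tendsto_integral_barnes (τ := τ) hy hβ0 (by linarith) hm1 hm2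
  have t1 := (tendsto_const_nhds (x := ∫ t : ℝ, barnes α τ y (γ + t * Complex.I))).sub t0
  rw [sub_zero] at t1
  have t2 := ((hA.hasSum.tendsto_sum_nat.add hB.hasSum.tendsto_sum_nat).add
    (hC.hasSum.tendsto_sum_nat.comp (tendsto_sub_atTop_nat m))).const_mul (2 * Real.pi : ℂ)
  refine tendsto_nhds_unique (t1.congr fun N => ?_) t2
  exact integral_barnes_sub hy hτ hβ0 hβα hβγ hγ₂ hm1 hm2 N

/-! ### Products of Bessel functions and the Weber kernel -/

theorem ringChoose_eq_Gamma {r : ℂ} {k : ℕ} (hr : ∀ m : ℕ, r - k + 1 ≠ -m) :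
    Ring.choose r k =
      Complex.Gamma (r + 1) / ((k.factorial : ℂ) * Complex.Gamma (r - k + 1)) := by
  rw [Ring.choose_eq_smul, Polynomial.descPochhammer_smeval_eq_ascPochhammer,
    Polynomial.ascPochhammer_smeval_eq_eval, ← Complex.Gamma_add_nat_div_Gamma_eq _ hr, smul_eq_mul,
    show r - k + 1 + (k : ℂ) = r + 1 by ring]
  field_simp

/-- The Chu–Vandermonde identity in the form needed for the product of two Bessel series. -/
theorem sum_antidiagonal_Gamma {μ ν : ℂ} (hμ : ∀ m : ℕ, μ ≠ -m) (hν : ∀ m : ℕ, ν ≠ -m)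
    (hμν : -1 < (μ + ν).re) (n : ℕ) :
    ∑ ij ∈ Finset.HasAntidiagonal.antidiagonal n,
      1 / ((ij.1.factorial : ℂ) * Complex.Gamma (μ + ij.1 + 1)) *
        (1 / ((ij.2.factorial : ℂ) * Complex.Gamma (ν + ij.2 + 1))) =
      Complex.Gamma (μ + ν + 2 * n + 1) / ((n.factorial : ℂ) * Complex.Gamma (μ + n + 1) *
        Complex.Gamma (ν + n + 1) * Complex.Gamma (μ + ν + n + 1)) := by
  have hshift : ∀ {c : ℂ}, (∀ m : ℕ, c ≠ -m) → ∀ j m : ℕ, c + j + 1 ≠ -m := by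
    intro c hc j m h
    apply hc (j + 1 + m)
    push_cast
    linear_combination h
  have h1 := Ring.add_choose_eq (r := ν + n) (s := μ + n) n (Commute.all _ _)
  have hG : ∀ {c : ℂ}, (∀ m : ℕ, c ≠ -m) → ∀ j : ℕ, Complex.Gamma (c + j + 1) ≠ 0 :=
    fun hc j => Complex.Gamma_ne_zero (hshift hc j)
  have hL : Ring.choose (ν + n + (μ + n)) n = Complex.Gamma (μ + ν + 2 * n + 1) /
      ((n.factorial : ℂ) * Complex.Gamma (μ + ν + n + 1)) := by
    rw [ringChoose_eq_Gamma]
    · congr 2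
      · ring
      · congr 2; ring
    · apply ne_neg_nat_of_re_pos
      have : ν + n + (μ + n) - n + 1 = μ + ν + n + 1 := by ring
      rw [this]
      simp only [Complex.add_re, Complex.natCast_re, Complex.one_re] at hμν ⊢
      have : (0 : ℝ) ≤ n := n.cast_nonneg
      linarith
  rw [hL] at h1
  have e : ∀ ij ∈ Finset.HasAntidiagonal.antidiagonal n,
      Ring.choose (ν + n) ij.1 * Ring.choose (μ + n) ij.2 =
      Complex.Gamma (μ + n + 1) * Complex.Gamma (ν + n + 1) *
      (1 / ((ij.1.factorial : ℂ) * Complex.Gamma (μ + ij.1 + 1)) *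
        (1 / ((ij.2.factorial : ℂ) * Complex.Gamma (ν + ij.2 + 1)))) := by
    rintro ⟨i, j⟩ hij
    have hn : (n : ℂ) = i + j := by
      have := Finset.HasAntidiagonal.mem_antidiagonal.1 hij
      rw [← this]; push_cast; ring
    have e1 : ν + n - i + 1 = ν + j + 1 := by rw [hn]; ring
    have e2 : μ + n - j + 1 = μ + i + 1 := by rw [hn]; ring
    rw [ringChoose_eq_Gamma (by rw [e1]; exact hshift hν j),
      ringChoose_eq_Gamma (by rw [e2]; exact hshift hμ i), e1, e2]
    have := hG hμ i
    have := hG hν j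
    field_simp
  rw [Finset.sum_congr rfl e, ← Finset.mul_sum] at h1
  have g1 := hG hμ n
  have g2 := hG hν n
  have h2 : ∀ A B P S F L : ℂ, A ≠ 0 → B ≠ 0 → L / (F * P) = A * B * S →
      S = L / (F * A * B * P) := by
    intro A B P S F L hA hB h
    rw [show F * A * B * P = F * P * (A * B) by ring, ← div_div, h, mul_comm (A * B),
      mul_div_assoc, div_self (mul_ne_zero hA hB), mul_one]
  exact h2 _ _ _ _ _ _ g1 g2 h1

theorem summable_norm_besselJ {μ w : ℂ} (hw : w ≠ 0) :
    Summable fun k : ℕ => ‖(-1 : ℂ) ^ k / ((k.factorial : ℂ) * Complex.Gamma (μ + k + 1)) *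
      w ^ (μ + 2 * (k : ℂ))‖ := by
  set f : ℕ → ℂ := fun k => (-1 : ℂ) ^ k / ((k.factorial : ℂ) * Complex.Gamma (μ + k + 1)) *
      w ^ (μ + 2 * (k : ℂ)) with hf
  have hsum : Summable f := by
    apply summable_of_ratio_norm_eventually_le (r := 1 / 2) (by norm_num)
    obtain ⟨N, hN⟩ := exists_nat_gt (max ‖μ‖ (2 * ‖w‖ ^ 2))
    filter_upwards [eventually_ge_atTop N] with k hk
    have hk' : (N : ℝ) ≤ k := by exact_mod_cast hk
    have h1 : ‖μ‖ < k := lt_of_le_of_lt (le_max_left _ _) (hN.trans_le hk')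
    have h2 : 2 * ‖w‖ ^ 2 < k := lt_of_le_of_lt (le_max_right _ _) (hN.trans_le hk')
    have h3 : 1 ≤ ‖μ + k + 1‖ := by
      have := norm_sub_le (μ + k + 1) μ
      rw [show μ + k + 1 - μ = ((k + 1 : ℕ) : ℂ) by push_cast; ring, Complex.norm_natCast] at this
      push_cast at this
      linarith
    have h4 : μ + k + 1 ≠ 0 := norm_pos_iff.1 (by linarith)
    have hrec : f (k + 1) = f k * (-(w ^ 2) / ((k + 1) * (μ + k + 1))) := by
      have g : Complex.Gamma (μ + (k + 1 : ℕ) + 1) = (μ + k + 1) * Complex.Gamma (μ + k + 1) := by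
        rw [← Complex.Gamma_add_one _ h4]; push_cast; congr 1; ring
      have p : w ^ (μ + 2 * ((k + 1 : ℕ) : ℂ)) = w ^ (μ + 2 * (k : ℂ)) * w ^ 2 := by
        rw [← Complex.cpow_natCast w 2, ← Complex.cpow_add _ _ hw]
        push_cast; congr 1; ring
      simp only [hf]
      rw [g, p, Nat.factorial_succ, pow_succ]
      push_cast
      rw [div_mul_eq_mul_div, div_mul_eq_mul_div, div_mul_div_comm]
      congr 1 <;> ring
    rw [hrec, norm_mul, mul_comm]
    gcongr
    rw [norm_div, norm_neg, norm_pow, norm_mul]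
    have h5 : ‖((k : ℂ) + 1)‖ = k + 1 := by
      rw [← Nat.cast_succ, Complex.norm_natCast]; push_cast; ring
    rw [h5, div_le_iff₀ (by positivity)]
    nlinarith [sq_nonneg ‖w‖]
  exact hsum.norm

/-- The general term of the power series of `J_μ(√x) J_ν(√x)` with `y = x/4`. -/
noncomputable def besselProdTerm (μ ν : ℂ) (y : ℝ) (n : ℕ) : ℂ :=
  (-1) ^ n * Complex.Gamma (μ + ν + 2 * n + 1) / ((n.factorial : ℂ) * Complex.Gamma (μ + n + 1) *
    Complex.Gamma (ν + n + 1) * Complex.Gamma (μ + ν + n + 1)) * (y : ℂ) ^ ((μ + ν) / 2 + n)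

theorem sqrt_div_two_cpow {x : ℝ} (hx : 0 < x) (c : ℂ) :
    ((Real.sqrt x : ℂ) / 2) ^ c = ((x / 4 : ℝ) : ℂ) ^ (c / 2) := by
  have h1 : (0 : ℝ) < Real.sqrt x / 2 := by positivity
  have h2 : (x / 4 : ℝ) = (Real.sqrt x / 2) ^ 2 := by
    rw [div_pow, Real.sq_sqrt hx.le]; norm_num
  have h3 : ((Real.sqrt x : ℂ) / 2) = ((Real.sqrt x / 2 : ℝ) : ℂ) := by push_cast; ring
  rw [h3, h2, Complex.cpow_def_of_ne_zero (by exact_mod_cast h1.ne'),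
    Complex.cpow_def_of_ne_zero (by exact_mod_cast (pow_pos h1 2).ne'), ← Complex.ofReal_log h1.le,
    ← Complex.ofReal_log (pow_pos h1 2).le, Real.log_pow]
  congr 1
  push_cast
  ring

theorem hasSum_besselJ_mul_besselJ {μ ν : ℂ} {x : ℝ} (hx : 0 < x) (hμ : ∀ m : ℕ, μ ≠ -m)
    (hν : ∀ m : ℕ, ν ≠ -m) (hμν : -1 < (μ + ν).re) :
    HasSum (besselProdTerm μ ν (x / 4)) (besselJ μ (Real.sqrt x) * besselJ ν (Real.sqrt x)) := by
  set w : ℂ := (Real.sqrt x : ℂ) / 2 with hw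
  have hw0 : w ≠ 0 := by
    have : (0 : ℝ) < Real.sqrt x := by positivity
    rw [hw]
    exact div_ne_zero (by exact_mod_cast this.ne') two_ne_zero
  have s1 := summable_norm_besselJ (μ := μ) hw0
  have s2 := summable_norm_besselJ (μ := ν) hw0
  have hs := (summable_norm_sum_mul_antidiagonal_of_summable_norm s1 s2).of_norm
  have hp := tsum_mul_tsum_eq_tsum_sum_antidiagonal_of_summable_norm s1 s2
  have h := hs.hasSum
  rw [← hp] at h
  refine (congrArg (fun f => HasSum f (besselJ μ (Real.sqrt x) * besselJ ν (Real.sqrt x)))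
    (funext fun n => ?_)).mpr h
  have e : ∀ ij ∈ Finset.HasAntidiagonal.antidiagonal n,
      (-1 : ℂ) ^ ij.1 / ((ij.1.factorial : ℂ) * Complex.Gamma (μ + ij.1 + 1)) *
        w ^ (μ + 2 * (ij.1 : ℂ)) *
      ((-1 : ℂ) ^ ij.2 / ((ij.2.factorial : ℂ) * Complex.Gamma (ν + ij.2 + 1)) *
        w ^ (ν + 2 * (ij.2 : ℂ))) =
      (-1) ^ n * w ^ (μ + ν + 2 * (n : ℂ)) *
      (1 / ((ij.1.factorial : ℂ) * Complex.Gamma (μ + ij.1 + 1)) *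
        (1 / ((ij.2.factorial : ℂ) * Complex.Gamma (ν + ij.2 + 1)))) := by
    rintro ⟨i, j⟩ hij
    have hn := Finset.HasAntidiagonal.mem_antidiagonal.1 hij
    simp only at hn ⊢
    have hn' : (n : ℂ) = i + j := by rw [← hn]; push_cast; ring
    have p : w ^ (μ + ν + 2 * (n : ℂ)) = w ^ (μ + 2 * (i : ℂ)) * w ^ (ν + 2 * (j : ℂ)) := by
      rw [← Complex.cpow_add _ _ hw0, hn']; congr 1; ring
    rw [p, ← hn, pow_add]
    ring
  rw [Finset.sum_congr rfl e, ← Finset.mul_sum, sum_antidiagonal_Gamma hμ hν hμν, besselProdTerm,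
    hw, sqrt_div_two_cpow hx, show (μ + ν + 2 * (n : ℂ)) / 2 = (μ + ν) / 2 + n by ring]
  ring

/-- On the positive axis `J` commutes with conjugation; this is what turns the imaginary part in the
Weber kernel into a combination of products of Bessel functions. -/
theorem conj_besselJ (ν : ℂ) {r : ℝ} (hr : 0 < r) :
    (starRingEnd ℂ) (besselJ ν r) = besselJ ((starRingEnd ℂ) ν) r := by
  have h : ∀ f : ℕ → ℂ, (starRingEnd ℂ) (∑' k, f k) = ∑' k, (starRingEnd ℂ) (f k) :=
    fun f => Complex.conjCLE.map_tsum
  rw [besselJ, besselJ, h]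
  congr 1
  ext k
  have h2 : (r : ℂ) / 2 = ((r / 2 : ℝ) : ℂ) := by push_cast; ring
  have harg : (((r / 2 : ℝ) : ℂ)).arg ≠ Real.pi := by
    rw [Complex.arg_ofReal_of_nonneg (by positivity)]; exact Real.pi_pos.ne
  have hc : (starRingEnd ℂ) (((r / 2 : ℝ) : ℂ) ^ (ν + 2 * (k : ℂ))) =
      ((r / 2 : ℝ) : ℂ) ^ ((starRingEnd ℂ) (ν + 2 * (k : ℂ))) := by
    rw [Complex.cpow_conj _ _ harg, Complex.conj_ofReal]
  rw [h2, map_mul, map_div₀, map_mul, ← Complex.Gamma_conj, hc]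
  simp [map_ofNat]

theorem sin_pi_mul_ne_zero_of_im_ne_zero {ν : ℂ} (h : ν.im ≠ 0) :
    Complex.sin (Real.pi * ν) ≠ 0 := by
  rw [Ne, Complex.sin_eq_zero_iff]
  rintro ⟨k, hk⟩
  have := congrArg Complex.im hk
  simp [Real.pi_ne_zero] at this
  exact h this

theorem Gamma_neg_sub_nat {ν : ℂ} (h : ν.im ≠ 0) (k : ℕ) :
    Complex.Gamma (-ν - k) =
      -(Real.pi * (-1) ^ k / Complex.sin (Real.pi * ν)) * (Complex.Gamma (ν + k + 1))⁻¹ := by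
  have h1 := Complex.Gamma_mul_Gamma_one_sub (-ν - k)
  have h2 : Complex.sin (Real.pi * (-ν - k)) = -((-1) ^ k * Complex.sin (Real.pi * ν)) := by
    rw [show (Real.pi : ℂ) * (-ν - k) = -(Real.pi * ν + k * Real.pi) by ring, Complex.sin_neg,
      Complex.sin_antiperiodic.add_nat_mul_eq]
  have h3 : Complex.Gamma (ν + k + 1) ≠ 0 :=
    Complex.Gamma_ne_zero (ne_neg_nat_of_im_ne_zero (by simpa using h))
  have h4 := sin_pi_mul_ne_zero_of_im_ne_zero h
  have h5 : ((-1 : ℂ) ^ k) * (-1) ^ k = 1 := by rw [← mul_pow]; simp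
  have h6 : ((-1 : ℂ) ^ k) ≠ 0 := pow_ne_zero _ (by norm_num)
  rw [show (1 : ℂ) - (-ν - k) = ν + k + 1 by ring, h2] at h1
  rw [← div_eq_mul_inv, eq_div_iff h3, h1]
  field_simp
  linear_combination h5

theorem residueAlpha_eq {α τ y : ℝ} (hτ : τ ≠ 0) (k : ℕ) :
    residueAlpha α τ y k = (Real.pi : ℂ) ^ 2 / (Complex.sin (Real.pi * (α + Complex.I * τ)) *
      Complex.sin (Real.pi * (α - Complex.I * τ))) *
      besselProdTerm (α + Complex.I * τ) (α - Complex.I * τ) y k := by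
  have h5 : ((-1 : ℂ) ^ k) * (-1) ^ k = 1 := by rw [← mul_pow]; simp
  rw [residueAlpha, besselProdTerm, Gamma_neg_sub_nat (by simpa using hτ),
    Gamma_neg_sub_nat (by simpa using hτ),
    show (α + Complex.I * τ + (α - Complex.I * τ) + 2 * k + 1 : ℂ) = 1 + 2 * α + 2 * k by ring,
    show (α + Complex.I * τ + (α - Complex.I * τ) + k + 1 : ℂ) = 1 + 2 * α + k by ring,
    show ((α + Complex.I * τ + (α - Complex.I * τ)) / 2 + k : ℂ) = α + k by ring]
  generalize Complex.Gamma (α + Complex.I * τ + k + 1) = A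
  generalize Complex.Gamma (α - Complex.I * τ + k + 1) = B
  generalize Complex.Gamma (1 + 2 * α + k) = D
  simp only [div_eq_mul_inv, mul_inv]
  linear_combination (Real.pi ^ 2 * (-1) ^ k * (k.factorial : ℂ)⁻¹ *
    (Complex.sin (Real.pi * (α + Complex.I * τ)))⁻¹ *
    (Complex.sin (Real.pi * (α - Complex.I * τ)))⁻¹ * A⁻¹ * B⁻¹ * D⁻¹ *
    Complex.Gamma (1 + 2 * α + 2 * k) * (y : ℂ) ^ ((α : ℂ) + k)) * h5

theorem residueTau_eq {α τ y : ℝ} (hτ : τ ≠ 0) (k : ℕ) :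
    residueTau α τ y k = -((Real.pi : ℂ) ^ 2 / (Complex.sin (Real.pi * (2 * (Complex.I * τ))) *
      Complex.sin (Real.pi * (α - Complex.I * τ)))) *
      besselProdTerm (α + Complex.I * τ) (-(α - Complex.I * τ)) y k := by
  have h5 : ((-1 : ℂ) ^ k) * (-1) ^ k = 1 := by rw [← mul_pow]; simp
  have g2 := Gamma_neg_sub_nat (ν := -(α - Complex.I * τ)) (by simpa using hτ) k
  rw [neg_neg, mul_neg, Complex.sin_neg] at g2
  rw [residueTau, besselProdTerm, Gamma_neg_sub_nat (by simpa using hτ), g2,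
    show (α + Complex.I * τ + -(α - Complex.I * τ) + 2 * k + 1 : ℂ) =
      1 + 2 * (Complex.I * τ) + 2 * k by ring,
    show (α + Complex.I * τ + -(α - Complex.I * τ) + k + 1 : ℂ) =
      2 * (Complex.I * τ) + k + 1 by ring,
    show ((α + Complex.I * τ + -(α - Complex.I * τ)) / 2 + k : ℂ) = Complex.I * τ + k by ring,
    show (1 + α + Complex.I * τ + k : ℂ) = α + Complex.I * τ + k + 1 by ring]
  generalize Complex.Gamma (α + Complex.I * τ + k + 1) = A
  generalize Complex.Gamma (-(α - Complex.I * τ) + k + 1) = B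
  generalize Complex.Gamma (2 * (Complex.I * τ) + k + 1) = D
  simp only [div_eq_mul_inv, mul_inv, inv_neg]
  linear_combination -(Real.pi ^ 2 * (-1) ^ k * (k.factorial : ℂ)⁻¹ *
    (Complex.sin (Real.pi * (2 * (Complex.I * τ))))⁻¹ *
    (Complex.sin (Real.pi * (α - Complex.I * τ)))⁻¹ * A⁻¹ * B⁻¹ * D⁻¹ *
    Complex.Gamma (1 + 2 * (Complex.I * τ) + 2 * k) * (y : ℂ) ^ (Complex.I * τ + k)) * h5

/-- The Weber kernel as a Mellin–Barnes integral: the three series of residues are the power series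
of `J_ν J_{-ν'}`, `J_{ν'} J_{-ν}` and `J_ν J_{ν'}`, with `ν = α + iτ` and `ν' = α - iτ`. -/
theorem weberKernel_eq_integral_barnes {α γ x τ : ℝ} (hγ₁ : max (-α) 0 < γ) (hγ₂ : γ < 1 / 4)
    (hx : 0 < x) (hτ : τ ≠ 0) :
    (weberKernel α x τ : ℂ) = Complex.cosh (Real.pi * τ) / (2 * Real.pi ^ 3) *
      ∫ t : ℝ, barnes α τ (x / 4) (γ + t * Complex.I) := by
  have hα : -(1 / 4) < α := by linarith [(max_lt_iff.1 hγ₁).1]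
  have hr : 0 < Real.sqrt x := by positivity
  set ν : ℂ := α + Complex.I * τ with hν
  set ν' : ℂ := α - Complex.I * τ with hν'
  have hconj : (starRingEnd ℂ) ν = ν' := by simp [hν, hν', sub_eq_add_neg]
  have hconj' : (starRingEnd ℂ) ν' = ν := by rw [← hconj, Complex.conj_conj]
  have imν : ν.im = τ := by simp [hν]
  have imν' : ν'.im = -τ := by simp [hν']
  have s1 : Complex.sin (Real.pi * ν) ≠ 0 := sin_pi_mul_ne_zero_of_im_ne_zero (by rw [imν]; exact hτ)
  have s2 : Complex.sin (Real.pi * ν') ≠ 0 :=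
    sin_pi_mul_ne_zero_of_im_ne_zero (by rw [imν']; exact neg_ne_zero.2 hτ)
  have nν := ne_neg_nat_of_im_ne_zero (s := ν) (by rw [imν]; exact hτ)
  have nν' := ne_neg_nat_of_im_ne_zero (s := ν') (by rw [imν']; exact neg_ne_zero.2 hτ)
  have mν := ne_neg_nat_of_im_ne_zero (s := -ν) (by
    rw [Complex.neg_im, imν]; exact neg_ne_zero.2 hτ)
  have mν' := ne_neg_nat_of_im_ne_zero (s := -ν') (by
    rw [Complex.neg_im, imν', neg_neg]; exact hτ)
  have hC := hasSum_besselJ_mul_besselJ hx nν nν' (by simp [hν, hν']; linarith)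
  have hA := hasSum_besselJ_mul_besselJ hx nν mν' (by simp [hν, hν'])
  have hB := hasSum_besselJ_mul_besselJ hx nν' mν (by simp [hν, hν'])
  have hC' : HasSum (residueAlpha α τ (x / 4)) ((Real.pi : ℂ) ^ 2 / (Complex.sin (Real.pi * ν) *
      Complex.sin (Real.pi * ν')) * (besselJ ν (Real.sqrt x) * besselJ ν' (Real.sqrt x))) := by
    rw [show residueAlpha α τ (x / 4) = _ from
      funext fun k => residueAlpha_eq (α := α) (y := x / 4) hτ k]
    exact hC.mul_left _
  have hA' : HasSum (residueTau α τ (x / 4)) (-((Real.pi : ℂ) ^ 2 /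
      (Complex.sin (Real.pi * (2 * (Complex.I * τ))) * Complex.sin (Real.pi * ν'))) *
      (besselJ ν (Real.sqrt x) * besselJ (-ν') (Real.sqrt x))) := by
    rw [show residueTau α τ (x / 4) = _ from
      funext fun k => residueTau_eq (α := α) (y := x / 4) hτ k]
    exact hA.mul_left _
  have hB' : HasSum (residueTau α (-τ) (x / 4)) ((Real.pi : ℂ) ^ 2 /
      (Complex.sin (Real.pi * (2 * (Complex.I * τ))) * Complex.sin (Real.pi * ν)) *
      (besselJ ν' (Real.sqrt x) * besselJ (-ν) (Real.sqrt x))) := by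
    rw [show residueTau α (-τ) (x / 4) = _ from
      funext fun k => residueTau_eq (α := α) (y := x / 4) (neg_ne_zero.2 hτ) k]
    simp only [Complex.ofReal_neg, mul_neg, sub_neg_eq_add, ← sub_eq_add_neg, Complex.sin_neg,
      neg_mul, div_neg, neg_neg]
    exact hB.mul_left _
  rw [integral_barnes (by positivity) hτ hγ₁ hγ₂ hA'.summable hB'.summable hC'.summable,
    hA'.tsum_eq, hB'.tsum_eq, hC'.tsum_eq]
  have cJ : (starRingEnd ℂ) (besselJ ν (Real.sqrt x)) = besselJ ν' (Real.sqrt x) := by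
    rw [conj_besselJ _ hr, hconj]
  have cJ' : (starRingEnd ℂ) (besselJ ν' (Real.sqrt x)) = besselJ ν (Real.sqrt x) := by
    rw [conj_besselJ _ hr, hconj']
  have cN : (starRingEnd ℂ) (besselJ (-ν') (Real.sqrt x)) = besselJ (-ν) (Real.sqrt x) := by
    rw [conj_besselJ _ hr, map_neg, hconj']
  have cs : (starRingEnd ℂ) (Complex.sin (Real.pi * ν')) = Complex.sin (Real.pi * ν) := by
    rw [← Complex.sin_conj, map_mul, hconj', Complex.conj_ofReal]
  have cc : (starRingEnd ℂ) (Complex.cos (Real.pi * ν')) = Complex.cos (Real.pi * ν) := by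
    rw [← Complex.cos_conj, map_mul, hconj', Complex.conj_ofReal]
  have hY : besselY ν' (Real.sqrt x) = (besselJ ν' (Real.sqrt x) * Complex.cos (Real.pi * ν') -
      besselJ (-ν') (Real.sqrt x)) / Complex.sin (Real.pi * ν') := by
    rw [besselY, if_neg s2, besselYQuot]
  have hsin2 : Complex.sin (Real.pi * (2 * (Complex.I * τ))) =
      2 * Complex.I * (Complex.sinh (Real.pi * τ) * Complex.cosh (Real.pi * τ)) := by
    rw [show (Real.pi : ℂ) * (2 * (Complex.I * τ)) = 2 * ((Real.pi * τ) * Complex.I) by ring,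
      Complex.sin_two_mul, Complex.sin_mul_I, Complex.cos_mul_I]
    ring
  have hdiff : Complex.sin (Real.pi * ν) * Complex.cos (Real.pi * ν') -
      Complex.cos (Real.pi * ν) * Complex.sin (Real.pi * ν') =
      2 * Complex.I * (Complex.sinh (Real.pi * τ) * Complex.cosh (Real.pi * τ)) := by
    rw [← hsin2, ← Complex.sin_sub]
    congr 1
    rw [hν, hν']; ring
  have hsh : Complex.sinh (Real.pi * τ) ≠ 0 := by
    rw [← Complex.ofReal_mul, ← Complex.ofReal_sinh]
    exact_mod_cast Real.sinh_ne_zero.2 (mul_ne_zero Real.pi_ne_zero hτ)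
  have hch : Complex.cosh (Real.pi * τ) ≠ 0 := by
    rw [← Complex.ofReal_mul, ← Complex.ofReal_cosh]
    exact_mod_cast (Real.cosh_pos _).ne'
  have hpi : (Real.pi : ℂ) ≠ 0 := by exact_mod_cast Real.pi_ne_zero
  have hI := Complex.I_ne_zero
  rw [weberKernel, ← hν, ← hν', hY, Complex.ofReal_div, Complex.ofReal_sinh, Complex.ofReal_mul,
    Complex.im_eq_sub_conj]
  simp only [map_mul, map_div₀, map_sub, cJ, cJ', cN, cs, cc]
  rw [hsin2]
  generalize besselJ ν (Real.sqrt x) = A at *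
  generalize besselJ ν' (Real.sqrt x) = B at *
  generalize besselJ (-ν) (Real.sqrt x) = C at *
  generalize besselJ (-ν') (Real.sqrt x) = D at *
  generalize Complex.sin (Real.pi * ν) = s at *
  generalize Complex.sin (Real.pi * ν') = s' at *
  generalize Complex.cos (Real.pi * ν) = c at *
  generalize Complex.cos (Real.pi * ν') = c' at *
  generalize Complex.sinh (Real.pi * τ) = u at *
  generalize Complex.cosh (Real.pi * τ) = v at *
  field_simp
  linear_combination A * B * hdiff

section Fourier

open scoped FourierTransform SchwartzMap ContDiff

/-! ### Plancherel's theorem for the Fourier integral -/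

/-- The `L²` Fourier transform of an integrable function is given by the Fourier integral: the two
agree as tempered distributions. -/
theorem coeFn_fourier_toLp {f : ℝ → ℂ} (hf1 : Integrable f) (hf2 : MemLp f 2 volume) :
    (𝓕 (hf2.toLp f) : Lp ℂ 2 (volume : Measure ℝ)) =ᵐ[volume] 𝓕 f := by
  have hcont : Continuous (𝓕 f) :=
    VectorFourier.fourierIntegral_continuous Real.continuous_fourierChar continuous_inner hf1
  apply ae_eq_of_integral_contDiff_smul_eq
  · exact (Lp.memLp _).locallyIntegrable (by norm_num)
  · exact hcont.locallyIntegrable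
  · intro φ hφ hc
    have hg₁ : HasCompactSupport (Complex.ofRealCLM ∘ φ) := hc.comp_left rfl
    have hg₂ : ContDiff ℝ ∞ (Complex.ofRealCLM ∘ φ) := by fun_prop
    set ψ : 𝓢(ℝ, ℂ) := hg₁.toSchwartzMap hg₂ with hψ
    have h1 := congrArg (fun T : 𝓢'(ℝ, ℂ) => T ψ)
      (Lp.fourier_toTemperedDistribution_eq (hf2.toLp f))
    simp only [TemperedDistribution.fourier_apply, Lp.toTemperedDistribution_apply] at h1
    have h2 : ∫ x : ℝ, (𝓕 ψ) x • (hf2.toLp f) x = ∫ x : ℝ, (𝓕 ψ) x • f x := by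
      apply integral_congr_ae
      filter_upwards [hf2.coeFn_toLp] with x hx
      rw [hx]
    have h3 : ∫ x : ℝ, (𝓕 ψ) x • f x = ∫ x : ℝ, ψ x • (𝓕 f) x := by
      simpa using! VectorFourier.integral_bilin_fourierIntegral_eq_flip
        (ContinuousLinearMap.lsmul ℂ ℂ : ℂ →L[ℂ] ℂ →L[ℂ] ℂ) (L := innerₗ ℝ)
        Real.continuous_fourierChar continuous_inner ψ.integrable hf1
    rw [h2, h3] at h1
    have h4 : ∀ x, ψ x = (φ x : ℂ) := by intro x; simp [hψ]
    simp only [h4] at h1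
    simpa using h1.symm

theorem memLp_fourier {f : ℝ → ℂ} (hf1 : Integrable f) (hf2 : MemLp f 2 volume) :
    MemLp (𝓕 f) 2 volume :=
  (memLp_congr_ae (coeFn_fourier_toLp hf1 hf2)).1 (Lp.memLp _)

/-- Transposing the Fourier transform by Plancherel: pairing `g ∈ L²` with Fourier transforms is
pairing some `h` of the same norm (in fact the Fourier transform of `g`) with the functions
themselves. The two conjugations turn the sesquilinear Plancherel identity into a bilinear one. -/
theorem exists_fourier_transpose {g : ℝ → ℂ} (hg : MemLp g 2 volume) :
    ∃ h : ℝ → ℂ, MemLp h 2 volume ∧ eLpNorm h 2 volume = eLpNorm g 2 volume ∧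
      ∀ f : ℝ → ℂ, Integrable f → MemLp f 2 volume → ∫ τ, 𝓕 f τ * g τ = ∫ v, f v * h v := by
  have hgc : MemLp (fun τ => (starRingEnd ℂ) (g τ)) 2 volume := hg.star
  set G : Lp ℂ 2 (volume : Measure ℝ) := hgc.toLp _ with hG
  set H : Lp ℂ 2 (volume : Measure ℝ) := (Lp.fourierTransformₗᵢ ℝ ℂ).symm G with hH
  have hFH : (𝓕 H : Lp ℂ 2 (volume : Measure ℝ)) = G :=
    (Lp.fourierTransformₗᵢ ℝ ℂ).apply_symm_apply G
  have norm_star : ∀ u : ℝ → ℂ, eLpNorm (fun v => (starRingEnd ℂ) (u v)) 2 volume =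
      eLpNorm u 2 volume := fun u =>
    eLpNorm_congr_norm_ae (Eventually.of_forall fun v => by simp)
  refine ⟨fun v => (starRingEnd ℂ) (H v), (Lp.memLp H).star, ?_, fun f hf1 hf2 => ?_⟩
  · have h1 : ‖H‖ = ‖G‖ := (Lp.fourierTransformₗᵢ ℝ ℂ).symm.norm_map G
    have h2 : ‖H‖ₑ = ‖G‖ₑ := by
      rw [← ofReal_norm, ← ofReal_norm, h1]
    rw [Lp.enorm_def, Lp.enorm_def] at h2
    rw [norm_star, h2, eLpNorm_congr_ae hgc.coeFn_toLp, norm_star]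
  · have h1 := Lp.inner_fourier_eq H (hf2.toLp f)
    rw [hFH, L2.inner_def, L2.inner_def] at h1
    calc ∫ τ, 𝓕 f τ * g τ
        = ∫ τ, inner ℂ (G τ) ((𝓕 (hf2.toLp f) : Lp ℂ 2 (volume : Measure ℝ)) τ) := by
          apply integral_congr_ae
          filter_upwards [coeFn_fourier_toLp hf1 hf2, hgc.coeFn_toLp] with τ e1 e2
          rw [e1, e2]
          simp
      _ = _ := h1
      _ = _ := by
          apply integral_congr_ae
          filter_upwards [hf2.coeFn_toLp] with v e1
          rw [e1]
          simp

/-! ### Fourier transforms of powers of the hyperbolic sine -/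

/-- The phase function `sinh²(πv)`, which turns Mellin transforms into Fourier transforms. -/
noncomputable def sinhSq (v : ℝ) : ℝ := Real.sinh (Real.pi * v) ^ 2

theorem sinhSq_neg (v : ℝ) : sinhSq (-v) = sinhSq v := by
  simp [sinhSq]

theorem sinhSq_nonneg (v : ℝ) : 0 ≤ sinhSq v := sq_nonneg _

theorem sinhSq_pos {v : ℝ} (hv : v ≠ 0) : 0 < sinhSq v := by
  have : Real.sinh (Real.pi * v) ≠ 0 := Real.sinh_ne_zero.2 (mul_ne_zero Real.pi_ne_zero hv)
  unfold sinhSq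
  positivity

theorem continuous_sinhSq : Continuous sinhSq := by unfold sinhSq; fun_prop

theorem ae_sinhSq_pos : ∀ᵐ v : ℝ, 0 < sinhSq v := by
  have : ∀ᵐ v : ℝ, v ≠ 0 := by simp [ae_iff, measure_singleton]
  filter_upwards [this] with v hv using sinhSq_pos hv

theorem ofReal_cpow_eq_exp {a : ℝ} (ha : 0 < a) (c : ℂ) :
    (a : ℂ) ^ c = Complex.exp (Real.log a * c) := by
  rw [Complex.cpow_def_of_ne_zero (by exact_mod_cast ha.ne'), Complex.ofReal_log ha.le]

theorem sinhSq_eq {v : ℝ} : sinhSq v =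
    (1 - Real.exp (-(2 * Real.pi * v))) ^ 2 / (4 * Real.exp (-(2 * Real.pi * v))) := by
  have h1 : Real.exp (-(2 * Real.pi * v)) = Real.exp (-(Real.pi * v)) ^ 2 := by
    rw [← Real.exp_nat_mul]; congr 1; push_cast; ring
  have h2 : Real.exp (Real.pi * v) = (Real.exp (-(Real.pi * v)))⁻¹ := by
    rw [Real.exp_neg, inv_inv]
  have h3 := Real.exp_pos (-(Real.pi * v))
  rw [sinhSq, Real.sinh_eq, h1, h2]
  field_simp
  ring

/-- The integrand of the beta integral `B(s + iτ, 1 - 2s)` under the substitution `e^{-2πv}`. -/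
theorem beta_substitution {s : ℂ} {τ v : ℝ} (hv : 0 < v) :
    |Real.exp (-(2 * Real.pi * v)) * -(2 * Real.pi)| •
      (((Real.exp (-(2 * Real.pi * v)) : ℝ) : ℂ) ^ (s + Complex.I * τ - 1) *
        (1 - ((Real.exp (-(2 * Real.pi * v)) : ℝ) : ℂ)) ^ (1 - 2 * s - 1)) =
      (2 * Real.pi * (4 : ℂ) ^ (-s)) *
        (Complex.exp ((-2 * Real.pi * v * τ : ℝ) * Complex.I) * (sinhSq v : ℂ) ^ (-s)) := by
  set E := Real.exp (-(2 * Real.pi * v)) with hE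
  have hE0 : 0 < E := Real.exp_pos _
  have hE1 : E < 1 := by
    rw [hE, Real.exp_lt_one_iff]
    have := mul_pos Real.pi_pos hv
    linarith
  have hlogE : Real.log E = -(2 * Real.pi * v) := Real.log_exp _
  have hS : sinhSq v = (1 - E) ^ 2 / (4 * E) := sinhSq_eq
  have hSp : 0 < sinhSq v := sinhSq_pos hv.ne'
  have h1E : 0 < 1 - E := by linarith
  have hlogS : Real.log (sinhSq v) = 2 * Real.log (1 - E) - Real.log 4 - Real.log E := by
    rw [hS, Real.log_div (by positivity) (by positivity), Real.log_pow,
      Real.log_mul (by norm_num) hE0.ne']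
    push_cast; ring
  have habs : |E * -(2 * Real.pi)| = E * (2 * Real.pi) := by
    rw [mul_neg, abs_neg, abs_of_pos (by positivity)]
  have h4 : (4 : ℂ) = ((4 : ℝ) : ℂ) := by norm_num
  have hEc : ((E : ℝ) : ℂ) = Complex.exp (-(2 * Real.pi * v)) := by
    rw [hE]; push_cast; rfl
  rw [habs, Complex.real_smul, h4, show (1 : ℂ) - (E : ℂ) = ((1 - E : ℝ) : ℂ) by push_cast; rfl,
    ofReal_cpow_eq_exp hE0, ofReal_cpow_eq_exp h1E, ofReal_cpow_eq_exp (by norm_num),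
    ofReal_cpow_eq_exp hSp, hlogS, hlogE, Complex.ofReal_mul E, hEc]
  have : ∀ a b c d e f p : ℂ, a + c + d = e + b + f → 
      Complex.exp a * p * (Complex.exp c * Complex.exp d) =
      p * Complex.exp e * (Complex.exp b * Complex.exp f) := by
    intro a b c d e f p h
    calc _ = p * Complex.exp (a + c + d) := by rw [Complex.exp_add, Complex.exp_add]; ring
      _ = _ := by rw [h, Complex.exp_add, Complex.exp_add]; ring
  push_cast
  apply this
  ring

theorem image_exp_Ioi :
    (fun v : ℝ => Real.exp (-(2 * Real.pi * v))) '' Ioi 0 = Ioo 0 1 := by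
  have hpi := Real.pi_pos
  ext t
  constructor
  · rintro ⟨v, hv, rfl⟩
    refine ⟨Real.exp_pos _, ?_⟩
    simp only [Real.exp_lt_one_iff]
    have : (0 : ℝ) < v := hv
    have := mul_pos hpi this
    linarith
  · rintro ⟨h0, h1⟩
    refine ⟨-Real.log t / (2 * Real.pi), ?_, ?_⟩
    · have := Real.log_neg h0 h1
      change (0 : ℝ) < -Real.log t / (2 * Real.pi)
      exact div_pos (by linarith) (by positivity)
    · have : -(2 * Real.pi * (-Real.log t / (2 * Real.pi))) = Real.log t := by field_simp
      simp only [this]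
      exact Real.exp_log h0

theorem integral_sinhSq_cpow_Ioi {s : ℂ} (hs0 : 0 < s.re) (hs : s.re < 1 / 2) (τ : ℝ) :
    IntegrableOn (fun v : ℝ => Complex.exp ((-2 * Real.pi * v * τ : ℝ) * Complex.I) *
      (sinhSq v : ℂ) ^ (-s)) (Ioi 0) ∧
    2 * Real.pi * (4 : ℂ) ^ (-s) * ∫ v in Ioi (0 : ℝ),
      Complex.exp ((-2 * Real.pi * v * τ : ℝ) * Complex.I) * (sinhSq v : ℂ) ^ (-s) =
      Complex.betaIntegral (s + Complex.I * τ) (1 - 2 * s) := by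
  have hpi := Real.pi_pos
  have hderiv : ∀ v ∈ Ioi (0 : ℝ), HasDerivWithinAt (fun v : ℝ => Real.exp (-(2 * Real.pi * v)))
      (Real.exp (-(2 * Real.pi * v)) * -(2 * Real.pi)) (Ioi 0) v := by
    intro v _
    have : HasDerivAt (fun v : ℝ => -(2 * Real.pi * v)) (-(2 * Real.pi * 1)) v :=
      ((hasDerivAt_id v).const_mul (2 * Real.pi)).neg
    rw [mul_one] at this
    exact this.exp.hasDerivWithinAt
  have hinj : InjOn (fun v : ℝ => Real.exp (-(2 * Real.pi * v))) (Ioi 0) := by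
    intro a _ b _ h
    have := Real.exp_injective h
    have h2 : 2 * Real.pi * a = 2 * Real.pi * b := by linarith
    exact mul_left_cancel₀ (by positivity) h2
  have hB := Complex.betaIntegral_convergent (u := s + Complex.I * τ) (v := 1 - 2 * s)
    (by simpa using hs0) (by simp; linarith)
  rw [intervalIntegrable_iff_integrableOn_Ioo_of_le zero_le_one, ← image_exp_Ioi,
    integrableOn_image_iff_integrableOn_abs_deriv_smul measurableSet_Ioi hderiv hinj] at hB
  have hc : (2 * Real.pi * (4 : ℂ) ^ (-s)) ≠ 0 := by
    refine mul_ne_zero (mul_ne_zero two_ne_zero (by exact_mod_cast hpi.ne')) ?_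
    rw [Ne, Complex.cpow_eq_zero_iff]
    rintro ⟨h, _⟩
    norm_num at h
  have hB' : IntegrableOn (fun v : ℝ => (2 * Real.pi * (4 : ℂ) ^ (-s)) *
      (Complex.exp ((-2 * Real.pi * v * τ : ℝ) * Complex.I) * (sinhSq v : ℂ) ^ (-s))) (Ioi 0) :=
    hB.congr_fun (fun v hv => beta_substitution hv) measurableSet_Ioi
  refine ⟨?_, ?_⟩
  · have := hB'.const_mul (2 * Real.pi * (4 : ℂ) ^ (-s))⁻¹
    refine this.congr (Eventually.of_forall fun v => ?_)
    simp only
    rw [inv_mul_cancel_left₀ hc]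
  · rw [← integral_const_mul, Complex.betaIntegral, intervalIntegral.integral_of_le zero_le_one,
      integral_Ioc_eq_integral_Ioo, ← image_exp_Ioi,
      integral_image_eq_integral_abs_deriv_smul measurableSet_Ioi hderiv hinj]
    exact setIntegral_congr_fun measurableSet_Ioi (fun v hv => (beta_substitution hv).symm)

/-- Folding an integral over the line onto the positive half-line. -/
theorem integrable_of_Ioi {F : ℝ → ℂ} (h1 : IntegrableOn F (Ioi 0))
    (h2 : IntegrableOn (fun v => F (-v)) (Ioi 0)) :
    Integrable F ∧ ∫ v, F v = (∫ v in Ioi (0 : ℝ), F v) + ∫ v in Ioi (0 : ℝ), F (-v) := by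
  have h3 : IntegrableOn F (Iic 0) := by
    rw [integrableOn_Iic_iff_integrableOn_Iio]
    refine ((Measure.measurePreserving_neg volume).integrableOn_comp_preimage
      (Homeomorph.neg ℝ).measurableEmbedding).1 ?_
    have : (Neg.neg ⁻¹' Iio (0 : ℝ)) = Ioi 0 := by ext v; simp
    rw [this]
    exact h2
  refine ⟨?_, ?_⟩
  · rw [← integrableOn_univ, ← Iic_union_Ioi (a := (0 : ℝ))]
    exact h3.union h1
  · rw [integral_comp_neg_Ioi, neg_zero, add_comm]
    exact (intervalIntegral.integral_Iic_add_Ioi h3 h1).symm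

theorem inv_Gamma_one_sub {z : ℂ} (h0 : 0 < z.re) (h1 : z.re < 1) :
    (Complex.Gamma (1 - z))⁻¹ = Complex.Gamma z * Complex.sin (Real.pi * z) / Real.pi := by
  have h := Complex.Gamma_mul_Gamma_one_sub z
  have g1 := Complex.Gamma_ne_zero_of_re_pos h0
  have g2 : Complex.Gamma (1 - z) ≠ 0 :=
    Complex.Gamma_ne_zero_of_re_pos (by simp; linarith)
  have hpi : (Real.pi : ℂ) ≠ 0 := by exact_mod_cast Real.pi_ne_zero
  have hs : Complex.sin (Real.pi * z) ≠ 0 := by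
    intro hs
    rw [hs, div_zero] at h
    exact mul_ne_zero g1 g2 h
  rw [eq_div_iff hs] at h
  apply inv_eq_of_mul_eq_one_right
  rw [mul_div_assoc', div_eq_one_iff_eq hpi]
  linear_combination h

/-- The Fourier transform of `sinh(πv)^(-2s)`: a beta integral in the variable `e^{-2πv}`. -/
theorem integral_exp_mul_sinhSq_cpow {s : ℂ} (hs0 : 0 < s.re) (hs : s.re < 1 / 2) (τ : ℝ) :
    Integrable (fun v : ℝ => Complex.exp ((-2 * Real.pi * v * τ : ℝ) * Complex.I) *
      (sinhSq v : ℂ) ^ (-s)) ∧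
    ∫ v : ℝ, Complex.exp ((-2 * Real.pi * v * τ : ℝ) * Complex.I) * (sinhSq v : ℂ) ^ (-s) =
      (4 : ℂ) ^ s * Complex.Gamma (1 - 2 * s) * Complex.Gamma (s + Complex.I * τ) *
        Complex.Gamma (s - Complex.I * τ) * Complex.sin (Real.pi * s) *
        Complex.cosh (Real.pi * τ) / Real.pi ^ 2 := by
  obtain ⟨i1, v1⟩ := integral_sinhSq_cpow_Ioi hs0 hs τ
  obtain ⟨i2, v2⟩ := integral_sinhSq_cpow_Ioi hs0 hs (-τ)
  have hneg : ∀ v : ℝ, Complex.exp ((-2 * Real.pi * v * (-τ) : ℝ) * Complex.I) *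
      (sinhSq v : ℂ) ^ (-s) = Complex.exp ((-2 * Real.pi * (-v) * τ : ℝ) * Complex.I) *
      (sinhSq (-v) : ℂ) ^ (-s) := by
    intro v
    rw [sinhSq_neg]
    congr 4
    ring
  simp only [hneg] at i2 v2
  obtain ⟨i, v⟩ := integrable_of_Ioi i1 i2
  refine ⟨i, ?_⟩
  have hpi : (Real.pi : ℂ) ≠ 0 := by exact_mod_cast Real.pi_ne_zero
  have h44 : (4 : ℂ) ^ s * (4 : ℂ) ^ (-s) = 1 := by
    rw [← Complex.cpow_add _ _ (by norm_num), add_neg_cancel, Complex.cpow_zero]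
  have hsum : 2 * Real.pi * (4 : ℂ) ^ (-s) * ∫ v : ℝ,
      Complex.exp ((-2 * Real.pi * v * τ : ℝ) * Complex.I) * (sinhSq v : ℂ) ^ (-s) =
      2 * Complex.Gamma (1 - 2 * s) * Complex.Gamma (s + Complex.I * τ) *
        Complex.Gamma (s - Complex.I * τ) * Complex.sin (Real.pi * s) *
        Complex.cosh (Real.pi * τ) / Real.pi := by
    rw [v, mul_add, v1, v2, Complex.betaIntegral_eq_Gamma_mul_div _ _ (by simpa) (by simp; linarith),
      Complex.betaIntegral_eq_Gamma_mul_div _ _ (by simpa) (by simp; linarith)]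
    have e1 : s + Complex.I * τ + (1 - 2 * s) = 1 - (s - Complex.I * τ) := by ring
    have e2 : s + Complex.I * (-τ : ℝ) + (1 - 2 * s) = 1 - (s + Complex.I * τ) := by
      push_cast; ring
    have e3 : s + Complex.I * (-τ : ℝ) = s - Complex.I * τ := by push_cast; ring
    rw [e1, e2, e3, div_eq_mul_inv, div_eq_mul_inv,
      inv_Gamma_one_sub (by simpa) (by simp; linarith),
      inv_Gamma_one_sub (by simpa) (by simp; linarith)]
    have hsin : Complex.sin (Real.pi * (s - Complex.I * τ)) +
        Complex.sin (Real.pi * (s + Complex.I * τ)) =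
        2 * (Complex.sin (Real.pi * s) * Complex.cosh (Real.pi * τ)) := by
      rw [mul_sub, mul_add, Complex.sin_sub, Complex.sin_add, ← Complex.cos_mul_I,
        show (Real.pi : ℂ) * (Complex.I * τ) = Real.pi * τ * Complex.I by ring]
      ring
    linear_combination (Complex.Gamma (s + Complex.I * τ) * Complex.Gamma (1 - 2 * s) *
      Complex.Gamma (s - Complex.I * τ) / Real.pi) * hsin
  set J := ∫ v : ℝ, Complex.exp ((-2 * Real.pi * v * τ : ℝ) * Complex.I) * (sinhSq v : ℂ) ^ (-s)
  have h2 : J = (4 : ℂ) ^ s * (2 * Real.pi * (4 : ℂ) ^ (-s) * J) / (2 * Real.pi) := by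
    rw [eq_div_iff (mul_ne_zero two_ne_zero hpi)]
    linear_combination (-(2 * Real.pi * J)) * h44
  rw [h2, hsum]
  field_simp

theorem norm_sinhSq_cpow {v : ℝ} (hv : 0 < sinhSq v) (s : ℂ) :
    ‖(sinhSq v : ℂ) ^ (-s)‖ = sinhSq v ^ (-s.re) := by
  rw [Complex.norm_cpow_eq_rpow_re_of_pos hv, Complex.neg_re]

theorem integrable_sinhSq_rpow {σ : ℝ} (h0 : 0 < σ) (h1 : σ < 1 / 2) :
    Integrable (fun v : ℝ => sinhSq v ^ (-σ)) := by
  have h := (integral_exp_mul_sinhSq_cpow (s := σ) (by simpa) (by simp; linarith) 0).1.norm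
  refine h.congr ?_
  filter_upwards [ae_sinhSq_pos] with v hv
  rw [norm_mul, norm_sinhSq_cpow hv]
  simp

/-- The case `τ = 0`, `s = 2γ` of the beta integral, simplified by the duplication and reflection
formulas. It supplies the Gamma factors of the bounding constant. -/
theorem integral_sinhSq_rpow {γ : ℝ} (h0 : 0 < γ) (h1 : γ < 1 / 4) :
    ∫ v : ℝ, sinhSq v ^ (-(2 * γ)) =
      Real.Gamma (1 / 2 - 2 * γ) * Real.Gamma (2 * γ) / (Real.pi * Real.sqrt Real.pi) := by
  have hpi := Real.pi_pos
  have h := (integral_exp_mul_sinhSq_cpow (s := (2 * γ : ℝ)) (by simpa)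
    (by simp; linarith) 0).2
  have e : ∀ v : ℝ, Complex.exp ((-2 * Real.pi * v * (0 : ℝ) : ℝ) * Complex.I) *
      (sinhSq v : ℂ) ^ (-((2 * γ : ℝ) : ℂ)) = ((sinhSq v ^ (-(2 * γ)) : ℝ) : ℂ) := by
    intro v
    rw [mul_zero, Complex.ofReal_zero, zero_mul, Complex.exp_zero, one_mul,
      Complex.ofReal_cpow (sinhSq_nonneg v), Complex.ofReal_neg]
  simp only [e] at h
  rw [integral_complex_ofReal] at h
  simp only [Complex.ofReal_zero, mul_zero, add_zero, sub_zero, Complex.cosh_zero, mul_one] at h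
  have e2 : (4 : ℂ) ^ ((2 * γ : ℝ) : ℂ) = (((4 : ℝ) ^ (2 * γ) : ℝ) : ℂ) := by
    rw [Complex.ofReal_cpow (by norm_num)]; norm_num
  have e3 : (1 : ℂ) - 2 * ((2 * γ : ℝ) : ℂ) = ((1 - 4 * γ : ℝ) : ℂ) := by push_cast; ring
  rw [e2, e3, Complex.Gamma_ofReal, Complex.Gamma_ofReal, ← Complex.ofReal_mul Real.pi,
    ← Complex.ofReal_sin] at h
  have h' : ∫ v : ℝ, sinhSq v ^ (-(2 * γ)) = (4 : ℝ) ^ (2 * γ) * Real.Gamma (1 - 4 * γ) *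
      Real.Gamma (2 * γ) * Real.Gamma (2 * γ) * Real.sin (Real.pi * (2 * γ)) / Real.pi ^ 2 := by
    exact_mod_cast h
  have hdup := Real.Gamma_mul_Gamma_add_half (1 / 2 - 2 * γ)
  rw [show (1 / 2 - 2 * γ + 1 / 2 : ℝ) = 1 - 2 * γ by ring,
    show (2 * (1 / 2 - 2 * γ) : ℝ) = 1 - 4 * γ by ring,
    show (1 - (1 - 4 * γ) : ℝ) = 2 * (2 * γ) by ring,
    Real.rpow_mul (by norm_num), show ((2 : ℝ) ^ (2 : ℝ)) = 4 by norm_num] at hdup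
  have hrefl := Real.Gamma_mul_Gamma_one_sub (2 * γ)
  have hsin : 0 < Real.sin (Real.pi * (2 * γ)) := by
    apply Real.sin_pos_of_pos_of_lt_pi
    · positivity
    · nlinarith
  rw [eq_div_iff hsin.ne'] at hrefl
  have hsq : Real.sqrt Real.pi ≠ 0 := (Real.sqrt_pos.2 hpi).ne'
  have hG : Real.Gamma (1 - 2 * γ) ≠ 0 := (Real.Gamma_pos_of_pos (by linarith)).ne'
  rw [h', div_eq_div_iff (by positivity) (by positivity)]
  apply mul_left_cancel₀ hG
  generalize Real.Gamma (1 - 2 * γ) = A at *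
  generalize Real.Gamma (1 - 4 * γ) = B at *
  generalize Real.Gamma (2 * γ) = C at *
  generalize Real.Gamma (1 / 2 - 2 * γ) = D at *
  generalize Real.sin (Real.pi * (2 * γ)) = S at *
  generalize (4 : ℝ) ^ (2 * γ) = F at *
  linear_combination (F * B * C * Real.pi * Real.sqrt Real.pi) * hrefl - C * Real.pi ^ 2 * hdup

/-! ### The Weber kernel as a Fourier transform -/

theorem vline_re (γ t : ℝ) : (vline γ t).re = γ := by simp [vline]

theorem vline_im (γ t : ℝ) : (vline γ t).im = t := by simp [vline]

theorem continuous_vline (γ : ℝ) : Continuous (vline γ) := by unfold vline; fun_prop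

theorem norm_cpow_neg_vline {z : ℝ} (hz : 0 < z) (γ t : ℝ) :
    ‖(z : ℂ) ^ (-vline γ t)‖ = z ^ (-γ) := by
  rw [Complex.norm_cpow_eq_rpow_re_of_pos hz, Complex.neg_re, vline_re]

theorem continuous_cpow_neg_vline {z : ℝ} (hz : 0 < z) (γ : ℝ) :
    Continuous fun t : ℝ => (z : ℂ) ^ (-vline γ t) :=
  (continuous_vline γ).neg.const_cpow (Or.inl (by exact_mod_cast hz.ne'))

/-- `∫ q(t) z^(-γ-it) dt`: the inverse Mellin transform, up to the factor `1/(2π)`, of a function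
given by its values `q` on the line `Re s = γ`. -/
noncomputable def lineMellin (γ : ℝ) (q : ℝ → ℂ) (z : ℝ) : ℂ :=
  ∫ t : ℝ, q t * (z : ℂ) ^ (-vline γ t)

theorem norm_lineMellin_le (γ : ℝ) (q : ℝ → ℂ) {z : ℝ} (hz : 0 < z) :
    ‖lineMellin γ q z‖ ≤ z ^ (-γ) * ∫ t, ‖q t‖ := by
  refine (norm_integral_le_integral_norm _).trans ?_
  rw [← integral_const_mul]
  apply le_of_eq
  congr 1
  ext t
  rw [norm_mul, norm_cpow_neg_vline hz, mul_comm]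

theorem integrable_mul_cpow_neg_vline {γ : ℝ} {q : ℝ → ℂ} (hq : Integrable q) {z : ℝ}
    (hz : 0 < z) : Integrable fun t : ℝ => q t * (z : ℂ) ^ (-vline γ t) := by
  refine hq.mul_bdd (c := z ^ (-γ)) (continuous_cpow_neg_vline hz γ).aestronglyMeasurable ?_
  exact Eventually.of_forall fun t => (norm_cpow_neg_vline hz γ t).le

theorem continuousOn_lineMellin {γ : ℝ} (hγ : 0 ≤ γ) {q : ℝ → ℂ} (hq : Integrable q) :
    ContinuousOn (lineMellin γ q) (Ioi 0) := by
  intro z₀ hz₀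
  have hz₀' : (0 : ℝ) < z₀ := hz₀
  apply ContinuousAt.continuousWithinAt
  have hnear : ∀ᶠ z in 𝓝 z₀, z₀ / 2 < z := eventually_gt_nhds (by linarith)
  apply continuousAt_of_dominated (bound := fun t => ‖q t‖ * (z₀ / 2) ^ (-γ))
  · filter_upwards [hnear] with z hz
    exact (integrable_mul_cpow_neg_vline hq (by linarith)).aestronglyMeasurable
  · filter_upwards [hnear] with z hz
    refine Eventually.of_forall fun t => ?_
    have hz' : 0 < z := by linarith
    rw [norm_mul, norm_cpow_neg_vline hz']
    gcongr ?_ * ?_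
    exact Real.rpow_le_rpow_of_nonpos (by linarith) hz.le (by linarith)
  · exact hq.norm.mul_const _
  · refine Eventually.of_forall fun t => ?_
    apply ContinuousAt.mul continuousAt_const
    exact Complex.continuousAt_ofReal_cpow_const z₀ _ (Or.inr hz₀'.ne')

theorem aestronglyMeasurable_comp_sinhSq {f : ℝ → ℂ} (hf : ContinuousOn f (Ioi 0)) {x : ℝ}
    (hx : 0 < x) : AEStronglyMeasurable (fun v => f (x * sinhSq v)) volume := by
  have hc : ContinuousOn (fun v => f (x * sinhSq v)) ({0}ᶜ : Set ℝ) := by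
    refine hf.comp (by have := continuous_sinhSq; fun_prop) ?_
    intro v hv
    exact mul_pos hx (sinhSq_pos hv)
  have := hc.aestronglyMeasurable (μ := volume) (measurableSet_singleton 0).compl
  rwa [restrict_compl_singleton] at this

theorem mul_sinhSq_cpow {z v : ℝ} (hz : 0 < z) (s : ℂ) :
    (((z * sinhSq v : ℝ)) : ℂ) ^ s = (z : ℂ) ^ s * (sinhSq v : ℂ) ^ s := by
  rw [Complex.ofReal_mul, Complex.mul_cpow_ofReal_nonneg hz.le (sinhSq_nonneg v)]

/-- Exchanging the vertical integral with an integral against a weight `w` in the variable `v` of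
the phase function. -/
theorem integral_lineMellin_comp_sinhSq {γ z : ℝ} {q w : ℝ → ℂ} (hq : Integrable q) (hz : 0 < z)
    (hw : AEStronglyMeasurable w volume) (hwi : Integrable fun v => sinhSq v ^ (-γ) * ‖w v‖) :
    ∫ v, lineMellin γ q (z * sinhSq v) * w v =
      ∫ t, q t * (z : ℂ) ^ (-vline γ t) * ∫ v, (sinhSq v : ℂ) ^ (-vline γ t) * w v := by
  have hmeas : AEStronglyMeasurable (fun p : ℝ × ℝ =>
      q p.2 * ((z * sinhSq p.1 : ℝ) : ℂ) ^ (-vline γ p.2) * w p.1) (volume.prod volume) := by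
    refine (hq.1.comp_snd.mul ?_).mul hw.comp_fst
    apply Measurable.aestronglyMeasurable
    apply Measurable.pow
    · have := continuous_sinhSq
      apply Continuous.measurable
      fun_prop
    · exact ((continuous_vline γ).measurable.comp measurable_snd).neg
  have hint : Integrable (fun p : ℝ × ℝ =>
      q p.2 * ((z * sinhSq p.1 : ℝ) : ℂ) ^ (-vline γ p.2) * w p.1) (volume.prod volume) := by
    have hb := (hwi.mul_prod hq.norm).const_mul (z ^ (-γ))
    refine hb.mono' hmeas ?_
    have hae : ∀ᵐ p : ℝ × ℝ ∂(volume.prod volume), 0 < sinhSq p.1 :=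
      Measure.quasiMeasurePreserving_fst.ae ae_sinhSq_pos
    filter_upwards [hae] with p hp
    rw [norm_mul, norm_mul, norm_cpow_neg_vline (mul_pos hz hp), Real.mul_rpow hz.le hp.le]
    apply le_of_eq
    ring
  have hswap := integral_integral_swap (f := fun v t =>
    q t * ((z * sinhSq v : ℝ) : ℂ) ^ (-vline γ t) * w v) hint
  calc ∫ v, lineMellin γ q (z * sinhSq v) * w v
      = ∫ v, ∫ t, q t * ((z * sinhSq v : ℝ) : ℂ) ^ (-vline γ t) * w v := by
        congr 1; ext v; rw [lineMellin, integral_mul_const]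
    _ = _ := hswap
    _ = _ := by
        congr 1; ext t
        rw [← integral_const_mul]
        congr 1; ext v
        rw [mul_sinhSq_cpow hz]; ring

/-- The function `Γ(s+α) / (sin(πs) Γ(1+α-s))`, whose modulus on the line `Re s = γ` is
`constIntegrand α γ`. -/
noncomputable def gammaQuot (α : ℝ) (s : ℂ) : ℂ :=
  Complex.Gamma (s + α) / (Complex.sin (Real.pi * s) * Complex.Gamma (1 + α - s))

theorem sin_pi_mul_eq {s : ℂ} (h0 : 0 < s.re) (h1 : s.re < 1) :
    Complex.sin (Real.pi * s) ≠ 0 ∧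
      (Complex.sin (Real.pi * s))⁻¹ = Complex.Gamma s * Complex.Gamma (1 - s) / Real.pi := by
  have h := Complex.Gamma_mul_Gamma_one_sub s
  have g1 := Complex.Gamma_ne_zero_of_re_pos h0
  have g2 : Complex.Gamma (1 - s) ≠ 0 :=
    Complex.Gamma_ne_zero_of_re_pos (by simp; linarith)
  have hpi : (Real.pi : ℂ) ≠ 0 := by exact_mod_cast Real.pi_ne_zero
  refine ⟨?_, ?_⟩
  · intro hs
    rw [hs, div_zero] at h
    exact mul_ne_zero g1 g2 h
  · rw [h]; field_simp

theorem continuous_Gamma_vline {γ : ℝ} (hγ : 0 < γ) :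
    Continuous fun t : ℝ => Complex.Gamma (vline γ t) := by
  rw [continuous_iff_continuousAt]
  intro t
  exact (Complex.continuousAt_Gamma _ (ne_neg_nat_of_re_pos (by rwa [vline_re]))).comp
    (continuous_vline γ).continuousAt

theorem exp_neg_mul_le_div_sq {c t : ℝ} (hc : 1 ≤ c) (ht : t ≠ 0) :
    Real.exp (-(c * |t|)) ≤ 2 / t ^ 2 := by
  have h0 : 0 < |t| := abs_pos.2 ht
  have h1 : (c * |t|) ^ 2 / 2 ≤ Real.exp (c * |t|) := by
    have := Real.quadratic_le_exp_of_nonneg (x := c * |t|) (by positivity)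
    have : 0 ≤ c * |t| := by positivity
    linarith
  have h2 : t ^ 2 ≤ (c * |t|) ^ 2 := by
    rw [mul_pow, sq_abs]
    exact le_mul_of_one_le_left (sq_nonneg t) (one_le_pow₀ hc)
  rw [Real.exp_neg, ← inv_div]
  apply inv_anti₀
  · positivity
  · linarith

theorem integrable_Gamma_vline {γ : ℝ} (hγ : 0 < γ) :
    Integrable fun t : ℝ => Complex.Gamma (vline γ t) := by
  have hpi := Real.pi_gt_three
  obtain ⟨C, hC0, hC⟩ := exists_norm_Gamma_le γ γ (θ := Real.pi / 3) (by linarith) (by linarith)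
  apply integrable_of_continuous_of_norm_le_div_sq (C := C * 2) (T := 1) (continuous_Gamma_vline hγ)
  intro t ht
  have h := hC (vline γ t) (by rw [vline_re]) (by rw [vline_re]) (by rwa [vline_im])
  rw [vline_im] at h
  refine h.trans ?_
  rw [mul_div_assoc]
  gcongr
  exact exp_neg_mul_le_div_sq (by linarith) (by
    rintro rfl
    rw [abs_zero] at ht; linarith)

section Parameters

variable {α γ : ℝ}

/-- The factor `1 / sin(πs)` is written as `Γ(s) Γ(1-s) / π`, so that the bounds for `Γ` in strips
suffice. -/
theorem integrable_gammaQuot_vline (hγ₁ : max (-α) 0 < γ) (hγ₂ : γ < 1 / 4) :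
    Continuous (fun t : ℝ => gammaQuot α (vline γ t)) ∧
      Integrable fun t : ℝ => gammaQuot α (vline γ t) := by
  obtain ⟨hα, hγ⟩ := max_lt_iff.1 hγ₁
  have hpi := Real.pi_gt_three
  have hcont : Continuous fun t : ℝ => gammaQuot α (vline γ t) := by
    have e : (fun t : ℝ => gammaQuot α (vline γ t)) = fun t =>
        Complex.Gamma (vline γ t + α) * ((Complex.sin (Real.pi * vline γ t))⁻¹ *
          (Complex.Gamma (1 + α - vline γ t))⁻¹) := by
      ext t; rw [gammaQuot, div_eq_mul_inv, mul_inv]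
    rw [e]
    have hv := continuous_vline γ
    refine Continuous.mul ?_ (Continuous.mul ?_ ?_)
    · rw [continuous_iff_continuousAt]
      intro t
      refine ContinuousAt.comp (g := Complex.Gamma) (f := fun t : ℝ => vline γ t + α)
        (Complex.continuousAt_Gamma _ (ne_neg_nat_of_re_pos ?_)) (by fun_prop)
      rw [Complex.add_re, vline_re, Complex.ofReal_re]; linarith
    · refine Continuous.inv₀ (by fun_prop) fun t => ?_
      exact (sin_pi_mul_eq (by rwa [vline_re]) (by rw [vline_re]; linarith)).1
    · exact Complex.differentiable_one_div_Gamma.continuous.comp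
        (f := fun t : ℝ => 1 + α - vline γ t) (by fun_prop)
  refine ⟨hcont, ?_⟩
  have hθ0 : 0 ≤ Real.pi / 3 := by positivity
  have hθ : Real.pi / 3 < Real.pi / 2 := by linarith
  obtain ⟨C₁, p₁, h₁⟩ := exists_norm_Gamma_le (γ + α) (γ + α) hθ0 hθ
  obtain ⟨C₂, p₂, h₂⟩ := exists_norm_Gamma_le γ γ hθ0 hθ
  obtain ⟨C₃, p₃, h₃⟩ := exists_norm_Gamma_le (1 - γ) (1 - γ) hθ0 hθ
  obtain ⟨C₄, p₄, h₄⟩ := exists_norm_Gamma_inv_le (1 + α - γ) (1 + α - γ) hθ0 hθ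
  apply integrable_of_continuous_of_norm_le_div_sq (C := C₁ * C₂ * C₃ * C₄ * 2) (T := 1) hcont
  intro t ht
  set s := vline γ t with hs
  have hre : s.re = γ := vline_re γ t
  have him : s.im = t := vline_im γ t
  have b₁ := h₁ (s + α) (by simp [hre]) (by simp [hre]) (by simpa [him] using ht)
  have b₂ := h₂ s (by simp [hre]) (by simp [hre]) (by simpa [him] using ht)
  have b₃ := h₃ (1 - s) (by simp [hre]) (by simp [hre]) (by simpa [him] using ht)
  have b₄ := h₄ (1 + α - s) (by simp [hre]) (by simp [hre]) (by simpa [him] using ht)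
  have e₁ : |(s + α).im| = |t| := by simp [him]
  have e₃ : |(1 - s).im| = |t| := by simp [him]
  have e₄ : |(1 + α - s).im| = |t| := by simp [him]
  rw [e₁] at b₁
  rw [him] at b₂
  rw [e₃] at b₃
  rw [e₄] at b₄
  have hsin := (sin_pi_mul_eq (s := s) (by rwa [hre]) (by rw [hre]; linarith)).2
  have hnpi : ‖(Real.pi : ℂ)‖ = Real.pi := by simp [Real.pi_pos.le]
  rw [gammaQuot, div_eq_mul_inv, mul_inv, hsin, norm_mul, norm_mul, norm_div, norm_mul, hnpi]
  set E := Real.exp (-(Real.pi / 3 * |t|)) with hE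
  calc _ ≤ ‖Complex.Gamma (s + α)‖ * ((‖Complex.Gamma s‖ * ‖Complex.Gamma (1 - s)‖) *
        ‖(Complex.Gamma (1 + α - s))⁻¹‖) := by
        gcongr
        exact div_le_self (by positivity) (by linarith)
    _ ≤ (C₁ * E) * ((C₂ * E * (C₃ * E)) * (C₄ * Real.exp ((Real.pi - Real.pi / 3) * |t|))) := by
        gcongr
    _ = C₁ * C₂ * C₃ * C₄ * Real.exp (-(Real.pi / 3 * |t|)) := by
        have : E * E * E * Real.exp ((Real.pi - Real.pi / 3) * |t|) =
            Real.exp (-(Real.pi / 3 * |t|)) := by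
          rw [hE, ← Real.exp_add, ← Real.exp_add, ← Real.exp_add]
          congr 1; ring
        rw [← this]; ring
    _ ≤ _ := by
        rw [mul_div_assoc]
        gcongr
        exact exp_neg_mul_le_div_sq (by linarith) (by
          rintro rfl
          rw [abs_zero] at ht; linarith)

/-- A singularity `sinh(πv)^(-2γ)` with `γ < 1/4` is square integrable. -/
theorem integrable_and_memLp_comp_sinhSq (hγ : 0 < γ) (hγ₂ : γ < 1 / 4) {f : ℝ → ℂ} {C : ℝ}
    (hf : AEStronglyMeasurable f volume)
    (hb : ∀ᵐ v, ‖f v‖ ≤ C * sinhSq v ^ (-γ)) : Integrable f ∧ MemLp f 2 volume := by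
  refine ⟨((integrable_sinhSq_rpow hγ (by linarith)).const_mul C).mono' hf hb, ?_⟩
  rw [memLp_two_iff_integrable_sq_norm hf]
  refine ((integrable_sinhSq_rpow (σ := 2 * γ) (by linarith) (by linarith)).const_mul
    (C ^ 2)).mono' (hf.norm.pow 2) ?_
  filter_upwards [hb, ae_sinhSq_pos] with v h1 h2
  have h3 : sinhSq v ^ (-(2 * γ)) = (sinhSq v ^ (-γ)) ^ 2 := by
    rw [← Real.rpow_natCast, ← Real.rpow_mul h2.le]; congr 1; push_cast; ring
  rw [Real.norm_of_nonneg (by positivity), h3, ← mul_pow]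
  gcongr

theorem memLp_sinhSq_rpow (hγ : 0 < γ) (hγ₂ : γ < 1 / 4) :
    MemLp (fun v => sinhSq v ^ (-γ)) 2 volume := by
  have hi := integrable_sinhSq_rpow hγ (show γ < 1 / 2 by linarith)
  rw [memLp_two_iff_integrable_sq hi.1]
  refine (integrable_sinhSq_rpow (σ := 2 * γ) (by linarith) (by linarith)).congr ?_
  filter_upwards [ae_sinhSq_pos] with v h2
  rw [← Real.rpow_natCast, ← Real.rpow_mul h2.le]; congr 1; push_cast; ring

theorem integrable_and_memLp_lineMellin (hγ : 0 < γ) (hγ₂ : γ < 1 / 4) {q : ℝ → ℂ}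
    (hq : Integrable q) {x : ℝ} (hx : 0 < x) :
    Integrable (fun v => lineMellin γ q (x * sinhSq v)) ∧
      MemLp (fun v => lineMellin γ q (x * sinhSq v)) 2 volume := by
  apply integrable_and_memLp_comp_sinhSq (C := x ^ (-γ) * ∫ t, ‖q t‖) hγ hγ₂
  · exact aestronglyMeasurable_comp_sinhSq (continuousOn_lineMellin hγ.le hq) hx
  · filter_upwards [ae_sinhSq_pos] with v hv
    refine (norm_lineMellin_le γ q (mul_pos hx hv)).trans ?_
    rw [Real.mul_rpow hx.le hv.le]
    apply le_of_eq; ring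

/-- As a function of `τ`, the Weber kernel is the Fourier transform of a function of
`x sinh²(πv)`. At `τ = 0` the quotient defining the kernel has the junk value `0`, which is
excluded by the hypothesis on `τ`. -/
theorem fourier_lineMellin_gammaQuot (hγ₁ : max (-α) 0 < γ) (hγ₂ : γ < 1 / 4) {x τ : ℝ}
    (hx : 0 < x) (hτ : τ ≠ 0) :
    𝓕 (fun v => lineMellin γ (fun t => gammaQuot α (vline γ t)) (x * sinhSq v)) τ =
      2 * Real.pi * weberKernel α x τ := by
  have hγ : 0 < γ := (max_lt_iff.1 hγ₁).2
  have hpi : (Real.pi : ℂ) ≠ 0 := by exact_mod_cast Real.pi_ne_zero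
  obtain ⟨_, hq⟩ := integrable_gammaQuot_vline hγ₁ hγ₂
  set w : ℝ → ℂ := fun v => Complex.exp ((-2 * Real.pi * v * τ : ℝ) * Complex.I) with hw
  have hwc : Continuous w := by rw [hw]; fun_prop
  have hwn : ∀ v, ‖w v‖ = 1 := fun v => Complex.norm_exp_ofReal_mul_I _
  have h := integral_lineMellin_comp_sinhSq (γ := γ) (w := w) hq hx hwc.aestronglyMeasurable (by
    simp only [hwn, mul_one]
    exact integrable_sinhSq_rpow hγ (by linarith))
  have hF : 𝓕 (fun v => lineMellin γ (fun t => gammaQuot α (vline γ t)) (x * sinhSq v)) τ =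
      ∫ v, lineMellin γ (fun t => gammaQuot α (vline γ t)) (x * sinhSq v) * w v := by
    rw [Real.fourier_real_eq_integral_exp_smul]
    congr 1; ext v
    rw [smul_eq_mul, mul_comm]
  have hpt : ∀ t : ℝ, gammaQuot α (vline γ t) * (x : ℂ) ^ (-vline γ t) *
      ∫ v, (sinhSq v : ℂ) ^ (-vline γ t) * w v =
      Complex.cosh (Real.pi * τ) / Real.pi ^ 2 * barnes α τ (x / 4) (γ + t * Complex.I) := by
    intro t
    have hb := (integral_exp_mul_sinhSq_cpow (s := vline γ t) (by rwa [vline_re])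
      (by rw [vline_re]; linarith) τ).2
    have hsin := (sin_pi_mul_eq (s := vline γ t) (by rwa [vline_re])
      (by rw [vline_re]; linarith)).1
    simp only [hw]
    simp only [mul_comm ((sinhSq _ : ℂ) ^ (-vline γ t))]
    rw [hb, ← vline, gammaQuot, barnes]
    have hx4 : ((x / 4 : ℝ) : ℂ) ^ (-vline γ t) =
        (x : ℂ) ^ (-vline γ t) * (4 : ℂ) ^ (vline γ t) := by
      have h4 : ((x / 4 : ℝ) : ℂ) = (x : ℂ) * (((4 : ℝ)⁻¹ : ℝ) : ℂ) := by push_cast; ring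
      rw [h4, Complex.mul_cpow_ofReal_nonneg hx.le (by norm_num), Complex.ofReal_inv,
        Complex.inv_cpow _ _ (by
          rw [Complex.arg_ofReal_of_nonneg (by norm_num)]; exact Real.pi_pos.ne),
        Complex.cpow_neg, Complex.cpow_neg, inv_inv]
      norm_num
    rw [hx4]
    generalize Complex.sin (Real.pi * vline γ t) = S at *
    rw [div_mul_eq_div_div, div_eq_mul_inv _ (Complex.Gamma _)]
    field_simp
  rw [hF, h]
  simp only [hpt]
  rw [integral_const_mul, weberKernel_eq_integral_barnes hγ₁ hγ₂ hx hτ]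
  generalize (∫ t : ℝ, barnes α τ (x / 4) (γ + t * Complex.I)) = B
  field_simp

end Parameters

/-! ### Mellin inversion and the Macdonald function -/

/-- In the logarithmic coordinate `x = e^{-u}` the integral `lineMellin` is an inverse Fourier
transform. -/
theorem lineMellin_exp_neg (γ : ℝ) (q : ℝ → ℂ) (u : ℝ) :
    Real.exp (-γ * u) • (1 / (2 * Real.pi) * lineMellin γ q (Real.exp (-u))) =
      𝓕⁻ (fun y : ℝ => q (2 * Real.pi * y)) u := by
  have hpi := Real.pi_pos
  rw [Real.fourierInv_eq_fourier_neg, Real.fourier_real_eq_integral_exp_smul]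
  have e : ∀ y : ℝ, Complex.exp ((-2 * Real.pi * y * (-u) : ℝ) * Complex.I) •
      q (2 * Real.pi * y) =
      (fun t : ℝ => Complex.exp ((t * u : ℝ) * Complex.I) * q t) (2 * Real.pi * y) := by
    intro y
    simp only [smul_eq_mul]
    congr 4
    ring
  simp only [e]
  rw [Measure.integral_comp_mul_left (fun t : ℝ => Complex.exp ((t * u : ℝ) * Complex.I) * q t),
    lineMellin, abs_of_pos (by positivity), Complex.real_smul, Complex.real_smul]
  rw [mul_left_comm, ← integral_const_mul]
  push_cast
  rw [one_div]
  congr 2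
  ext t
  have h : (Complex.exp (-(u : ℂ))) ^ (-vline γ t) =
      Complex.exp (γ * u) * Complex.exp (t * u * Complex.I) := by
    have := ofReal_cpow_eq_exp (Real.exp_pos (-u)) (-vline γ t)
    rw [Real.log_exp] at this
    push_cast at this
    rw [this, ← Complex.exp_add, vline]
    congr 1; ring
  rw [h, mul_left_comm (q t), ← mul_assoc, ← Complex.exp_add, mul_comm (q t)]
  rw [show -(γ : ℂ) * u + γ * u = 0 by ring, Complex.exp_zero, one_mul]

theorem image_exp_neg_univ : (fun u : ℝ => Real.exp (-u)) '' univ = Ioi 0 := by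
  ext x
  constructor
  · rintro ⟨u, _, rfl⟩; exact Real.exp_pos _
  · intro hx
    exact ⟨-Real.log x, mem_univ _, by simp only [neg_neg]; exact Real.exp_log hx⟩

/-- Integrability with weight `x^(γ-1)`, in the logarithmic coordinate `x = e^{-u}`. -/
theorem integrable_exp_neg_smul {γ : ℝ} {f : ℝ → ℂ}
    (hf : IntegrableOn (fun x : ℝ => ((x ^ (γ - 1) : ℝ) : ℂ) * f x) (Ioi 0)) :
    Integrable fun u : ℝ => Real.exp (-γ * u) • f (Real.exp (-u)) := by
  have hderiv : ∀ u ∈ (univ : Set ℝ), HasDerivWithinAt (fun u : ℝ => Real.exp (-u))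
      (Real.exp (-u) * -1) univ u := fun u _ => (hasDerivAt_neg u).exp.hasDerivWithinAt
  have hinj : InjOn (fun u : ℝ => Real.exp (-u)) univ := by
    intro a _ b _ h
    exact neg_injective (Real.exp_injective h)
  rw [← image_exp_neg_univ,
    integrableOn_image_iff_integrableOn_abs_deriv_smul MeasurableSet.univ hderiv hinj,
    integrableOn_univ] at hf
  refine hf.congr (Eventually.of_forall fun u => ?_)
  simp only [Complex.real_smul]
  rw [mul_neg, mul_one, abs_neg, abs_of_pos (Real.exp_pos _), ← mul_assoc, ← Complex.ofReal_mul,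
    ← Real.exp_mul, ← Real.exp_add]
  congr 3
  ring

/-- Mellin inversion, starting from the inverse transform: in logarithmic coordinates `f` becomes
the inverse Fourier transform of a continuous integrable function, and is itself integrable. -/
theorem mellin_eq_of_eq_lineMellin {γ : ℝ} {q f : ℝ → ℂ} (hqc : Continuous q) (hq : Integrable q)
    (hf : ∀ x, 0 < x → f x = 1 / (2 * Real.pi) * lineMellin γ q x)
    (hfi : IntegrableOn (fun x : ℝ => ((x ^ (γ - 1) : ℝ) : ℂ) * f x) (Ioi 0)) (t : ℝ) :
    mellin f (vline γ t) = q t := by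
  have hpi := Real.pi_pos
  set P : ℝ → ℂ := fun y => q (2 * Real.pi * y) with hP
  have hfun : (fun u : ℝ => Real.exp (-γ * u) • f (Real.exp (-u))) = 𝓕⁻ P := by
    ext u
    rw [hf _ (Real.exp_pos _)]
    exact lineMellin_exp_neg γ q u
  have hPi : Integrable P := hq.comp_mul_left' (by positivity)
  have hPc : Continuous P := by rw [hP]; fun_prop
  have hinv : Integrable (𝓕⁻ P) := hfun ▸ integrable_exp_neg_smul hfi
  have hFP : Integrable (𝓕 P) := by
    refine hinv.comp_neg.congr (Eventually.of_forall fun u => ?_)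
    simp only [Real.fourierInv_eq_fourier_neg, neg_neg]
  rw [mellin_eq_fourier, vline_re, vline_im, hfun, hPc.fourier_fourierInv_eq hPi hFP, hP]
  simp only
  congr 1
  field_simp

/-- The Cahen–Mellin integral. -/
theorem lineMellin_Gamma {γ z : ℝ} (hγ : 0 < γ) (hz : 0 < z) :
    lineMellin γ (fun t => Complex.Gamma (vline γ t)) z = 2 * Real.pi * Complex.exp (-z) := by
  have hpi : (Real.pi : ℂ) ≠ 0 := by exact_mod_cast Real.pi_ne_zero
  set f : ℝ → ℂ := fun x => (Real.exp (-x) : ℂ) with hf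
  have hm : ∀ s : ℂ, 0 < s.re → mellin f s = Complex.Gamma s := fun s hs => by
    rw [Complex.Gamma_eq_integral hs, Complex.GammaIntegral_eq_mellin]
  have hconv : MellinConvergent f γ := by
    have := Complex.GammaIntegral_convergent (s := γ) (by simpa)
    refine this.congr_fun (fun x _ => ?_) measurableSet_Ioi
    simp [hf, mul_comm]
  have hvert : Complex.VerticalIntegrable (mellin f) γ volume := by
    refine (integrable_Gamma_vline hγ).congr (Eventually.of_forall fun t => ?_)
    exact (hm _ (by rwa [vline_re])).symm
  have h := mellinInv_mellin_eq γ f hz hconv hvert (by rw [hf]; fun_prop)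
  have e : mellinInv γ (mellin f) z =
      1 / (2 * Real.pi) * lineMellin γ (fun t => Complex.Gamma (vline γ t)) z := by
    rw [mellinInv, lineMellin, Complex.real_smul]
    push_cast
    congr 2
    ext t
    rw [← hm _ (by rwa [vline_re]), smul_eq_mul, mul_comm]
    rfl
  rw [e] at h
  simp only [hf] at h
  push_cast at h
  rw [← h]
  field_simp

theorem sq_le_sinhSq (v : ℝ) : v ^ 2 ≤ sinhSq v := by
  have h1 : |Real.pi * v| ≤ |Real.sinh (Real.pi * v)| := by
    rw [Real.abs_sinh]
    exact Real.self_le_sinh_iff.2 (abs_nonneg _)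
  have h2 : |v| ≤ |Real.pi * v| := by
    rw [abs_mul, abs_of_pos Real.pi_pos]
    exact le_mul_of_one_le_left (abs_nonneg _) (by linarith [Real.pi_gt_three])
  exact sq_le_sq.2 (h2.trans h1)

theorem integrable_and_memLp_exp_neg_sinhSq {y : ℝ} (hy : 0 < y) :
    Integrable (fun v => Complex.exp (-(y * sinhSq v : ℝ))) ∧
      MemLp (fun v => Complex.exp (-(y * sinhSq v : ℝ))) 2 volume := by
  have hcont : Continuous fun v => Complex.exp (-(y * sinhSq v : ℝ)) := by
    have := continuous_sinhSq
    fun_prop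
  have hn : ∀ v, ‖Complex.exp (-(y * sinhSq v : ℝ))‖ ≤ Real.exp (-y * v ^ 2) := by
    intro v
    rw [← Complex.ofReal_neg, ← Complex.ofReal_exp, Complex.norm_real, Real.norm_eq_abs,
      Real.abs_exp, Real.exp_le_exp, neg_mul, neg_le_neg_iff]
    exact mul_le_mul_of_nonneg_left (sq_le_sinhSq v) hy.le
  have hi := integrable_exp_neg_mul_sq hy
  refine ⟨hi.mono' hcont.aestronglyMeasurable (Eventually.of_forall hn), ?_⟩
  rw [memLp_two_iff_integrable_sq_norm hcont.aestronglyMeasurable]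
  refine hi.mono' (hcont.norm.pow 2).aestronglyMeasurable (Eventually.of_forall fun v => ?_)
  have h1 : Real.exp (-y * v ^ 2) ≤ 1 := by
    rw [Real.exp_le_one_iff]; nlinarith [sq_nonneg v]
  rw [Real.norm_of_nonneg (by positivity), sq]
  calc _ ≤ Real.exp (-y * v ^ 2) * 1 :=
        mul_le_mul (hn v) ((hn v).trans h1) (norm_nonneg _) (Real.exp_pos _).le
    _ = _ := mul_one _

/-- As a function of `τ`, `e^{y/2} K_{iτ}(y/2)` is the Fourier transform of a function of
`y sinh²(πv)`. -/
theorem fourier_exp_neg_sinhSq {y : ℝ} (hy : 0 < y) (τ : ℝ) :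
    Real.pi * 𝓕 (fun v => Complex.exp (-(y * sinhSq v : ℝ))) τ =
      Complex.exp (y / 2) * besselK (Complex.I * τ) (y / 2) := by
  have hpi := Real.pi_pos
  set F : ℝ → ℂ := fun v => Complex.exp ((-2 * Real.pi * v * τ : ℝ) * Complex.I) *
    Complex.exp (-(y * sinhSq v : ℝ)) with hF
  have hFi : Integrable F := by
    refine (integrable_and_memLp_exp_neg_sinhSq hy).1.bdd_mul (c := 1) (by fun_prop) ?_
    exact Eventually.of_forall fun v => (Complex.norm_exp_ofReal_mul_I _).le
  have hFi' : Integrable fun v => F (-v) := hFi.comp_neg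
  rw [Real.fourier_real_eq_integral_exp_smul]
  simp only [smul_eq_mul]
  rw [show (∫ v : ℝ, Complex.exp ((-2 * Real.pi * v * τ : ℝ) * Complex.I) *
    Complex.exp (-(y * sinhSq v : ℝ))) = ∫ v, F v from rfl,
    (integrable_of_Ioi hFi.integrableOn hFi'.integrableOn).2,
    ← integral_add hFi.integrableOn hFi'.integrableOn, besselK, ← integral_const_mul]
  have h := integral_comp_mul_left_Ioi (fun u : ℝ => Complex.exp (y / 2) *
    (Complex.exp (-(y / 2) * Real.cosh u) * Complex.cosh (Complex.I * τ * u))) 0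
    (show 0 < 2 * Real.pi by positivity)
  rw [mul_zero] at h
  have h' : ∫ u in Ioi (0 : ℝ), Complex.exp (y / 2) *
      (Complex.exp (-(y / 2) * Real.cosh u) * Complex.cosh (Complex.I * τ * u)) =
      2 * Real.pi * ∫ v in Ioi (0 : ℝ), Complex.exp (y / 2) *
      (Complex.exp (-(y / 2) * Real.cosh (2 * Real.pi * v)) *
        Complex.cosh (Complex.I * τ * (2 * Real.pi * v : ℝ))) := by
    rw [h, Complex.real_smul, ← mul_assoc]
    push_cast
    rw [mul_inv_cancel₀, one_mul]
    exact mul_ne_zero two_ne_zero (by exact_mod_cast hpi.ne')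
  rw [← integral_const_mul, h', ← integral_const_mul]
  congr 1
  ext v
  have hc : Real.cosh (2 * Real.pi * v) = 1 + 2 * sinhSq v := by
    rw [mul_assoc, Real.cosh_two_mul, Real.cosh_sq, sinhSq]; ring
  have hexp : Complex.exp (y / 2) * Complex.exp (-(y / 2) * Real.cosh (2 * Real.pi * v)) =
      Complex.exp (-(y * sinhSq v : ℝ)) := by
    rw [hc, ← Complex.exp_add]
    push_cast
    congr 1; ring
  have hcosh : 2 * Complex.cosh (Complex.I * τ * (2 * Real.pi * v : ℝ)) =
      Complex.exp ((-2 * Real.pi * v * τ : ℝ) * Complex.I) +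
        Complex.exp ((-2 * Real.pi * (-v) * τ : ℝ) * Complex.I) := by
    rw [Complex.cosh, mul_div_cancel₀ _ two_ne_zero, add_comm]
    congr 2 <;> · push_cast; ring
  rw [← mul_assoc (Complex.exp (y / 2)), hexp]
  simp only [hF, sinhSq_neg]
  linear_combination (-(Real.pi : ℂ) * Complex.exp (-(y * sinhSq v : ℝ))) * hcosh

/-! ### The index transform -/

theorem integrable_mul_of_memLp_two {f h : ℝ → ℂ} (hf : MemLp f 2 volume) (hh : MemLp h 2 volume) :
    Integrable fun v => f v * h v := hf.integrable_mul hh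

section Parameters

variable {α γ : ℝ}

theorem integrable_sinhSq_rpow_mul_norm (hγ : 0 < γ) (hγ₂ : γ < 1 / 4) {h : ℝ → ℂ}
    (hh : MemLp h 2 volume) : Integrable fun v => sinhSq v ^ (-γ) * ‖h v‖ :=
  (memLp_sinhSq_rpow hγ hγ₂).integrable_mul hh.norm

/-- Hölder's inequality, with the value of the beta integral `∫ sinh(πv)^(-4γ) dv`. -/
theorem integral_sinhSq_rpow_mul_norm_le (hγ : 0 < γ) (hγ₂ : γ < 1 / 4) {h : ℝ → ℂ}
    (hh : MemLp h 2 volume) :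
    ∫ v, sinhSq v ^ (-γ) * ‖h v‖ ≤
      Real.sqrt (Real.Gamma (1 / 2 - 2 * γ) * Real.Gamma (2 * γ) / (Real.pi * Real.sqrt Real.pi)) *
        (eLpNorm h 2 volume).toReal := by
  have hS : MemLp (fun v => sinhSq v ^ (-γ)) (ENNReal.ofReal 2) volume := by
    simpa using memLp_sinhSq_rpow hγ hγ₂
  have hh' : MemLp (fun v => ‖h v‖) (ENNReal.ofReal 2) volume := by
    simpa using hh.norm
  have h1 := integral_mul_le_Lp_mul_Lq_of_nonneg Real.HolderConjugate.two_two
    (Eventually.of_forall fun v => Real.rpow_nonneg (sinhSq_nonneg v) (-γ))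
    (Eventually.of_forall fun v => norm_nonneg (h v)) hS hh'
  refine h1.trans_eq ?_
  have hS2 : ∫ v, (sinhSq v ^ (-γ)) ^ (2 : ℝ) = ∫ v, sinhSq v ^ (-(2 * γ)) := by
    congr 1; ext v
    rw [← Real.rpow_mul (sinhSq_nonneg v)]; congr 1; ring
  rw [hS2, integral_sinhSq_rpow hγ hγ₂, ← Real.sqrt_eq_rpow,
    hh.eLpNorm_eq_integral_rpow_norm two_ne_zero ENNReal.ofNat_ne_top,
    ENNReal.toReal_ofReal (by positivity)]
  norm_num

/-- The Weber kernel is, almost everywhere in `τ`, the Fourier transform of a function in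
`L¹ ∩ L²`. -/
theorem weberKernel_ae_eq (hγ₁ : max (-α) 0 < γ) (hγ₂ : γ < 1 / 4) {x : ℝ} (hx : 0 < x) :
    (fun τ => (weberKernel α x τ : ℂ)) =ᵐ[volume] fun τ => 1 / (2 * Real.pi) *
      𝓕 (fun v => lineMellin γ (fun t => gammaQuot α (vline γ t)) (x * sinhSq v)) τ := by
  have hpi : (Real.pi : ℂ) ≠ 0 := by exact_mod_cast Real.pi_ne_zero
  have : ∀ᵐ τ : ℝ, τ ≠ 0 := by simp [ae_iff, measure_singleton]
  filter_upwards [this] with τ hτ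
  rw [fourier_lineMellin_gammaQuot hγ₁ hγ₂ hx hτ]
  field_simp

theorem integrable_weberKernel_mul (hγ₁ : max (-α) 0 < γ) (hγ₂ : γ < 1 / 4) {g : ℝ → ℂ}
    (hg : MemLp g 2 volume) {x : ℝ} (hx : 0 < x) :
    Integrable fun τ : ℝ => (weberKernel α x τ : ℂ) * g τ := by
  obtain ⟨_, hq⟩ := integrable_gammaQuot_vline hγ₁ hγ₂
  obtain ⟨i1, i2⟩ := integrable_and_memLp_lineMellin (max_lt_iff.1 hγ₁).2 hγ₂ hq hx
  refine (integrable_mul_of_memLp_two ((memLp_fourier i1 i2).const_mul (1 / (2 * Real.pi : ℂ))) hg).congr ?_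
  filter_upwards [weberKernel_ae_eq hγ₁ hγ₂ hx] with τ hτ
  rw [hτ]

/-- If `h` is the Plancherel transpose of `g`, then `G_α g` is a multiplicative convolution
against `h`. -/
theorem indexG_eq_integral (hγ₁ : max (-α) 0 < γ) (hγ₂ : γ < 1 / 4) {g h : ℝ → ℂ}
    (hgh : ∀ f : ℝ → ℂ, Integrable f → MemLp f 2 volume → ∫ τ, 𝓕 f τ * g τ = ∫ v, f v * h v)
    {x : ℝ} (hx : 0 < x) :
    indexG α g x = 1 / (2 * Real.pi) *
      ∫ v, lineMellin γ (fun t => gammaQuot α (vline γ t)) (x * sinhSq v) * h v := by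
  obtain ⟨_, hq⟩ := integrable_gammaQuot_vline hγ₁ hγ₂
  obtain ⟨i1, i2⟩ := integrable_and_memLp_lineMellin (max_lt_iff.1 hγ₁).2 hγ₂ hq hx
  rw [← hgh _ i1 i2, ← integral_const_mul, indexG]
  apply integral_congr_ae
  filter_upwards [weberKernel_ae_eq hγ₁ hγ₂ hx] with τ hτ
  rw [hτ, mul_assoc]

theorem norm_lineMellin_comp_sinhSq_mul_le (γ : ℝ) (q h : ℝ → ℂ) {x v : ℝ} (hx : 0 < x)
    (hv : 0 < sinhSq v) :
    ‖lineMellin γ q (x * sinhSq v) * h v‖ ≤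
      x ^ (-γ) * (∫ t, ‖q t‖) * (sinhSq v ^ (-γ) * ‖h v‖) := by
  rw [norm_mul]
  calc _ ≤ ((x * sinhSq v) ^ (-γ) * ∫ t, ‖q t‖) * ‖h v‖ := by
        gcongr; exact norm_lineMellin_le γ q (mul_pos hx hv)
    _ = _ := by rw [Real.mul_rpow hx.le hv.le]; ring

/-- The modulus of the kernel is bounded before any oscillation is used, and Hölder's inequality in
`v` then gives exactly the constant `boundConst`. -/
theorem norm_rpow_mul_indexG_le (hγ₁ : max (-α) 0 < γ) (hγ₂ : γ < 1 / 4) {g h : ℝ → ℂ}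
    (hh : MemLp h 2 volume)
    (hgh : ∀ f : ℝ → ℂ, Integrable f → MemLp f 2 volume → ∫ τ, 𝓕 f τ * g τ = ∫ v, f v * h v)
    {x : ℝ} (hx : 0 < x) :
    ‖((x ^ γ : ℝ) : ℂ) * indexG α g x‖ ≤ boundConst α γ * (eLpNorm h 2 volume).toReal := by
  have hγ : 0 < γ := (max_lt_iff.1 hγ₁).2
  have hpi := Real.pi_pos
  have hxγ : 0 < x ^ γ := Real.rpow_pos_of_pos hx γ
  set q : ℝ → ℂ := fun t => gammaQuot α (vline γ t)
  have hQ : 0 ≤ ∫ t, ‖q t‖ := integral_nonneg fun t => norm_nonneg _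
  have h1 : ‖∫ v, lineMellin γ q (x * sinhSq v) * h v‖ ≤
      x ^ (-γ) * (∫ t, ‖q t‖) * ∫ v, sinhSq v ^ (-γ) * ‖h v‖ := by
    rw [← integral_const_mul]
    apply norm_integral_le_of_norm_le
    · exact (integrable_sinhSq_rpow_mul_norm hγ hγ₂ hh).const_mul _
    · filter_upwards [ae_sinhSq_pos] with v hv
      exact norm_lineMellin_comp_sinhSq_mul_le γ q h hx hv
  have h2 := integral_sinhSq_rpow_mul_norm_le hγ hγ₂ hh
  set N := (eLpNorm h 2 volume).toReal
  set GG := Real.Gamma (1 / 2 - 2 * γ) * Real.Gamma (2 * γ) with hGG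
  have hGG0 : 0 ≤ GG :=
    mul_nonneg (Real.Gamma_nonneg_of_nonneg (by linarith)) (Real.Gamma_nonneg_of_nonneg (by linarith))
  have hc : 1 / (2 * Real.pi) * Real.sqrt (GG / (Real.pi * Real.sqrt Real.pi)) =
      1 / (2 * Real.pi ^ (7 / 4 : ℝ)) * Real.sqrt GG := by
    have e : Real.sqrt (Real.pi * Real.sqrt Real.pi) = Real.pi ^ (3 / 4 : ℝ) := by
      rw [Real.sqrt_eq_rpow, Real.sqrt_eq_rpow, ← Real.rpow_one_add' hpi.le (by norm_num),
        ← Real.rpow_mul hpi.le]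
      norm_num
    have e2 : Real.pi ^ (7 / 4 : ℝ) = Real.pi * Real.pi ^ (3 / 4 : ℝ) := by
      rw [← Real.rpow_one_add' hpi.le (by norm_num)]; norm_num
    rw [Real.sqrt_div hGG0, e, e2]
    field_simp
  have hxx : x ^ γ * x ^ (-γ) = 1 := by rw [← Real.rpow_add hx, add_neg_cancel, Real.rpow_zero]
  have hn : ‖((x ^ γ : ℝ) : ℂ) * indexG α g x‖ =
      x ^ γ * (1 / (2 * Real.pi) * ‖∫ v, lineMellin γ q (x * sinhSq v) * h v‖) := by
    rw [indexG_eq_integral hγ₁ hγ₂ hgh hx, norm_mul, norm_mul, Complex.norm_real,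
      Real.norm_of_nonneg hxγ.le, norm_div, norm_mul, Complex.norm_real, Real.norm_of_nonneg hpi.le,
      norm_one, Complex.norm_ofNat]
  have hb : boundConst α γ = 1 / (2 * Real.pi) *
      Real.sqrt (GG / (Real.pi * Real.sqrt Real.pi)) * ∫ t, ‖q t‖ := by
    rw [hc]; rfl
  rw [hn, hb]
  calc _ ≤ x ^ γ * (1 / (2 * Real.pi) * (x ^ (-γ) * (∫ t, ‖q t‖) *
        (Real.sqrt (GG / (Real.pi * Real.sqrt Real.pi)) * N))) := by
        gcongr
        exact h1.trans (by gcongr)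
    _ = _ := by linear_combination (1 / (2 * Real.pi) * ((∫ t, ‖q t‖) *
        (Real.sqrt (GG / (Real.pi * Real.sqrt Real.pi)) * N))) * hxx

theorem continuousOn_indexG (hγ₁ : max (-α) 0 < γ) (hγ₂ : γ < 1 / 4) {g h : ℝ → ℂ}
    (hh : MemLp h 2 volume)
    (hgh : ∀ f : ℝ → ℂ, Integrable f → MemLp f 2 volume → ∫ τ, 𝓕 f τ * g τ = ∫ v, f v * h v) :
    ContinuousOn (indexG α g) (Ioi 0) := by
  have hγ : 0 < γ := (max_lt_iff.1 hγ₁).2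
  obtain ⟨_, hq⟩ := integrable_gammaQuot_vline hγ₁ hγ₂
  have hcq := continuousOn_lineMellin hγ.le hq
  refine ContinuousOn.congr (f := fun x => 1 / (2 * Real.pi) *
    ∫ v, lineMellin γ (fun t => gammaQuot α (vline γ t)) (x * sinhSq v) * h v) ?_
    fun x hx => indexG_eq_integral hγ₁ hγ₂ hgh hx
  set q : ℝ → ℂ := fun t => gammaQuot α (vline γ t)
  have hQ : 0 ≤ ∫ t, ‖q t‖ := integral_nonneg fun t => norm_nonneg _
  refine continuousOn_const.mul fun x₀ hx₀ => ContinuousAt.continuousWithinAt ?_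
  have hx₀' : (0 : ℝ) < x₀ := hx₀
  have hnear : ∀ᶠ x in 𝓝 x₀, x₀ / 2 < x := eventually_gt_nhds (by linarith)
  apply continuousAt_of_dominated
    (bound := fun v => (x₀ / 2) ^ (-γ) * (∫ t, ‖q t‖) * (sinhSq v ^ (-γ) * ‖h v‖))
  · filter_upwards [hnear] with x hx
    exact (aestronglyMeasurable_comp_sinhSq hcq (by linarith)).mul hh.1
  · filter_upwards [hnear] with x hx
    filter_upwards [ae_sinhSq_pos] with v hv
    refine (norm_lineMellin_comp_sinhSq_mul_le γ q h (by linarith) hv).trans ?_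
    have : x ^ (-γ) ≤ (x₀ / 2) ^ (-γ) :=
      Real.rpow_le_rpow_of_nonpos (by linarith) hx.le (by linarith)
    have := Real.rpow_nonneg hv.le (-γ)
    gcongr
  · exact (integrable_sinhSq_rpow_mul_norm hγ hγ₂ hh).const_mul _
  · filter_upwards [ae_sinhSq_pos] with v hv
    refine ContinuousAt.mul ?_ continuousAt_const
    exact ContinuousAt.comp (f := fun x => x * sinhSq v)
      (hcq.continuousAt (Ioi_mem_nhds (mul_pos hx₀' hv))) (by fun_prop)

/-- `∫ sinh(πv)^(-2s) h(v) dv` on the line `Re s = γ`. -/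
noncomputable def phaseMellin (γ : ℝ) (h : ℝ → ℂ) (t : ℝ) : ℂ :=
  ∫ v, (sinhSq v : ℂ) ^ (-vline γ t) * h v

theorem continuous_phaseMellin (hγ : 0 < γ) (hγ₂ : γ < 1 / 4) {h : ℝ → ℂ}
    (hh : MemLp h 2 volume) : Continuous (phaseMellin γ h) := by
  have hm : Measurable fun v => (sinhSq v : ℂ) :=
    (Complex.continuous_ofReal.comp continuous_sinhSq).measurable
  apply continuous_of_dominated (bound := fun v => sinhSq v ^ (-γ) * ‖h v‖)
  · exact fun t => (hm.pow_const _).aestronglyMeasurable.mul hh.1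
  · intro t
    filter_upwards [ae_sinhSq_pos] with v hv
    rw [norm_mul, norm_cpow_neg_vline hv]
  · exact integrable_sinhSq_rpow_mul_norm hγ hγ₂ hh
  · filter_upwards [ae_sinhSq_pos] with v hv
    exact (continuous_cpow_neg_vline hv γ).mul continuous_const

theorem norm_phaseMellin_le (hγ : 0 < γ) (hγ₂ : γ < 1 / 4) {h : ℝ → ℂ}
    (hh : MemLp h 2 volume) (t : ℝ) :
    ‖phaseMellin γ h t‖ ≤ ∫ v, sinhSq v ^ (-γ) * ‖h v‖ := by
  apply norm_integral_le_of_norm_le (integrable_sinhSq_rpow_mul_norm hγ hγ₂ hh)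
  filter_upwards [ae_sinhSq_pos] with v hv
  rw [norm_mul, norm_cpow_neg_vline hv]

theorem integrable_mul_phaseMellin (hγ : 0 < γ) (hγ₂ : γ < 1 / 4) {q h : ℝ → ℂ}
    (hh : MemLp h 2 volume) (hq : Integrable q) :
    Integrable fun t => q t * phaseMellin γ h t :=
  hq.mul_bdd (continuous_phaseMellin hγ hγ₂ hh).aestronglyMeasurable
    (Eventually.of_forall (norm_phaseMellin_le hγ hγ₂ hh))

/-- Parseval's identity for the Mellin transform, in the phase variable. -/
theorem integral_lineMellin_comp_sinhSq_mul (hγ : 0 < γ) (hγ₂ : γ < 1 / 4) {q h : ℝ → ℂ}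
    (hh : MemLp h 2 volume) (hq : Integrable q) {z : ℝ} (hz : 0 < z) :
    ∫ v, lineMellin γ q (z * sinhSq v) * h v =
      lineMellin γ (fun t => q t * phaseMellin γ h t) z := by
  rw [integral_lineMellin_comp_sinhSq hq hz hh.1 (integrable_sinhSq_rpow_mul_norm hγ hγ₂ hh),
    lineMellin]
  congr 1; ext t
  rw [phaseMellin]; ring

/-- The Mellin transform of `G_α g` factors into the Mellin transform of the kernel in the variable
`x sinh²(πv)` and that of `h`. -/
theorem mellin_indexG (hγ₁ : max (-α) 0 < γ) (hγ₂ : γ < 1 / 4) {g h : ℝ → ℂ}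
    (hh : MemLp h 2 volume)
    (hgh : ∀ f : ℝ → ℂ, Integrable f → MemLp f 2 volume → ∫ τ, 𝓕 f τ * g τ = ∫ v, f v * h v)
    (hG : MemLWeighted γ (indexG α g)) (t : ℝ) :
    mellin (indexG α g) (vline γ t) = gammaQuot α (vline γ t) * phaseMellin γ h t := by
  have hγ : 0 < γ := (max_lt_iff.1 hγ₁).2
  obtain ⟨hqc, hq⟩ := integrable_gammaQuot_vline hγ₁ hγ₂
  refine mellin_eq_of_eq_lineMellin (q := fun t => gammaQuot α (vline γ t) * phaseMellin γ h t)
    (hqc.mul (continuous_phaseMellin hγ hγ₂ hh)) (integrable_mul_phaseMellin hγ hγ₂ hh hq)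
    (fun x hx => ?_) hG t
  rw [indexG_eq_integral hγ₁ hγ₂ hgh hx, integral_lineMellin_comp_sinhSq_mul hγ hγ₂ hh hq hx]

/-- The multiplier turns the Mellin transform of the Weber kernel (in the variable `x sinh²(πv)`)
into that of `e^{-x} / π`. -/
theorem multiplier_mul_gammaQuot (hγ₁ : max (-α) 0 < γ) (hγ₂ : γ < 1 / 4) (t : ℝ) :
    multiplier α (vline γ t) * gammaQuot α (vline γ t) =
      1 / Real.pi * Complex.Gamma (vline γ t) := by
  obtain ⟨hα, hγ⟩ := max_lt_iff.1 hγ₁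
  have hre : (vline γ t).re = γ := vline_re γ t
  set s := vline γ t
  have g1 : Complex.Gamma (α + s) ≠ 0 :=
    Complex.Gamma_ne_zero_of_re_pos (by simp [hre]; linarith)
  have g2 : Complex.Gamma (1 - s) ≠ 0 :=
    Complex.Gamma_ne_zero_of_re_pos (by simp [hre]; linarith)
  have g3 : Complex.Gamma (1 + α - s) ≠ 0 :=
    Complex.Gamma_ne_zero_of_re_pos (by simp [hre]; linarith)
  have hsin := (sin_pi_mul_eq (s := s) (by rwa [hre]) (by rw [hre]; linarith)).2
  rw [multiplier, gammaQuot, add_comm s, div_eq_mul_inv _ (Complex.sin _ * _), mul_inv, hsin]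
  field_simp

/-- The inversion formula. Both sides equal `π⁻¹ ∫ exp(-y sinh²(πv)) h(v) dv`: the left one by the
Cahen–Mellin integral, the right one by Plancherel. -/
theorem integral_multiplier_mul_mellin_indexG (hγ₁ : max (-α) 0 < γ) (hγ₂ : γ < 1 / 4) {g h : ℝ → ℂ}
    (hg : MemLp g 2 volume) (hh : MemLp h 2 volume)
    (hgh : ∀ f : ℝ → ℂ, Integrable f → MemLp f 2 volume → ∫ τ, 𝓕 f τ * g τ = ∫ v, f v * h v)
    (hG : MemLWeighted γ (indexG α g)) {y : ℝ} (hy : 0 < y) :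
    Integrable (fun t : ℝ => multiplier α (vline γ t) * mellin (indexG α g) (vline γ t) *
        (y : ℂ) ^ (-vline γ t)) ∧
      Integrable (fun τ : ℝ => Complex.exp (y / 2) * besselK (Complex.I * τ) (y / 2) * g τ) ∧
      1 / (2 * (Real.pi : ℂ)) *
          ∫ t : ℝ, multiplier α (vline γ t) * mellin (indexG α g) (vline γ t) *
            (y : ℂ) ^ (-vline γ t) =
        1 / (Real.pi : ℂ) ^ 2 *
          ∫ τ : ℝ, Complex.exp (y / 2) * besselK (Complex.I * τ) (y / 2) * g τ := by
  have hγ : 0 < γ := (max_lt_iff.1 hγ₁).2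
  have hpi : (Real.pi : ℂ) ≠ 0 := by exact_mod_cast Real.pi_ne_zero
  have hΓ := integrable_Gamma_vline hγ
  obtain ⟨i1, i2⟩ := integrable_and_memLp_exp_neg_sinhSq hy
  have e1 : ∀ t : ℝ, multiplier α (vline γ t) * mellin (indexG α g) (vline γ t) *
      (y : ℂ) ^ (-vline γ t) = 1 / Real.pi *
        (Complex.Gamma (vline γ t) * phaseMellin γ h t * (y : ℂ) ^ (-vline γ t)) := by
    intro t
    rw [mellin_indexG hγ₁ hγ₂ hh hgh hG, ← mul_assoc, multiplier_mul_gammaQuot hγ₁ hγ₂]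
    ring
  have e2 : ∀ τ : ℝ, Complex.exp (y / 2) * besselK (Complex.I * τ) (y / 2) * g τ =
      Real.pi * (𝓕 (fun v => Complex.exp (-(y * sinhSq v : ℝ))) τ * g τ) := by
    intro τ
    rw [← fourier_exp_neg_sinhSq hy τ, mul_assoc]
  simp only [e1, e2]
  refine ⟨?_, (integrable_mul_of_memLp_two (memLp_fourier i1 i2) hg).const_mul _, ?_⟩
  · exact (integrable_mul_cpow_neg_vline (integrable_mul_phaseMellin hγ hγ₂ hh hΓ) hy).const_mul _
  · have h1 := integral_lineMellin_comp_sinhSq_mul hγ hγ₂ hh hΓ hy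
    have h2 : ∫ v, lineMellin γ (fun t => Complex.Gamma (vline γ t)) (y * sinhSq v) * h v =
        2 * Real.pi * ∫ v, Complex.exp (-(y * sinhSq v : ℝ)) * h v := by
      rw [← integral_const_mul]
      apply integral_congr_ae
      filter_upwards [ae_sinhSq_pos] with v hv
      rw [lineMellin_Gamma hγ (mul_pos hy hv), mul_assoc]
    rw [integral_const_mul, integral_const_mul, hgh _ i1 i2]
    rw [h2, lineMellin] at h1
    rw [← h1]
    field_simp

end Parameters

end Fourier

theorem theorem4 (α γ : ℝ) (hγ₁ : max (-α) 0 < γ) (hγ₂ : γ < 1 / 4)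
    (g : ℝ → ℂ) (hg : MemLp g 2 volume) :
    (∀ x : ℝ, 0 < x → Integrable (fun τ : ℝ => (weberKernel α x τ : ℂ) * g τ)) ∧
    ContinuousOn (fun x : ℝ => ((x ^ γ : ℝ) : ℂ) * indexG α g x) (Ioi 0) ∧
    Integrable (constIntegrand α γ) ∧
    (∀ x : ℝ, 0 < x →
      ‖((x ^ γ : ℝ) : ℂ) * indexG α g x‖ ≤ boundConst α γ * (eLpNorm g 2 volume).toReal) ∧
    (MemLWeighted γ (indexG α g) → MellinDecay γ (indexG α g) →
      ∀ y : ℝ, 0 < y →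
        Integrable (fun t : ℝ => multiplier α (vline γ t) * mellin (indexG α g) (vline γ t) *
          (y : ℂ) ^ (-vline γ t)) ∧
        Integrable (fun τ : ℝ => Complex.exp (y / 2) * besselK (Complex.I * τ) (y / 2) * g τ) ∧
        1 / (2 * (Real.pi : ℂ)) *
            ∫ t : ℝ, multiplier α (vline γ t) * mellin (indexG α g) (vline γ t) *
              (y : ℂ) ^ (-vline γ t) =
          1 / (Real.pi : ℂ) ^ 2 *
            ∫ τ : ℝ, Complex.exp (y / 2) * besselK (Complex.I * τ) (y / 2) * g τ) := by
  have hγ : 0 < γ := (max_lt_iff.1 hγ₁).2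
  obtain ⟨h, hh, hnorm, hgh⟩ := exists_fourier_transpose hg
  refine ⟨fun x hx => integrable_weberKernel_mul hγ₁ hγ₂ hg hx, ?_,
    (integrable_gammaQuot_vline hγ₁ hγ₂).2.norm, fun x hx => ?_,
    fun hG _ y hy => integral_multiplier_mul_mellin_indexG hγ₁ hγ₂ hg hh hgh hG hy⟩
  · refine ContinuousOn.mul ?_ (continuousOn_indexG hγ₁ hγ₂ hh hgh)
    exact Complex.continuous_ofReal.comp_continuousOn
      (continuousOn_id.rpow_const fun x _ => Or.inr hγ.le)
  · rw [← hnorm]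
    exact norm_rpow_mul_indexG_le hγ₁ hγ₂ hh hgh hx
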